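/- Let $\mathfrak k$ be a real two-step nilpotent Lie algebra (that is, $[\mathfrak k,[\mathfrak k,\mathfrak k]]=0$) of dimension $q$ with centre $\mathfrak z$ of dimension $p\le q$, let $\mathfrak h$ be a real Lie algebra of dimension $p$, let $\phi:\mathfrak h\to\mathfrak{der}(\mathfrak k)$ be a Lie algebra homomorphism, and let $G$ be a Lie group of dimension $n=p+q\ge 3$ whose Lie algebra is (isomorphic to) the semi-direct sum $\mathfrak g=\mathfrak h\ltimes_\phi\mathfrak k$. Fix a basis $(e_{\bar a})_{\bar a=1,\dots,p}$ of $\mathfrak h$, a basis $(e_a)_{a=1,\dots,p}$ of $\mathfrak z$, and complete the latter by $(e_A)_{A=1,\dots,q-p}$ to a basis of $\mathfrak k$. View these as left-invariant vector fields on $G$, and let $\Theta^{\bar a},\Theta^a,\Theta^A$ be the dual left-invariant one-forms. Let $(g_{a\bar c})$ be an invertible real matrix, let $(g_{AB})$ be an invertible symmetric real matrix with inverse $(g^{AB})$, and let $$g=\sum_{a,\bar c}g_{a\bar c}\,(\Theta^a\otimes\Theta^{\bar c}+\Theta^{\bar c}\otimes\Theta^a)+\sum_{A,B}g_{AB}\,\Theta^A\otimes\Theta^B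 ,$$ a left-invariant pseudo-Riemannian metric on $G$. Put $R_{\bar a\bar c}=\mathrm{Ric}^g(e_{\bar a},e_{\bar c})$ and $\Delta f=\sum_{A,B} g^{AB}e_A(e_B f)$. Let $F_{\bar a\bar c}=F_{\bar c\bar a}$ be smooth functions on $G$ with $dF_{\bar a\bar c}(e_a)=0$ for all $a$, and consider on $(0,\infty)\times G\times\mathbb R$, with coordinates $t$ and $\rho$ on the first and the last factor, $$\widetilde g_F=2\,d(\rho t)\,dt+t^2\Big(g+\sum_{\bar a,\bar c}\Big(\tfrac{2\rho}{n-2}R_{\bar a\bar c}+\rho^{n/2}\Big(F_{\bar a\bar c}+\sum_{k=1}^\infty\frac{\Delta^kF_{\bar a\bar c}}{k!\prod_{i=1}^k(2i+n)}\rho^k\Big)\Big)\Theta^{\bar a}\otimes\Theta^{\bar c}\Big),$$ where for $n$ odd and $\rho<0$ the factor $\rho^{n/2}$ is read as $|\rho|^{n/2}$. Then: 1. On each open set $\Omega\subset G\times\mathbb R$ of points $(x,\rho)$ on which the series converge to smooth functions, locally uniformly together with their first and second derivatives in the directions of $G$, $\widetilde g_F$ is a Ricci-flat ambient metric for the conformal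 class of $g$: it is a pseudo-Riemannian metric $2\,d(\rho t)\,dt+t^2\gamma(x,\rho)$ on $(0,\infty)\times\Omega$ with $\gamma(x,0)=g(x)$ where $(x,0)\in\Omega$, it is smooth if $n$ is even, and of class $C^2$ and smooth away from $\rho=0$ if $n$ is odd, and its Ricci tensor vanishes. 2. For arbitrary such $F_{\bar a\bar c}$ and every $N\ge 0$, let $\widetilde g_{F,N}$ be given by the same formula with the sum over $k$ stopped at $k=N$. It is a metric of the same form and of class $C^\infty$ ($n$ even) or $C^2$ ($n$ odd), and its Ricci tensor, in the frame $\partial_t,e_i,\partial_\rho$, is $O(|\rho|^{n/2+N})$ near each point with $\rho=0$; that is, $\widetilde g_F$ is Ricci-flat as a formal series in $\rho$. 3. For $F_{\bar a\bar c}\equiv0$, $\widetilde g_0=2\,d(\rho t)\,dt+t^2\big(g+\sum_{\bar a,\bar c}\tfrac{2\rho}{n-2}R_{\bar a\bar c}\Theta^{\bar a}\otimes\Theta^{\bar c}\big)$ is a smooth Ricci-flat metric on all of $(0,\infty)\times G\times\mathbb R$, and it is analytic in $\rho$. If $n$ is odd, it is the unique analytic Ricci-flat ambient metric of $g$: if $\Omega\subset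 G\times\mathbb R$ is open and contains $(x,s\rho)$ for all $(x,\rho)\in\Omega$ and $s\in[0,1]$, and $2\,d(\rho t)\,dt+t^2\gamma(x,\rho)$ is any smooth Ricci-flat pseudo-Riemannian metric on $(0,\infty)\times\Omega$ that is real-analytic in $\rho$ and satisfies $\gamma(x,0)=g(x)$ when $(x,0)\in\Omega$, then it equals $\widetilde g_0$ on $(0,\infty)\times\Omega$. -/

import Mathlib

open scoped Manifold ContDiff Topology
open VectorField Asymptotics

noncomputable section

/-! ### The Ricci tensor of a pseudo-Riemannian metric in a frame -/

section Frame

variable {EM : Type*} [NormedAddCommGroup EM] [NormedSpace ℝ EM]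
  {HM : Type*} [TopologicalSpace HM] (J : ModelWithCorners ℝ EM HM)
  {M : Type*} [TopologicalSpace M] [ChartedSpace HM M]

/-- A field of bilinear forms on the tangent spaces of a manifold. -/
abbrev BilinField (M : Type*) [TopologicalSpace M] [ChartedSpace HM M] :=
  ∀ x : M, TangentSpace J x →ₗ[ℝ] TangentSpace J x →ₗ[ℝ] ℝ

variable {J} {ι : Type*} [Fintype ι] [DecidableEq ι]

/-- The derivative `X(f)` of a function in the direction of a vector field. -/
def dirDeriv (X : ∀ x : M, TangentSpace J x) (f : M → ℝ) (x : M) : ℝ :=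
  mfderiv J 𝓘(ℝ, ℝ) f x (X x)

/-- The components `g_{ij} = g(e_i, e_j)`. -/
def gram (g : BilinField J M) (e : ι → ∀ x : M, TangentSpace J x) (x : M) : Matrix ι ι ℝ :=
  Matrix.of fun i j => g x (e i x) (e j x)

/-- `g(∇_{e_i} e_j, e_k)` for the Levi-Civita connection `∇` of `g`, by the Koszul formula. -/
def koszul (g : BilinField J M) (e : ι → ∀ x : M, TangentSpace J x) (i j k : ι) (x : M) : ℝ :=
  (1 / 2) *
    (dirDeriv (e i) (fun y => gram g e y j k) x
      + dirDeriv (e j) (fun y => gram g e y i k) x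
      - dirDeriv (e k) (fun y => gram g e y i j) x
      + g x (mlieBracket J (e i) (e j) x) (e k x)
      - g x (mlieBracket J (e i) (e k) x) (e j x)
      - g x (mlieBracket J (e j) (e k) x) (e i x))

/-- The connection coefficients `Γ^k_{ij}`, given by `∇_{e_i} e_j = Γ^k_{ij} e_k`. -/
def connCoeff (g : BilinField J M) (e : ι → ∀ x : M, TangentSpace J x) (k i j : ι) (x : M) : ℝ :=
  ∑ l, (gram g e x)⁻¹ k l * koszul g e i j l x

/-- The components `Ric(e_j, e_k)` of the Ricci tensor `Ric(Y, Z) = tr (X ↦ R(X, Y) Z)`, where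
`R(X, Y) Z = ∇_X ∇_Y Z - ∇_Y ∇_X Z - ∇_{[X, Y]} Z`; here `[e_i, e_j] = (Γ^m_{ij} - Γ^m_{ji}) e_m`
because the Levi-Civita connection is torsion free. -/
def ricci (g : BilinField J M) (e : ι → ∀ x : M, TangentSpace J x) (j k : ι) (x : M) : ℝ :=
  ∑ i, (dirDeriv (e i) (connCoeff g e i j k) x - dirDeriv (e j) (connCoeff g e i i k) x
    + ∑ m, (connCoeff g e m j k x * connCoeff g e i i m x
      - connCoeff g e m i k x * connCoeff g e i j m x
      - (connCoeff g e m i j x - connCoeff g e m j i x) * connCoeff g e i m k x))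

end Frame

section LieGroups

variable {E : Type*} [NormedAddCommGroup E] [NormedSpace ℝ E]
  {G : Type*} [TopologicalSpace G] [ChartedSpace E G] [Group G]

instance instLieGroupMinSmoothness [LieGroup 𝓘(ℝ, E) ∞ G] :
    LieGroup 𝓘(ℝ, E) (minSmoothness ℝ 3) G := by
  rw [minSmoothness_of_isRCLikeNormedField]; infer_instance

/-! ### Ambient metrics over a Lie group

The ambient space is `ℝ × G × ℝ` with points `(t, x, ρ)`. -/

/-- The model with corners of the ambient space. -/
abbrev ambientModel (E : Type*) [NormedAddCommGroup E] [NormedSpace ℝ E] :=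
  𝓘(ℝ, ℝ).prod (𝓘(ℝ, E).prod 𝓘(ℝ, ℝ))

/-- A family of bilinear forms on the tangent spaces of `G` that depends on a parameter `ρ`. -/
abbrev BilinFamily (E G : Type*) [NormedAddCommGroup E] [NormedSpace ℝ E]
    [TopologicalSpace G] [ChartedSpace E G] :=
  ∀ x : G, ℝ → TangentSpace 𝓘(ℝ, E) x →ₗ[ℝ] TangentSpace 𝓘(ℝ, E) x →ₗ[ℝ] ℝ

/-- The differential of the coordinate `t`. -/
def formDt (P : ℝ × G × ℝ) : TangentSpace (ambientModel E) P →ₗ[ℝ] ℝ :=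
  (mfderiv (ambientModel E) 𝓘(ℝ, ℝ) (fun Q : ℝ × G × ℝ => Q.1) P).toLinearMap

/-- The differential of the function `ρ t`. -/
def formDrt (P : ℝ × G × ℝ) : TangentSpace (ambientModel E) P →ₗ[ℝ] ℝ :=
  (mfderiv (ambientModel E) 𝓘(ℝ, ℝ) (fun Q : ℝ × G × ℝ => Q.2.2 * Q.1) P).toLinearMap

/-- The differential of the projection to `G`. -/
def projG (P : ℝ × G × ℝ) :
    TangentSpace (ambientModel E) P →ₗ[ℝ] TangentSpace 𝓘(ℝ, E) P.2.1 :=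
  (mfderiv (ambientModel E) 𝓘(ℝ, E) (fun Q : ℝ × G × ℝ => Q.2.1) P).toLinearMap

/-- The ambient metric `2 d(ρt) dt + t² γ(ρ)`, with `2 α β = α ⊗ β + β ⊗ α` for one-forms. -/
def ambientMetric (γ : BilinFamily E G) : BilinField (ambientModel E) (ℝ × G × ℝ) :=
  fun P => (formDrt P).smulRight (formDt P) + (formDt P).smulRight (formDrt P)
    + P.1 ^ 2 • (γ P.2.1 P.2.2).compl₁₂ (projG P) (projG P)

variable {κ : Type*} [Fintype κ] [DecidableEq κ]

/-- The left-invariant frame of `G` given by a basis of the Lie algebra. -/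
def leftFrame (b : Module.Basis κ ℝ (GroupLieAlgebra 𝓘(ℝ, E) G)) (i : κ) (x : G) :
    TangentSpace 𝓘(ℝ, E) x :=
  mulInvariantVectorField (b i) x

/-- The frame `∂_t, e_i, ∂_ρ` of the ambient space, where `(e_i)` is the left-invariant frame
of `G`. -/
def ambientFrame (b : Module.Basis κ ℝ (GroupLieAlgebra 𝓘(ℝ, E) G)) :
    Unit ⊕ κ ⊕ Unit → ∀ P : ℝ × G × ℝ, TangentSpace (ambientModel E) P
  | .inl _, _ => ((1 : ℝ), (0 : E), (0 : ℝ))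
  | .inr (.inl i), P => ((0 : ℝ), (leftFrame b i P.2.1 : E), (0 : ℝ))
  | .inr (.inr _), _ => ((0 : ℝ), (0 : E), (1 : ℝ))

/-- `γ` defines, over the open set `Ω` of points `(x, ρ)`, a metric in normal form with respect
to `g`: each `γ(x, ρ)` is symmetric and nondegenerate, depends on `(x, ρ)` in a `C^m` manner, and
`γ(x, 0) = g(x)`. -/
structure IsNormalForm (m : ℕ∞ω) (g : BilinField 𝓘(ℝ, E) G) (γ : BilinFamily E G)
    (Ω : Set (G × ℝ)) : Prop where
  symm : ∀ y ∈ Ω, ∀ v w, γ y.1 y.2 v w = γ y.1 y.2 w v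
  nondeg : ∀ y ∈ Ω, ∀ v, (∀ w, γ y.1 y.2 v w = 0) → v = 0
  contMDiffOn : ∀ v w : GroupLieAlgebra 𝓘(ℝ, E) G,
    ContMDiffOn (𝓘(ℝ, E).prod 𝓘(ℝ, ℝ)) 𝓘(ℝ, ℝ) m
      (fun y : G × ℝ => γ y.1 y.2 (mulInvariantVectorField v y.1) (mulInvariantVectorField w y.1)) Ω
  initial : ∀ x, (x, (0 : ℝ)) ∈ Ω → γ x 0 = g x

/-- The metric `2 d(ρt) dt + t² γ(ρ)` is Ricci-flat at all `(t, x, ρ)` with `t > 0` and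
`(x, ρ) ∈ Ω`. -/
def IsAmbientRicciFlat (b : Module.Basis κ ℝ (GroupLieAlgebra 𝓘(ℝ, E) G)) (γ : BilinFamily E G)
    (Ω : Set (G × ℝ)) : Prop :=
  ∀ i j, ∀ P : ℝ × G × ℝ, 0 < P.1 → P.2 ∈ Ω →
    ricci (ambientMetric γ) (ambientFrame b) i j P = 0

/-- `ρ ↦ γ(x, ρ)` is real-analytic at all points of `Ω`. -/
def IsAnalyticInRho (γ : BilinFamily E G) (Ω : Set (G × ℝ)) : Prop :=
  ∀ y ∈ Ω, ∀ v w, AnalyticAt ℝ (fun ρ => γ y.1 ρ v w) y.2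

/-! ### Left-invariant one-forms and derivatives -/

/-- The differential of the left translation that moves `x` to the unit element. -/
def toLieAlgebra (x : G) : TangentSpace 𝓘(ℝ, E) x →L[ℝ] GroupLieAlgebra 𝓘(ℝ, E) G :=
  mfderiv 𝓘(ℝ, E) 𝓘(ℝ, E) (fun y : G => x⁻¹ * y) x

/-- The left-invariant one-forms `Θ^i` dual to the frame `(e_i)`. -/
def coframe (b : Module.Basis κ ℝ (GroupLieAlgebra 𝓘(ℝ, E) G)) (i : κ) (x : G) :
    TangentSpace 𝓘(ℝ, E) x →ₗ[ℝ] ℝ :=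
  b.coord i ∘ₗ (toLieAlgebra x).toLinearMap

/-- The derivative of a function on `G` along the left-invariant vector field given by `v`. -/
def leftDeriv (v : GroupLieAlgebra 𝓘(ℝ, E) G) (f : G → ℝ) : G → ℝ :=
  dirDeriv (J := 𝓘(ℝ, E)) (mulInvariantVectorField v) f

/-! ### The metrics of the theorem

The index set `Fin p ⊕ Fin r ⊕ Fin p` is that of a basis `(e_a, e_A, e_ā)` of `𝔤`, where `(e_a)`
is a basis of the centre `𝔷` of `𝔨`, where `(e_A)` completes it to a basis of `𝔨`, and where
`(e_ā)` is a basis of `𝔥`. The dimension of `G` is `2 * p + r`. -/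

/-- The index set of an adapted basis. -/
abbrev AdaptedIndex (p r : ℕ) := Fin p ⊕ Fin r ⊕ Fin p

/-- The index of `e_a ∈ 𝔷`. -/
abbrev iz {p r : ℕ} (a : Fin p) : AdaptedIndex p r := .inl a

/-- The index of `e_A`. -/
abbrev im {p r : ℕ} (A : Fin r) : AdaptedIndex p r := .inr (.inl A)

/-- The index of `e_ā ∈ 𝔥`. -/
abbrev ih {p r : ℕ} (a : Fin p) : AdaptedIndex p r := .inr (.inr a)

/-- The basis of a semi-direct sum `𝔤 = 𝔥 ⋉ 𝔨` composed of a basis of `𝔨` and a basis of `𝔥`. -/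
def adaptedBasis {𝔥 𝔨 : Type*} [LieRing 𝔥] [LieAlgebra ℝ 𝔥] [LieRing 𝔨] [LieAlgebra ℝ 𝔨]
    (φ : 𝔥 →ₗ⁅ℝ⁆ LieDerivation ℝ 𝔨 𝔨) {p r : ℕ}
    (bk : Module.Basis (Fin p ⊕ Fin r) ℝ 𝔨) (bh : Module.Basis (Fin p) ℝ 𝔥) :
    Module.Basis (AdaptedIndex p r) ℝ (LieAlgebra.SemiDirectSum 𝔨 𝔥 φ) :=
  ((bk.prod bh).map (LieAlgebra.SemiDirectSum.toProdl φ).symm).reindex (Equiv.sumAssoc _ _ _)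

variable {p r : ℕ} (b : Module.Basis (AdaptedIndex p r) ℝ (GroupLieAlgebra 𝓘(ℝ, E) G))
  (gz : Matrix (Fin p) (Fin p) ℝ) (gm : Matrix (Fin r) (Fin r) ℝ)

/-- The left-invariant metric
`2 g_{ac̄} Θ^a ∘ Θ^c̄ + g_{AB} Θ^A ∘ Θ^B`, where `2 Θ^a ∘ Θ^c̄ = Θ^a ⊗ Θ^c̄ + Θ^c̄ ⊗ Θ^a`. -/
def leftMetric : BilinField 𝓘(ℝ, E) G := fun x =>
  ∑ a, ∑ c, gz a c • ((coframe b (iz a) x).smulRight (coframe b (ih c) x)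
      + (coframe b (ih c) x).smulRight (coframe b (iz a) x))
    + ∑ A, ∑ B, gm A B • (coframe b (im A) x).smulRight (coframe b (im B) x)

/-- The operator `Δ f = g^{AB} e_A (e_B f)`, with `(g^{AB})` the inverse matrix of `(g_{AB})`. -/
def lapl (f : G → ℝ) (x : G) : ℝ :=
  ∑ A, ∑ B, gm⁻¹ A B * leftDeriv (b (im A)) (leftDeriv (b (im B)) f) x

/-- The function `Δ^k F / (k! ∏_{i=1}^k (2i + n))` with `n = 2p + r`. -/
def serCoeff (F : G → ℝ) (k : ℕ) (x : G) : ℝ :=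
  ((lapl b gm)^[k] F) x / (k.factorial * ∏ i ∈ Finset.Icc 1 k, (2 * (i : ℝ) + (2 * p + r : ℕ)))

/-- The coefficient for `k = 0` is `F`. -/
theorem serCoeff_zero (F : G → ℝ) : serCoeff b gm F 0 = F := by
  funext x; simp [serCoeff]

/-- The sum `F + ∑_{k ≥ 1} Δ^k F / (k! ∏_{i=1}^k (2i + n)) ρ^k`. -/
def serSum (F : G → ℝ) (x : G) (ρ : ℝ) : ℝ := ∑' k : ℕ, serCoeff b gm F k x * ρ ^ k

/-- The part `F + ∑_{k = 1}^N Δ^k F / (k! ∏_{i=1}^k (2i + n)) ρ^k` of the series. -/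
def serPartial (N : ℕ) (F : G → ℝ) (x : G) (ρ : ℝ) : ℝ :=
  ∑ k ∈ Finset.range (N + 1), serCoeff b gm F k x * ρ ^ k

/-- On the set `Ω` of points `(x, ρ)` the series converges to a smooth function, locally
uniformly together with its first and second derivatives in the directions of `G`. -/
structure SeriesConverges (F : G → ℝ) (Ω : Set (G × ℝ)) : Prop where
  summable : SummableLocallyUniformlyOn
    (fun (k : ℕ) (y : G × ℝ) => serCoeff b gm F k y.1 * y.2 ^ k) Ω
  summable_deriv : ∀ v : GroupLieAlgebra 𝓘(ℝ, E) G, SummableLocallyUniformlyOn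
    (fun (k : ℕ) (y : G × ℝ) => leftDeriv v (serCoeff b gm F k) y.1 * y.2 ^ k) Ω
  summable_deriv_deriv : ∀ v w : GroupLieAlgebra 𝓘(ℝ, E) G, SummableLocallyUniformlyOn
    (fun (k : ℕ) (y : G × ℝ) => leftDeriv v (leftDeriv w (serCoeff b gm F k)) y.1 * y.2 ^ k) Ω
  smooth : ContMDiffOn (𝓘(ℝ, E).prod 𝓘(ℝ, ℝ)) 𝓘(ℝ, ℝ) ∞
    (fun y : G × ℝ => serSum b gm F y.1 y.2) Ω

/-- The function `ρ^{n/2}`; for odd `n` and `ρ < 0` it is read as `|ρ|^{n/2}`. -/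
def halfPow (n : ℕ) (ρ : ℝ) : ℝ := if Even n then ρ ^ (n / 2) else |ρ| ^ ((n : ℝ) / 2)

/-- The family of metrics
`g + (2ρ/(n-2) R_{āc̄} + ρ^{n/2} f_{āc̄}(x, ρ)) Θ^ā Θ^c̄`, where `n = 2p + r` and
`R_{āc̄} = Ric^g(e_ā, e_c̄)`. -/
def ambientFamily (f : Fin p → Fin p → G → ℝ → ℝ) : BilinFamily E G := fun x ρ =>
  leftMetric b gz gm x
    + ∑ a, ∑ c,
      (2 * ρ / (((2 * p + r : ℕ) : ℝ) - 2)
          * ricci (leftMetric b gz gm) (leftFrame b) (ih a) (ih c) x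
        + halfPow (2 * p + r) ρ * f a c x ρ)
      • (coframe b (ih a) x).smulRight (coframe b (ih c) x)

/-- The functions `F_{āc̄} = F_{c̄ā}` are smooth and annihilated by the elements of `𝔷`. -/
structure IsAdmissible (F : Fin p → Fin p → G → ℝ) : Prop where
  smooth : ∀ a c, ContMDiff 𝓘(ℝ, E) 𝓘(ℝ, ℝ) ∞ (F a c)
  symm : ∀ a c, F a c = F c a
  annihilated : ∀ a c d x, leftDeriv (b (iz d)) (F a c) x = 0

end LieGroups

end

noncomputable section

/-! ### Directional derivatives and Lie brackets on manifolds -/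

section Calculus

variable {EM : Type*} [NormedAddCommGroup EM] [NormedSpace ℝ EM]
  {HM : Type*} [TopologicalSpace HM] {J : ModelWithCorners ℝ EM HM}
  {M : Type*} [TopologicalSpace M] [ChartedSpace HM M]

/-! Give `e_a`, `e_A`, `e_ā` the weights 2, 1, 0. Since `𝔨` is a two-step nilpotent ideal and
derivations preserve its centre, a structure constant `c^k_{ij}` can be nonzero only if `wt i + wt j
≤ wt k` (`isGradedBasis_adaptedBasis`). The metric `g` pairs weight `w` only with weight `2 - w`,
and a perturbation `h = h_{āc̄} Θ^ā Θ^c̄` lives in weights (0, 0). Hence `h g⁻¹ h = 0`, the inverse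
of `g + h` is `g⁻¹ - g⁻¹ h g⁻¹`, and the connection coefficients of `g + h` obey the same weight
inequality, with a strict gain in the part that depends on `h` when `h` is annihilated by `𝔷`
(`wt_of_connCorr_ne_zero`).

A quadratic term of the Ricci tensor contracts two connection coefficients. Adding their
inequalities cancels the contracted weights, so these terms survive only in the directions of `𝔥`
and do not see `h` (`constRic_eq_zero`, `constRic_add`). The shape operator `½ γ⁻¹ ∂_ρ γ` takes
weight 0 to weight 2, so its trace and its square vanish. Thus the Ricci tensor of `2 d(ρt) dt + t²
γ`, computed for general `γ` in `ricci_ambientFrame`, reduces for `γ = g + h` to a linear expression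
in each component, and Ricci-flatness becomes `ρ h'' + (1 - n/2) h' + R - ½ Δ h = 0`
(`ambRicci_pertComp_ih_ih`).

The constants `R` make `2ρR/(n-2)` a particular solution. The indicial roots are 0 and `n/2`, and
the substitution `h = 2ρR/(n-2) + ρ^{n/2} s` leaves `ρ s'' + (n/2 + 1) s' - ½ Δ s = 0`
(`ricci_ambientFamily`). A power series solves this exactly when `(k+1)(2(k+1)+n) c_{k+1} = Δ c_k`
(`serCoeff_succ`). A truncation leaves only its last `Δ`-term (`fuchs_serPartial`), and a convergent
series leaves nothing (`fuchs_serSum`). The power `ρ^{n/2}` is of class `C²` because the hypotheses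
force `n ≥ 4` (`one_le_of_centre`).

Uniqueness holds for any two metrics in normal form. If their components agree to order `k + 1` in
`ρ`, the Ricci equations determine the next order as long as `k + 1 - n/2 ≠ 0`, which is automatic
for odd `n` (`agreeToOrder_succ`). So all `ρ`-jets at `ρ = 0` agree, and analyticity on segments
that start at `ρ = 0` gives equality. -/

theorem dirDeriv_eq_mvfderiv (X : ∀ x : M, TangentSpace J x) (f : M → ℝ) (x : M) :
    dirDeriv X f x = mvfderiv J f x (X x) := rfl

theorem dirDeriv_congr {X : ∀ x : M, TangentSpace J x} {f g : M → ℝ} {x : M} (h : f =ᶠ[𝓝 x] g) :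
    dirDeriv X f x = dirDeriv X g x := by
  simp only [dirDeriv]; rw [h.mfderiv_eq]; rfl

theorem dirDeriv_const (X : ∀ x : M, TangentSpace J x) (c : ℝ) (x : M) :
    dirDeriv X (fun _ => c) x = 0 := by
  simp [dirDeriv_eq_mvfderiv, mvfderiv_const]

theorem dirDeriv_add {X : ∀ x : M, TangentSpace J x} {f g : M → ℝ} {x : M}
    (hf : MDifferentiableAt J 𝓘(ℝ, ℝ) f x) (hg : MDifferentiableAt J 𝓘(ℝ, ℝ) g x) :
    dirDeriv X (fun y => f y + g y) x = dirDeriv X f x + dirDeriv X g x := by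
  simp only [dirDeriv_eq_mvfderiv]
  rw [show (fun y => f y + g y) = f + g from rfl, mvfderiv_add hf hg]; rfl

theorem dirDeriv_mul {X : ∀ x : M, TangentSpace J x} {f g : M → ℝ} {x : M}
    (hf : MDifferentiableAt J 𝓘(ℝ, ℝ) f x) (hg : MDifferentiableAt J 𝓘(ℝ, ℝ) g x) :
    dirDeriv X (fun y => f y * g y) x = dirDeriv X f x * g x + f x * dirDeriv X g x := by
  simp only [dirDeriv_eq_mvfderiv]
  rw [show (fun y => f y * g y) = f * g from rfl, mvfderiv_mul hf hg]
  simp [mul_comm, add_comm]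

theorem dirDeriv_const_mul {X : ∀ x : M, TangentSpace J x} {f : M → ℝ} {x : M} (c : ℝ)
    (hf : MDifferentiableAt J 𝓘(ℝ, ℝ) f x) :
    dirDeriv X (fun y => c * f y) x = c * dirDeriv X f x := by
  rw [dirDeriv_mul mdifferentiableAt_const hf, dirDeriv_const]; ring

theorem mdifferentiableAt_fun_sum {α : Type*} {s : Finset α} {f : α → M → ℝ}
    {x : M} (hf : ∀ i ∈ s, MDifferentiableAt J 𝓘(ℝ, ℝ) (f i) x) :
    MDifferentiableAt J 𝓘(ℝ, ℝ) (fun y => ∑ i ∈ s, f i y) x := by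
  classical
  induction s using Finset.induction_on with
  | empty => simpa using! mdifferentiableAt_const
  | insert a s ha ih =>
    simp only [Finset.sum_insert ha]
    exact (hf a (by simp)).add (ih fun i hi => hf i (by simp [hi]))

theorem dirDeriv_sum {α : Type*} {X : ∀ x : M, TangentSpace J x} {s : Finset α} {f : α → M → ℝ}
    {x : M} (hf : ∀ i ∈ s, MDifferentiableAt J 𝓘(ℝ, ℝ) (f i) x) :
    dirDeriv X (fun y => ∑ i ∈ s, f i y) x = ∑ i ∈ s, dirDeriv X (f i) x := by
  classical
  induction s using Finset.induction_on with
  | empty => simpa using dirDeriv_const X 0 x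
  | insert a s ha ih =>
    simp only [Finset.sum_insert ha]
    rw [dirDeriv_add (hf a (by simp)) (mdifferentiableAt_fun_sum fun i hi => hf i (by simp [hi])),
      ih fun i hi => hf i (by simp [hi])]

instance instIsManifoldMinSmoothness [IsManifold J ∞ M] : IsManifold J (minSmoothness ℝ 3) M := by
  rw [minSmoothness_of_isRCLikeNormedField]; infer_instance

theorem two_le_infty : (2 : ℕ∞ω) ≤ ∞ := ENat.LEInfty.out

variable [IsManifold J ∞ M]

/-- The derivative of a `C^(m+1)` function along a `C^m` vector field is `C^m`. -/
theorem ContMDiffOn.dirDeriv {m n : ℕ∞ω} (hmn : m + 1 ≤ n) (hn : n ≤ ∞)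
    {X : ∀ x : M, TangentSpace J x} {f : M → ℝ} {s : Set M} (hs : IsOpen s)
    (hX : ContMDiff J J.tangent m fun x => (⟨x, X x⟩ : TangentBundle J M))
    (hf : ContMDiffOn J 𝓘(ℝ, ℝ) n f s) : ContMDiffOn J 𝓘(ℝ, ℝ) m (dirDeriv X f) s := by
  have : IsManifold J n M := .of_le (n := ∞) hn
  -- The derivative along `X` is the fibre component of the tangent map of `f` evaluated on the
  -- section `X`.
  have h1 := hf.contMDiffOn_tangentMapWithin hmn hs.uniqueMDiffOn
  have h2 := (contMDiff_snd_tangentBundle_modelSpace ℝ 𝓘(ℝ, ℝ) (n := m)).comp_contMDiffOn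
    (h1.comp (hX.contMDiffOn (s := s)) fun x hx => hx)
  refine h2.congr fun x hx => ?_
  simp only [Function.comp, tangentMapWithin, _root_.dirDeriv]
  rw [mfderivWithin_of_isOpen hs hx]

/-- The commutator of two vector fields acts on functions as their Lie bracket. -/
theorem dirDeriv_comm_of_ne_zero [CompleteSpace EM]
    {U V Z : ∀ x : M, TangentSpace J x} {f : M → ℝ} {s : Set M} (hs : IsOpen s)
    (hU : ContMDiff J J.tangent ∞ fun x => (⟨x, U x⟩ : TangentBundle J M))
    (hV : ContMDiff J J.tangent ∞ fun x => (⟨x, V x⟩ : TangentBundle J M))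
    (hZ : ContMDiff J J.tangent ∞ fun x => (⟨x, Z x⟩ : TangentBundle J M))
    (hf : ContMDiffOn J 𝓘(ℝ, ℝ) 2 f s) {x : M} (hx : x ∈ s) (hZx : Z x ≠ 0) :
    dirDeriv U (dirDeriv V f) x - dirDeriv V (dirDeriv U f) x
      = dirDeriv (mlieBracket J U V) f x := by
  have h12 : (1 : ℕ∞ω) + 1 ≤ 2 := by norm_num [one_add_one_eq_two]
  have key : ∀ {W : ∀ x : M, TangentSpace J x} {Y : ∀ x : M, TangentSpace J x} {g : M → ℝ} {y : M},
      MDifferentiableAt J 𝓘(ℝ, ℝ) g y →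
      MDifferentiableAt J J.tangent (fun x => (⟨x, Y x⟩ : TangentBundle J M)) y →
      mlieBracket J W (g • Y) y = dirDeriv W g y • Y y + g y • mlieBracket J W Y y :=
    fun hg hY => mlieBracket_smul_right hg hY
  have hsm : ∀ {W : ∀ x : M, TangentSpace J x},
      ContMDiff J J.tangent ∞ (fun x => (⟨x, W x⟩ : TangentBundle J M)) →
      ContMDiffOn J 𝓘(ℝ, ℝ) 1 (dirDeriv W f) s := fun hW =>
    ContMDiffOn.dirDeriv h12 two_le_infty hs (hW.of_le ENat.LEInfty.out) hf
  have : IsManifold J (((2 : ℕ∞) : ℕ∞ω) + 1) M :=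
    .of_le (n := ∞) (show (((2 + 1 : ℕ∞)) : ℕ∞ω) ≤ ∞ from WithTop.coe_le_coe.2 le_top)
  have hbr : ∀ {W Y : ∀ x : M, TangentSpace J x},
      ContMDiff J J.tangent ∞ (fun x => (⟨x, W x⟩ : TangentBundle J M)) →
      ContMDiff J J.tangent ∞ (fun x => (⟨x, Y x⟩ : TangentBundle J M)) →
      MDifferentiableAt J J.tangent
        (fun x => (⟨x, mlieBracket J W Y x⟩ : TangentBundle J M)) x := fun hW hY =>
    (ContMDiffAt.mlieBracket_vectorField (m := 1) (n := 2)
      (hW.contMDiffAt.of_le two_le_infty)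
      (hY.contMDiffAt.of_le two_le_infty) (by
        rw [minSmoothness_of_isRCLikeNormedField]; exact h12)).mdifferentiableAt one_ne_zero
  have hZd : ∀ y, MDifferentiableAt J J.tangent (fun x => (⟨x, Z x⟩ : TangentBundle J M)) y :=
    fun y => hZ.contMDiffAt.mdifferentiableAt (by simp)
  have hfd : ∀ y ∈ s, MDifferentiableAt J 𝓘(ℝ, ℝ) f y := fun y hy =>
    (hf.contMDiffAt (hs.mem_nhds hy)).mdifferentiableAt (by simp)
  have hUf := ((hsm hU).contMDiffAt (hs.mem_nhds hx)).mdifferentiableAt one_ne_zero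
  have hVf := ((hsm hV).contMDiffAt (hs.mem_nhds hx)).mdifferentiableAt one_ne_zero
  have inner : ∀ {W W' : ∀ x : M, TangentSpace J x},
      ContMDiff J J.tangent ∞ (fun x => (⟨x, W x⟩ : TangentBundle J M)) →
      ContMDiff J J.tangent ∞ (fun x => (⟨x, W' x⟩ : TangentBundle J M)) →
      mlieBracket J W' (mlieBracket J W (f • Z)) x
        = (dirDeriv W' (dirDeriv W f) x • Z x + dirDeriv W f x • mlieBracket J W' Z x)
          + (dirDeriv W' f x • mlieBracket J W Z x
            + f x • mlieBracket J W' (mlieBracket J W Z) x) := by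
    intro W W' hW hW'
    have hWf := ((hsm hW).contMDiffAt (hs.mem_nhds hx)).mdifferentiableAt one_ne_zero
    have e : mlieBracket J W (f • Z) =ᶠ[𝓝 x] (dirDeriv W f • Z + f • mlieBracket J W Z) := by
      filter_upwards [hs.mem_nhds hx] with y hy
      exact key (hfd y hy) (hZd y)
    rw [(Filter.EventuallyEq.refl _ W').mlieBracket_vectorField_eq e,
      mlieBracket_add_right, key hWf (hZd x), key (hfd x hx) (hbr hW hZ)]
    · exact hWf.smul_section (hZd x)
    · exact (hfd x hx).smul_section (hbr hW hZ)
  -- The Jacobi identity is applied to `U`, `V`, `f • Z`. Expanding with the Leibniz rule, the mixed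
  -- first-order terms cancel, `f` times the Jacobi identity `L'` for `Z` drops out, and what
  -- remains is the commutator minus the bracket, as a coefficient of `Z x`.
  have L : mlieBracket J U (mlieBracket J V (f • Z)) x =
      mlieBracket J (mlieBracket J U V) (f • Z) x + mlieBracket J V (mlieBracket J U (f • Z)) x := by
    have e2 : minSmoothness ℝ 2 = 2 := minSmoothness_of_isRCLikeNormedField
    refine leibniz_identity_mlieBracket_apply ?_ ?_ ?_ <;> rw [e2]
    · exact hU.contMDiffAt.of_le two_le_infty
    · exact hV.contMDiffAt.of_le two_le_infty
    · exact (hf.contMDiffAt (hs.mem_nhds hx)).smul_section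
        (hZ.contMDiffAt.of_le two_le_infty)
  have L' : mlieBracket J U (mlieBracket J V Z) x =
      mlieBracket J (mlieBracket J U V) Z x + mlieBracket J V (mlieBracket J U Z) x := by
    have e2 : minSmoothness ℝ 2 = 2 := minSmoothness_of_isRCLikeNormedField
    refine leibniz_identity_mlieBracket_apply ?_ ?_ ?_ <;> rw [e2]
    · exact hU.contMDiffAt.of_le two_le_infty
    · exact hV.contMDiffAt.of_le two_le_infty
    · exact hZ.contMDiffAt.of_le two_le_infty
  rw [inner hV hU, inner hU hV, key (hfd x hx) (hZd x), L'] at L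
  have : (dirDeriv U (dirDeriv V f) x - dirDeriv V (dirDeriv U f) x
      - dirDeriv (mlieBracket J U V) f x) • Z x = 0 := by
    simp only [sub_smul]
    have := sub_eq_zero.mpr L
    rw [← this]
    module
  rcases smul_eq_zero.mp this with h | h
  · linarith
  · exact absurd h hZx

/-- The commutator of two vector fields acts on functions as their Lie bracket. -/
theorem dirDeriv_comm [CompleteSpace EM]
    {U V : ∀ x : M, TangentSpace J x} {f : M → ℝ} {s : Set M} (hs : IsOpen s)
    (hU : ContMDiff J J.tangent ∞ fun x => (⟨x, U x⟩ : TangentBundle J M))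
    (hV : ContMDiff J J.tangent ∞ fun x => (⟨x, V x⟩ : TangentBundle J M))
    (hf : ContMDiffOn J 𝓘(ℝ, ℝ) 2 f s) {x : M} (hx : x ∈ s) :
    dirDeriv U (dirDeriv V f) x - dirDeriv V (dirDeriv U f) x
      = dirDeriv (mlieBracket J U V) f x := by
  -- The auxiliary field is whichever of `U`, `V` is nonzero at `x`. If both vanish there, so does
  -- their bracket, and both sides are zero.
  by_cases h1 : U x = 0
  · by_cases h2 : V x = 0
    · have h3 : mlieBracket J U V x = 0 := by
        rw [← mlieBracketWithin_univ]; exact mlieBracketWithin_eq_zero_of_eq_zero h1 h2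
      simp [dirDeriv_eq_mvfderiv, h1, h2, h3]
    · exact dirDeriv_comm_of_ne_zero hs hU hV hV hf hx h2
  · exact dirDeriv_comm_of_ne_zero hs hU hV hU hf hx h1

/-- Composing a chart with continuous linear functionals gives enough local functions: functionals
separate points, and the derivative of the chart is injective. -/
theorem eq_of_forall_mvfderiv_eq {x : M} {v w : TangentSpace J x}
    (h : ∀ (f : M → ℝ) (s : Set M), IsOpen s → x ∈ s → ContMDiffOn J 𝓘(ℝ, ℝ) ∞ f s →
      mvfderiv J f x v = mvfderiv J f x w) : v = w := by
  have hd : MDifferentiableAt J 𝓘(ℝ, EM) (extChartAt J x) x := mdifferentiableAt_extChartAt (by simp)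
  have key : mfderiv J 𝓘(ℝ, EM) (extChartAt J x) x v = mfderiv J 𝓘(ℝ, EM) (extChartAt J x) x w := by
    refine (SeparatingDual.eq_iff_forall_dual_eq (R := ℝ) (V := EM)).2 fun l => ?_
    have hs : ContMDiffOn J 𝓘(ℝ, ℝ) ∞ (fun y => l (extChartAt J x y)) (chartAt HM x).source :=
      l.contMDiff.comp_contMDiffOn contMDiffOn_extChartAt
    have e : ∀ u : TangentSpace J x, mvfderiv J (fun y => l (extChartAt J x y)) x u
        = l (mfderiv J 𝓘(ℝ, EM) (extChartAt J x) x u) := by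
      intro u
      have := mfderiv_comp (I := J) (I' := 𝓘(ℝ, EM)) (I'' := 𝓘(ℝ, ℝ)) x
        (g := l) (l.differentiableAt.mdifferentiableAt) hd
      rw [mfderiv_eq_fderiv, ContinuousLinearMap.fderiv] at this
      exact DFunLike.congr_fun this u
    have := h _ _ (chartAt HM x).open_source (mem_chart_source HM x) hs
    rw [e, e] at this
    exact this
  have hinv := isInvertible_mfderiv_extChartAt (I := J) (mem_extChartAt_source x)
  exact hinv.injective key

section Related

variable {EN : Type*} [NormedAddCommGroup EN] [NormedSpace ℝ EN]
  {HN : Type*} [TopologicalSpace HN] {I : ModelWithCorners ℝ EN HN}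
  {N : Type*} [TopologicalSpace N] [ChartedSpace HN N] [IsManifold I ∞ N]

/-- The Lie bracket is natural for vector fields that are related by a smooth map. -/
theorem mlieBracket_of_related [CompleteSpace EM] [CompleteSpace EN] {π : N → M}
    (hπ : ContMDiff I J ∞ π)
    {V V' : ∀ x : M, TangentSpace J x} {W W' : ∀ x : N, TangentSpace I x}
    (hV : ContMDiff J J.tangent ∞ fun x => (⟨x, V x⟩ : TangentBundle J M))
    (hV' : ContMDiff J J.tangent ∞ fun x => (⟨x, V' x⟩ : TangentBundle J M))
    (hW : ContMDiff I I.tangent ∞ fun x => (⟨x, W x⟩ : TangentBundle I N))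
    (hW' : ContMDiff I I.tangent ∞ fun x => (⟨x, W' x⟩ : TangentBundle I N))
    (h : ∀ q, mfderiv I J π q (W q) = V (π q)) (h' : ∀ q, mfderiv I J π q (W' q) = V' (π q))
    (q : N) : mfderiv I J π q (mlieBracket I W W' q) = mlieBracket J V V' (π q) := by
  -- Both sides are tested on local functions `f`. Relatedness turns derivatives of `f ∘ π` into
  -- derivatives of `f`, so the two commutators correspond, and `dirDeriv_comm` identifies them with
  -- the brackets.
  refine eq_of_forall_mvfderiv_eq (J := J) fun f s hs hx hf => ?_
  have ho : IsOpen (π ⁻¹' s) := hs.preimage hπ.continuous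
  have hfs : ContMDiffOn I 𝓘(ℝ, ℝ) ∞ (f ∘ π) (π ⁻¹' s) := hf.comp hπ.contMDiffOn fun _ h => h
  have chain : ∀ {g : M → ℝ}, ContMDiffOn J 𝓘(ℝ, ℝ) 1 g s → ∀ q ∈ π ⁻¹' s,
      ∀ w : TangentSpace I q, mvfderiv I (g ∘ π) q w = mvfderiv J g (π q) (mfderiv I J π q w) := by
    intro g hg q hq w
    exact DFunLike.congr_fun (mfderiv_comp q
      ((hg.contMDiffAt (hs.mem_nhds hq)).mdifferentiableAt one_ne_zero)
      (hπ.mdifferentiable (by simp) q)) w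
  have hdd : ∀ {A B : ∀ x : M, TangentSpace J x} {C D : ∀ x : N, TangentSpace I x},
      ContMDiff J J.tangent ∞ (fun x => (⟨x, A x⟩ : TangentBundle J M)) →
      (∀ q, mfderiv I J π q (C q) = A (π q)) → (∀ q, mfderiv I J π q (D q) = B (π q)) →
      dirDeriv D (dirDeriv C (f ∘ π)) q = dirDeriv B (dirDeriv A f) (π q) := by
    intro A B C D hA hC hD
    have e : dirDeriv C (f ∘ π) =ᶠ[𝓝 q] dirDeriv A f ∘ π := by
      filter_upwards [ho.mem_nhds hx] with q hq
      rw [dirDeriv_eq_mvfderiv, chain (hf.of_le ENat.LEInfty.out) q hq, hC]; rfl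
    rw [dirDeriv_congr e, dirDeriv_eq_mvfderiv, chain
      ((ContMDiffOn.dirDeriv (m := ∞) (n := ∞) le_rfl le_rfl hs hA hf).of_le ENat.LEInfty.out) q hx,
      hD]
    rfl
  have c := dirDeriv_comm ho hW hW' (hfs.of_le two_le_infty) (x := q) hx
  rw [hdd hV' h' h, hdd hV h h', dirDeriv_comm hs hV hV' (hf.of_le two_le_infty) hx] at c
  rw [← dirDeriv_eq_mvfderiv (mlieBracket J V V') f, c, dirDeriv_eq_mvfderiv,
    chain (hf.of_le ENat.LEInfty.out) q hx]

end Related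

end Calculus

set_option linter.unusedSectionVars false

/-! ### Vector fields on products and on the line -/

section ProductField

variable {E₁ E₂ : Type*} [NormedAddCommGroup E₁] [NormedSpace ℝ E₁] [NormedAddCommGroup E₂]
  [NormedSpace ℝ E₂] {H₁ H₂ : Type*} [TopologicalSpace H₁] [TopologicalSpace H₂]
  {I₁ : ModelWithCorners ℝ E₁ H₁} {I₂ : ModelWithCorners ℝ E₂ H₂}
  {M₁ M₂ : Type*} [TopologicalSpace M₁] [ChartedSpace H₁ M₁] [TopologicalSpace M₂]
  [ChartedSpace H₂ M₂] [IsManifold I₁ ∞ M₁] [IsManifold I₂ ∞ M₂]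

/-- The vector field on a product given by vector fields on the factors. -/
def prodField (V : ∀ x : M₁, TangentSpace I₁ x) (W : ∀ x : M₂, TangentSpace I₂ x) (p : M₁ × M₂) :
    TangentSpace (I₁.prod I₂) p := ((V p.1 : E₁), (W p.2 : E₂))

theorem contMDiff_prodField {V : ∀ x : M₁, TangentSpace I₁ x} {W : ∀ x : M₂, TangentSpace I₂ x}
    (hV : ContMDiff I₁ I₁.tangent ∞ fun x => (⟨x, V x⟩ : TangentBundle I₁ M₁))
    (hW : ContMDiff I₂ I₂.tangent ∞ fun x => (⟨x, W x⟩ : TangentBundle I₂ M₂)) :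
    ContMDiff (I₁.prod I₂) (I₁.prod I₂).tangent ∞
      fun p => (⟨p, prodField V W p⟩ : TangentBundle (I₁.prod I₂) (M₁ × M₂)) := by
  have h1 : ContMDiff (I₁.prod I₂) (I₁.tangent.prod I₂.tangent) ∞ fun p : M₁ × M₂ =>
      ((⟨p.1, V p.1⟩ : TangentBundle I₁ M₁), (⟨p.2, W p.2⟩ : TangentBundle I₂ M₂)) :=
    (hV.comp contMDiff_fst).prodMk (hW.comp contMDiff_snd)
  exact (contMDiff_equivTangentBundleProd_symm (I := I₁) (I' := I₂) (M := M₁) (M' := M₂)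
    (n := ∞)).comp h1

theorem dirDeriv_prodField {V : ∀ x : M₁, TangentSpace I₁ x} {W : ∀ x : M₂, TangentSpace I₂ x}
    {f : M₁ × M₂ → ℝ} {p : M₁ × M₂} (hf : MDifferentiableAt (I₁.prod I₂) 𝓘(ℝ, ℝ) f p) :
    dirDeriv (prodField V W) f p
      = dirDeriv V (fun x => f (x, p.2)) p.1 + dirDeriv W (fun y => f (p.1, y)) p.2 :=
  mfderiv_prod_eq_add_apply hf

/-- A product field is related to its factors by the two projections, so naturality of the bracket
gives each component. -/
theorem mlieBracket_prodField [CompleteSpace E₁] [CompleteSpace E₂]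
    {V V' : ∀ x : M₁, TangentSpace I₁ x} {W W' : ∀ x : M₂, TangentSpace I₂ x}
    (hV : ContMDiff I₁ I₁.tangent ∞ fun x => (⟨x, V x⟩ : TangentBundle I₁ M₁))
    (hV' : ContMDiff I₁ I₁.tangent ∞ fun x => (⟨x, V' x⟩ : TangentBundle I₁ M₁))
    (hW : ContMDiff I₂ I₂.tangent ∞ fun x => (⟨x, W x⟩ : TangentBundle I₂ M₂))
    (hW' : ContMDiff I₂ I₂.tangent ∞ fun x => (⟨x, W' x⟩ : TangentBundle I₂ M₂)) :
    mlieBracket (I₁.prod I₂) (prodField V W) (prodField V' W')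
      = prodField (mlieBracket I₁ V V') (mlieBracket I₂ W W') := by
  have hP := contMDiff_prodField hV hW
  have hP' := contMDiff_prodField hV' hW'
  funext p
  have h1 := mlieBracket_of_related (π := (Prod.fst : M₁ × M₂ → M₁)) contMDiff_fst hV hV' hP hP'
    (fun q => by rw [mfderiv_fst]; rfl) (fun q => by rw [mfderiv_fst]; rfl) p
  have h2 := mlieBracket_of_related (π := (Prod.snd : M₁ × M₂ → M₂)) contMDiff_snd hW hW' hP hP'
    (fun q => by rw [mfderiv_snd]; rfl) (fun q => by rw [mfderiv_snd]; rfl) p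
  rw [mfderiv_fst] at h1
  rw [mfderiv_snd] at h2
  exact Prod.ext h1 h2

end ProductField

/-- The vector field `d/ds` on the real line. -/
def unitField (x : ℝ) : TangentSpace 𝓘(ℝ, ℝ) x := (1 : ℝ)

theorem contMDiff_unitField : ContMDiff 𝓘(ℝ, ℝ) 𝓘(ℝ, ℝ).tangent ∞
    fun x : ℝ => (⟨x, unitField x⟩ : TangentBundle 𝓘(ℝ, ℝ) ℝ) := fun _ =>
  contMDiffAt_vectorSpace_iff_contDiffAt (V := unitField).2
    (contDiffAt_const (c := (1 : ℝ)))

theorem dirDeriv_unitField (f : ℝ → ℝ) (x : ℝ) : dirDeriv unitField f x = deriv f x := by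
  simp only [dirDeriv, mfderiv_eq_fderiv]; rfl

section ZeroField

variable {EM : Type*} [NormedAddCommGroup EM] [NormedSpace ℝ EM]
  {HM : Type*} [TopologicalSpace HM] {J : ModelWithCorners ℝ EM HM}
  {M : Type*} [TopologicalSpace M] [ChartedSpace HM M]

theorem dirDeriv_zeroField (f : M → ℝ) (x : M) :
    dirDeriv (0 : ∀ x : M, TangentSpace J x) f x = 0 := (mfderiv J 𝓘(ℝ, ℝ) f x).map_zero

theorem contMDiff_zeroField [IsManifold J ∞ M] : ContMDiff J J.tangent ∞
    (fun x : M => (⟨x, (0 : ∀ x : M, TangentSpace J x) x⟩ : TangentBundle J M)) :=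
  Bundle.contMDiff_zeroSection _ _

end ZeroField

/-! ### Left-invariant frames of a Lie group -/

section Group

variable {E : Type*} [NormedAddCommGroup E] [NormedSpace ℝ E]
  {G : Type*} [TopologicalSpace G] [ChartedSpace E G] [Group G] 

instance instIsManifoldOfLieGroup [LieGroup 𝓘(ℝ, E) ∞ G] : IsManifold 𝓘(ℝ, E) ∞ G := inferInstance

variable [LieGroup 𝓘(ℝ, E) ∞ G]

/-- The field at `g` is the tangent map of the multiplication on the pair of the zero vector at `g`
and the vector `v` at the unit; the zero section and the tangent map are smooth. -/
theorem contMDiff_mulInvariantVectorField_infty (v : GroupLieAlgebra 𝓘(ℝ, E) G) :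
    ContMDiff 𝓘(ℝ, E) 𝓘(ℝ, E).tangent ∞
      (fun g : G => (⟨g, mulInvariantVectorField v g⟩ : TangentBundle 𝓘(ℝ, E) G)) := by
  let fg : G → TangentBundle 𝓘(ℝ, E) G := fun g => ⟨g, 0⟩
  have sfg : ContMDiff 𝓘(ℝ, E) 𝓘(ℝ, E).tangent ∞ fg := Bundle.contMDiff_zeroSection _ _
  let fv : G → TangentBundle 𝓘(ℝ, E) G := fun _ => ⟨1, v⟩
  have sfv : ContMDiff 𝓘(ℝ, E) 𝓘(ℝ, E).tangent ∞ fv := contMDiff_const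
  let F₂ : (TangentBundle 𝓘(ℝ, E) G × TangentBundle 𝓘(ℝ, E) G) →
      TangentBundle (𝓘(ℝ, E).prod 𝓘(ℝ, E)) (G × G) :=
    (equivTangentBundleProd 𝓘(ℝ, E) G 𝓘(ℝ, E) G).symm
  have S₂ : ContMDiff (𝓘(ℝ, E).tangent.prod 𝓘(ℝ, E).tangent) (𝓘(ℝ, E).prod 𝓘(ℝ, E)).tangent ∞ F₂ :=
    contMDiff_equivTangentBundleProd_symm
  have S₃ := ContMDiff.contMDiff_tangentMap (m := ∞) (contMDiff_mul 𝓘(ℝ, E) ∞ (G := G)) le_rfl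
  convert! (S₃.comp S₂).comp (sfg.prodMk sfv) with g
  · simp [F₂, fg, fv]
  · simp only [Function.comp_apply, tangentMap, F₂, fg, fv]
    rw [mfderiv_prod_eq_add_apply ((contMDiff_mul 𝓘(ℝ, E) ∞).mdifferentiableAt (by simp))]
    exact ((congrArg (· + _) (map_zero (mfderiv 𝓘(ℝ, E) 𝓘(ℝ, E) (fun z : G => z * 1) g))).trans
      (zero_add _)).symm

variable {κ : Type*} (b : Module.Basis κ ℝ (GroupLieAlgebra 𝓘(ℝ, E) G))

theorem contMDiff_leftFrame (i : κ) : ContMDiff 𝓘(ℝ, E) 𝓘(ℝ, E).tangent ∞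
      (fun g : G => (⟨g, leftFrame b i g⟩ : TangentBundle 𝓘(ℝ, E) G)) :=
  contMDiff_mulInvariantVectorField_infty _

theorem mdifferentiable_leftMul (g : G) :
    MDifferentiable 𝓘(ℝ, E) 𝓘(ℝ, E) (fun x : G => g * x) :=
  (contMDiff_mul_left (I := 𝓘(ℝ, E)) (n := ∞)).mdifferentiable (by simp)

/-- Replaces the base point by an equal one. Both tangent spaces unfold to `E`, so the two values
can be compared there; this absorbs `x * 1 = x` and `x⁻¹ * x = 1` in the chain rule. -/
theorem mfderiv_apply_congr_point (f : G → G) {x y : G} (h : y = x) (v : E) :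
    (mfderiv 𝓘(ℝ, E) 𝓘(ℝ, E) f x v : E) = (mfderiv 𝓘(ℝ, E) 𝓘(ℝ, E) f y v : E) := by
  subst h; rfl

theorem toLieAlgebra_mulInvariantVectorField (v : GroupLieAlgebra 𝓘(ℝ, E) G) (x : G) :
    toLieAlgebra x (mulInvariantVectorField v x) = v := by
  have h := mfderiv_comp_of_eq (I := 𝓘(ℝ, E)) (I' := 𝓘(ℝ, E)) (I'' := 𝓘(ℝ, E)) (x := (1 : G))
    (f := fun y : G => x * y) (g := fun y : G => x⁻¹ * y) (y := x)
    (mdifferentiable_leftMul x⁻¹ x) (mdifferentiable_leftMul x 1) (mul_one x)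
  have e : (fun y : G => x⁻¹ * y) ∘ (fun y : G => x * y) = id := by ext y; simp
  rw [e, mfderiv_id] at h
  exact (mfderiv_apply_congr_point _ (mul_one x) _).trans (DFunLike.congr_fun h v).symm

theorem mulInvariantVectorField_toLieAlgebra (x : G) (w : TangentSpace 𝓘(ℝ, E) x) :
    mulInvariantVectorField (toLieAlgebra x w : GroupLieAlgebra 𝓘(ℝ, E) G) x = w := by
  have h := mfderiv_comp_of_eq (I := 𝓘(ℝ, E)) (I' := 𝓘(ℝ, E)) (I'' := 𝓘(ℝ, E)) (x := x)
    (f := fun y : G => x⁻¹ * y) (g := fun y : G => x * y) (y := 1)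
    (mdifferentiable_leftMul x 1) (mdifferentiable_leftMul x⁻¹ x) (inv_mul_cancel x)
  have e : (fun y : G => x * y) ∘ (fun y : G => x⁻¹ * y) = id := by ext y; simp
  rw [e, mfderiv_id] at h
  exact (mfderiv_apply_congr_point _ (inv_mul_cancel x) _).trans (DFunLike.congr_fun h w).symm

theorem coframe_leftFrame [DecidableEq κ] (i j : κ) (x : G) :
    coframe b i x (leftFrame b j x) = if i = j then 1 else 0 := by
  have := toLieAlgebra_mulInvariantVectorField (b j) x
  simp only [coframe, leftFrame, LinearMap.comp_apply]
  refine (congrArg (b.coord i) this).trans ?_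
  simp [Finsupp.single_apply, eq_comm]

/-- The structure constants `c^k_{ij}` of a Lie algebra in a basis. -/
def structConst {L : Type*} [LieRing L] [LieAlgebra ℝ L] (b : Module.Basis κ ℝ L)
    (k i j : κ) : ℝ := b.repr ⁅b i, b j⁆ k

variable [CompleteSpace E] [Fintype κ]

theorem mulInvariantVectorField_sum {α : Type*} (s : Finset α) (c : α → ℝ)
    (v : α → GroupLieAlgebra 𝓘(ℝ, E) G) (x : G) :
    mulInvariantVectorField (∑ i ∈ s, c i • v i) x
      = ∑ i ∈ s, c i • mulInvariantVectorField (v i) x := by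
  have h : ∀ w : GroupLieAlgebra 𝓘(ℝ, E) G, mulInvariantVectorField w x
    = mfderiv 𝓘(ℝ, E) 𝓘(ℝ, E) (fun y : G => x * y) 1 w := fun _ => rfl
  simp only [h]
  erw [map_sum]
  refine Finset.sum_congr rfl fun i _ => ?_
  exact map_smul _ _ _

theorem mlieBracket_leftFrame (i j : κ) (x : G) :
    mlieBracket 𝓘(ℝ, E) (leftFrame b i) (leftFrame b j) x
      = ∑ k, structConst b k i j • leftFrame b k x := by
  have h := congrFun (mulInvariantVector_mlieBracket (I := 𝓘(ℝ, E)) (G := G) (b i) (b j)) x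
  refine h.symm.trans ?_
  rw [← GroupLieAlgebra.bracket_def, ← b.sum_repr ⁅b i, b j⁆]
  exact mulInvariantVectorField_sum _ _ _ _

end Group

/-! ### Smooth dependence of determinants and inverse matrices -/

section MatrixSmooth

variable {EM : Type*} [NormedAddCommGroup EM] [NormedSpace ℝ EM]
  {HM : Type*} [TopologicalSpace HM] {J : ModelWithCorners ℝ EM HM}
  {M : Type*} [TopologicalSpace M] [ChartedSpace HM M] {n : ℕ∞ω} {s : Set M}

theorem contMDiffOn_fun_sum {α : Type*} {t : Finset α} {f : α → M → ℝ}
    (h : ∀ i ∈ t, ContMDiffOn J 𝓘(ℝ, ℝ) n (f i) s) :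
    ContMDiffOn J 𝓘(ℝ, ℝ) n (fun x => ∑ i ∈ t, f i x) s := by
  classical
  induction t using Finset.induction_on with
  | empty => simpa using! contMDiffOn_const
  | insert a t ha ih =>
    simp only [Finset.sum_insert ha]
    exact (h a (by simp)).add (ih fun i hi => h i (by simp [hi]))

theorem contMDiffOn_fun_mul {f g : M → ℝ} (hf : ContMDiffOn J 𝓘(ℝ, ℝ) n f s)
    (hg : ContMDiffOn J 𝓘(ℝ, ℝ) n g s) : ContMDiffOn J 𝓘(ℝ, ℝ) n (fun x => f x * g x) s :=
  (contDiff_mul (𝕜 := ℝ) (n := n)).contMDiff.comp_contMDiffOn (hf.prodMk_space hg)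

theorem contMDiffOn_fun_prod {α : Type*} {t : Finset α} {f : α → M → ℝ}
    (h : ∀ i ∈ t, ContMDiffOn J 𝓘(ℝ, ℝ) n (f i) s) :
    ContMDiffOn J 𝓘(ℝ, ℝ) n (fun x => ∏ i ∈ t, f i x) s := by
  classical
  induction t using Finset.induction_on with
  | empty => simpa using! contMDiffOn_const
  | insert a t ha ih =>
    simp only [Finset.prod_insert ha]
    exact contMDiffOn_fun_mul (h a (by simp)) (ih fun i hi => h i (by simp [hi]))

theorem contMDiffOn_fun_inv {f : M → ℝ} (hf : ContMDiffOn J 𝓘(ℝ, ℝ) n f s)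
    (h0 : ∀ x ∈ s, f x ≠ 0) : ContMDiffOn J 𝓘(ℝ, ℝ) n (fun x => (f x)⁻¹) s := fun x hx =>
  (contDiffAt_inv ℝ (h0 x hx)).contMDiffAt.comp_contMDiffWithinAt x (hf x hx)

variable {κ : Type*} [Fintype κ] [DecidableEq κ]

theorem contMDiffOn_det {A : M → Matrix κ κ ℝ}
    (h : ∀ i j, ContMDiffOn J 𝓘(ℝ, ℝ) n (fun x => A x i j) s) :
    ContMDiffOn J 𝓘(ℝ, ℝ) n (fun x => (A x).det) s := by
  simp only [Matrix.det_apply']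
  exact contMDiffOn_fun_sum fun σ _ => contMDiffOn_fun_mul contMDiffOn_const
    (contMDiffOn_fun_prod fun i _ => h _ _)

theorem contMDiffOn_matrix_inv {A : M → Matrix κ κ ℝ}
    (h : ∀ i j, ContMDiffOn J 𝓘(ℝ, ℝ) n (fun x => A x i j) s) (h0 : ∀ x ∈ s, (A x).det ≠ 0)
    (i j : κ) : ContMDiffOn J 𝓘(ℝ, ℝ) n (fun x => (A x)⁻¹ i j) s := by
  -- Cramer's rule: the entries are quotients of determinants, hence as smooth as the entries of
  -- `A`.
  have e : ∀ x, (A x)⁻¹ i j = ((A x).det)⁻¹ * ((A x).updateRow j (Pi.single i 1)).det := by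
    intro x
    rw [Matrix.inv_def, Matrix.smul_apply, Ring.inverse_eq_inv', smul_eq_mul,
      Matrix.adjugate_apply]
  simp only [e]
  refine contMDiffOn_fun_mul (contMDiffOn_fun_inv (contMDiffOn_det h) h0)
    (contMDiffOn_det fun k l => ?_)
  by_cases hk : k = j
  · subst hk; simpa using! contMDiffOn_const
  · simpa [Matrix.updateRow_ne hk] using h k l

end MatrixSmooth

/-! ### The frame `e_i`, `∂_ρ` on `G × ℝ` -/

section Slices

set_option linter.unusedSectionVars false

variable {E : Type*} [NormedAddCommGroup E] [NormedSpace ℝ E]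
  {G : Type*} [TopologicalSpace G] [ChartedSpace E G] [Group G] [LieGroup 𝓘(ℝ, E) ∞ G]
  {κ : Type*} (b : Module.Basis κ ℝ (GroupLieAlgebra 𝓘(ℝ, E) G))

/-- The model with corners of `G × ℝ`. -/
abbrev sliceModel (E : Type*) [NormedAddCommGroup E] [NormedSpace ℝ E] :=
  𝓘(ℝ, E).prod 𝓘(ℝ, ℝ)

/-- The left-invariant frame of `G` as vector fields on `G × ℝ`. -/
abbrev liftX (i : κ) : ∀ y : G × ℝ, TangentSpace (sliceModel E) y :=
  prodField (leftFrame b i) 0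

/-- The vector field `∂_ρ` on `G × ℝ`. -/
abbrev liftR (E G : Type*) [NormedAddCommGroup E] [NormedSpace ℝ E] [TopologicalSpace G]
    [ChartedSpace E G] : ∀ y : G × ℝ, TangentSpace (sliceModel E) y :=
  prodField (I₁ := 𝓘(ℝ, E)) 0 unitField

theorem contMDiff_liftX (i : κ) : ContMDiff (sliceModel E) (sliceModel E).tangent ∞
    fun y => (⟨y, liftX b i y⟩ : TangentBundle (sliceModel E) (G × ℝ)) :=
  contMDiff_prodField (contMDiff_leftFrame b i) contMDiff_zeroField

theorem contMDiff_liftR : ContMDiff (sliceModel E) (sliceModel E).tangent ∞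
    fun y => (⟨y, liftR E G y⟩ : TangentBundle (sliceModel E) (G × ℝ)) :=
  contMDiff_prodField contMDiff_zeroField contMDiff_unitField

theorem dirDeriv_liftX {f : G × ℝ → ℝ} {y : G × ℝ}
    (hf : MDifferentiableAt (sliceModel E) 𝓘(ℝ, ℝ) f y) (i : κ) :
    dirDeriv (liftX b i) f y = leftDeriv (b i) (fun x => f (x, y.2)) y.1 := by
  rw [liftX, dirDeriv_prodField hf, dirDeriv_zeroField, add_zero]; rfl

theorem dirDeriv_liftR {f : G × ℝ → ℝ} {y : G × ℝ}
    (hf : MDifferentiableAt (sliceModel E) 𝓘(ℝ, ℝ) f y) :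
    dirDeriv (liftR E G) f y = deriv (fun s => f (y.1, s)) y.2 := by
  rw [liftR, dirDeriv_prodField hf, dirDeriv_unitField, dirDeriv_zeroField, zero_add]

theorem dirDeriv_liftX_snd (i : κ) (y : G × ℝ) :
    dirDeriv (liftX b i) (fun z : G × ℝ => z.2) y = 0 := by
  rw [dirDeriv_liftX b mdifferentiableAt_snd]; exact dirDeriv_const _ _ _

theorem dirDeriv_liftR_snd (y : G × ℝ) :
    dirDeriv (liftR E G) (fun z : G × ℝ => z.2) y = 1 := by
  rw [dirDeriv_liftR mdifferentiableAt_snd]; exact deriv_id _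

variable [CompleteSpace E] [Fintype κ]

theorem mlieBracket_liftX (i j : κ) (y : G × ℝ) :
    mlieBracket (sliceModel E) (liftX b i) (liftX b j) y
      = ∑ k, structConst b k i j • liftX b k y := by
  rw [mlieBracket_prodField (contMDiff_leftFrame b i) (contMDiff_leftFrame b j)
    contMDiff_zeroField contMDiff_zeroField]
  have h1 := mlieBracket_leftFrame b i j y.1
  refine Prod.ext (h1.trans ?_) ?_
  · erw [Prod.fst_sum]; rfl
  · erw [Prod.snd_sum]
    rw [mlieBracket_self]
    exact (Finset.sum_eq_zero fun k _ => mul_zero _).symm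

theorem mlieBracket_liftX_liftR (i : κ) (y : G × ℝ) :
    mlieBracket (sliceModel E) (liftX b i) (liftR E G) y = 0 := by
  rw [mlieBracket_prodField (contMDiff_leftFrame b i) contMDiff_zeroField
    contMDiff_zeroField contMDiff_unitField]
  refine Prod.ext ?_ ?_
  · exact congrFun mlieBracket_zero_right y.1
  · exact congrFun mlieBracket_zero_left y.2

theorem dirDeriv_liftX_comm (i j : κ) {f : G × ℝ → ℝ} {s : Set (G × ℝ)} (hs : IsOpen s)
    (hf : ContMDiffOn (sliceModel E) 𝓘(ℝ, ℝ) 2 f s) {y : G × ℝ} (hy : y ∈ s) :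
    dirDeriv (liftX b i) (dirDeriv (liftX b j) f) y
      - dirDeriv (liftX b j) (dirDeriv (liftX b i) f) y
      = ∑ k, structConst b k i j * dirDeriv (liftX b k) f y := by
  refine (dirDeriv_comm hs (contMDiff_liftX b i) (contMDiff_liftX b j) hf hy).trans ?_
  simp only [dirDeriv_eq_mvfderiv, mlieBracket_liftX]
  erw [map_sum]
  exact Finset.sum_congr rfl fun k _ => map_smul _ _ _

theorem dirDeriv_liftX_liftR (i : κ) {f : G × ℝ → ℝ} {s : Set (G × ℝ)} (hs : IsOpen s)
    (hf : ContMDiffOn (sliceModel E) 𝓘(ℝ, ℝ) 2 f s) {y : G × ℝ} (hy : y ∈ s) :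
    dirDeriv (liftX b i) (dirDeriv (liftR E G) f) y
      = dirDeriv (liftR E G) (dirDeriv (liftX b i) f) y := by
  have := dirDeriv_comm hs (contMDiff_liftX b i) contMDiff_liftR hf hy
  rw [dirDeriv_eq_mvfderiv (mlieBracket _ _ _), mlieBracket_liftX_liftR, map_zero] at this
  linarith

end Slices

/-! ### The frame of the ambient space and the components of the ambient metric -/

section AmbientFrame

set_option linter.unusedSectionVars false

variable {E : Type*} [NormedAddCommGroup E] [NormedSpace ℝ E]
  {G : Type*} [TopologicalSpace G] [ChartedSpace E G] [Group G] [LieGroup 𝓘(ℝ, E) ∞ G]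
  {κ : Type*} (b : Module.Basis κ ℝ (GroupLieAlgebra 𝓘(ℝ, E) G))

theorem ambientFrame_t (u : Unit) : ambientFrame b (.inl u) =
    prodField (I₂ := sliceModel E) (M₂ := G × ℝ) unitField 0 := rfl

theorem ambientFrame_x (i : κ) : ambientFrame b (.inr (.inl i)) =
    prodField (I₁ := 𝓘(ℝ, ℝ)) (M₁ := ℝ) (I₂ := sliceModel E) 0 (liftX b i) := rfl

theorem ambientFrame_r (u : Unit) : ambientFrame b (.inr (.inr u)) =
    prodField (I₁ := 𝓘(ℝ, ℝ)) (M₁ := ℝ) (I₂ := sliceModel E) 0 (liftR E G) := rfl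

section Product

variable {φ : ℝ → ℝ} {u : G × ℝ → ℝ} {P : ℝ × G × ℝ}

/-- All metric components and connection coefficients of the ambient metric can be written as `φ(t)
u(x, ρ)`, so derivatives along the frame are needed only for such products. -/
theorem mdifferentiableAt_mul_prod (hφ : DifferentiableAt ℝ φ P.1)
    (hu : MDifferentiableAt (sliceModel E) 𝓘(ℝ, ℝ) u P.2) :
    MDifferentiableAt (ambientModel E) 𝓘(ℝ, ℝ) (fun Q : ℝ × G × ℝ => φ Q.1 * u Q.2) P :=
  (MDifferentiableAt.comp P hφ.mdifferentiableAt mdifferentiableAt_fst).mul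
    (MDifferentiableAt.comp P hu mdifferentiableAt_snd)

theorem dirDeriv_ambientFrame_t (hφ : DifferentiableAt ℝ φ P.1)
    (hu : MDifferentiableAt (sliceModel E) 𝓘(ℝ, ℝ) u P.2) (x : Unit) :
    dirDeriv (ambientFrame b (.inl x)) (fun Q : ℝ × G × ℝ => φ Q.1 * u Q.2) P
      = deriv φ P.1 * u P.2 := by
  rw [ambientFrame_t, dirDeriv_prodField (mdifferentiableAt_mul_prod hφ hu), dirDeriv_unitField,
    dirDeriv_zeroField, add_zero]
  exact deriv_mul_const hφ (u P.2)

theorem dirDeriv_ambientFrame_x (hφ : DifferentiableAt ℝ φ P.1)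
    (hu : MDifferentiableAt (sliceModel E) 𝓘(ℝ, ℝ) u P.2) (i : κ) :
    dirDeriv (ambientFrame b (.inr (.inl i))) (fun Q : ℝ × G × ℝ => φ Q.1 * u Q.2) P
      = φ P.1 * dirDeriv (liftX b i) u P.2 := by
  rw [ambientFrame_x, dirDeriv_prodField (mdifferentiableAt_mul_prod hφ hu), dirDeriv_zeroField,
    zero_add]
  exact dirDeriv_const_mul (φ P.1) hu

theorem dirDeriv_ambientFrame_r (hφ : DifferentiableAt ℝ φ P.1)
    (hu : MDifferentiableAt (sliceModel E) 𝓘(ℝ, ℝ) u P.2) (x : Unit) :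
    dirDeriv (ambientFrame b (.inr (.inr x))) (fun Q : ℝ × G × ℝ => φ Q.1 * u Q.2) P
      = φ P.1 * dirDeriv (liftR E G) u P.2 := by
  rw [ambientFrame_r, dirDeriv_prodField (mdifferentiableAt_mul_prod hφ hu), dirDeriv_zeroField,
    zero_add]
  exact dirDeriv_const_mul (φ P.1) hu

end Product

variable [CompleteSpace E] [Fintype κ] [DecidableEq κ]

theorem mlieBracket_ambientFrame_x (i j : κ) (P : ℝ × G × ℝ) :
    mlieBracket (ambientModel E) (ambientFrame b (.inr (.inl i))) (ambientFrame b (.inr (.inl j))) P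
      = ∑ k, structConst b k i j • ambientFrame b (.inr (.inl k)) P := by
  rw [ambientFrame_x, ambientFrame_x, mlieBracket_prodField contMDiff_zeroField
    contMDiff_zeroField (contMDiff_liftX b i) (contMDiff_liftX b j)]
  have h1 := mlieBracket_liftX b i j P.2
  refine Prod.ext ?_ (h1.trans ?_)
  · erw [Prod.fst_sum]
    rw [mlieBracket_self]
    exact (Finset.sum_eq_zero fun k _ => mul_zero _).symm
  · erw [Prod.snd_sum]; rfl

theorem mlieBracket_ambientFrame_tt (u v : Unit) (P : ℝ × G × ℝ) :
    mlieBracket (ambientModel E) (ambientFrame b (.inl u)) (ambientFrame b (.inl v)) P = 0 :=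
  congrFun mlieBracket_self P

theorem mlieBracket_ambientFrame_rr (u v : Unit) (P : ℝ × G × ℝ) :
    mlieBracket (ambientModel E) (ambientFrame b (.inr (.inr u)))
      (ambientFrame b (.inr (.inr v))) P = 0 :=
  congrFun mlieBracket_self P

theorem mlieBracket_ambientFrame_tx (u : Unit) (i : κ) (P : ℝ × G × ℝ) :
    mlieBracket (ambientModel E) (ambientFrame b (.inl u)) (ambientFrame b (.inr (.inl i))) P
      = 0 := by
  rw [ambientFrame_t, ambientFrame_x, mlieBracket_prodField contMDiff_unitField
    contMDiff_zeroField contMDiff_zeroField (contMDiff_liftX b i), mlieBracket_zero_left,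
    mlieBracket_zero_right]
  rfl

theorem mlieBracket_ambientFrame_tr (u v : Unit) (P : ℝ × G × ℝ) :
    mlieBracket (ambientModel E) (ambientFrame b (.inl u)) (ambientFrame b (.inr (.inr v))) P
      = 0 := by
  rw [ambientFrame_t, ambientFrame_r, mlieBracket_prodField contMDiff_unitField
    contMDiff_zeroField contMDiff_zeroField contMDiff_liftR, mlieBracket_zero_left,
    mlieBracket_zero_right]
  rfl

theorem mlieBracket_ambientFrame_xr (i : κ) (u : Unit) (P : ℝ × G × ℝ) :
    mlieBracket (ambientModel E) (ambientFrame b (.inr (.inl i))) (ambientFrame b (.inr (.inr u))) P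
      = 0 := by
  rw [ambientFrame_x, ambientFrame_r, mlieBracket_prodField contMDiff_zeroField
    contMDiff_zeroField (contMDiff_liftX b i) contMDiff_liftR, mlieBracket_self]
  exact Prod.ext rfl (mlieBracket_liftX_liftR b i P.2)

end AmbientFrame

section AmbientGram

set_option linter.unusedSectionVars false

variable {E : Type*} [NormedAddCommGroup E] [NormedSpace ℝ E]
  {G : Type*} [TopologicalSpace G] [ChartedSpace E G] [Group G] [LieGroup 𝓘(ℝ, E) ∞ G]
  {κ : Type*} (b : Module.Basis κ ℝ (GroupLieAlgebra 𝓘(ℝ, E) G))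

theorem formDt_ambientFrame_t (u : Unit) (P : ℝ × G × ℝ) :
    formDt P (ambientFrame b (.inl u) P) = 1 := by
  simp only [formDt, mfderiv_fst]; rfl

theorem formDt_ambientFrame_x (i : κ) (P : ℝ × G × ℝ) :
    formDt P (ambientFrame b (.inr (.inl i)) P) = 0 := by
  simp only [formDt, mfderiv_fst]; rfl

theorem formDt_ambientFrame_r (u : Unit) (P : ℝ × G × ℝ) :
    formDt P (ambientFrame b (.inr (.inr u)) P) = 0 := by
  simp only [formDt, mfderiv_fst]; rfl

theorem mfderiv_proj (P : ℝ × G × ℝ) (v : TangentSpace (ambientModel E) P) :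
    (projG P v : E) = (v.2.1 : E) := by
  have h := mfderiv_comp (I := ambientModel E) (I' := sliceModel E) (I'' := 𝓘(ℝ, E)) P
    (g := Prod.fst) (f := Prod.snd) (mdifferentiableAt_fst (x := P.2))
    (mdifferentiableAt_snd (x := P))
  rw [mfderiv_fst, mfderiv_snd] at h
  exact DFunLike.congr_fun h v

theorem projG_ambientFrame_t (u : Unit) (P : ℝ × G × ℝ) :
    projG P (ambientFrame b (.inl u) P) = 0 := mfderiv_proj P _

theorem projG_ambientFrame_x (i : κ) (P : ℝ × G × ℝ) :
    projG P (ambientFrame b (.inr (.inl i)) P) = leftFrame b i P.2.1 := mfderiv_proj P _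

theorem projG_ambientFrame_r (u : Unit) (P : ℝ × G × ℝ) :
    projG P (ambientFrame b (.inr (.inr u)) P) = 0 := mfderiv_proj P _

theorem formDrt_eq (I : Unit ⊕ κ ⊕ Unit) (P : ℝ × G × ℝ) :
    formDrt P (ambientFrame b I P)
      = dirDeriv (ambientFrame b I) (fun Q : ℝ × G × ℝ => id Q.1 * Q.2.2) P := by
  have : (fun Q : ℝ × G × ℝ => id Q.1 * Q.2.2) = fun Q => Q.2.2 * Q.1 := by
    funext Q; exact mul_comm _ _
  rw [this]; rfl

theorem formDrt_ambientFrame_t (u : Unit) (P : ℝ × G × ℝ) :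
    formDrt P (ambientFrame b (.inl u) P) = P.2.2 := by
  rw [formDrt_eq, dirDeriv_ambientFrame_t b differentiableAt_id
    (u := fun y => y.2) mdifferentiableAt_snd, deriv_id, one_mul]

theorem formDrt_ambientFrame_x (i : κ) (P : ℝ × G × ℝ) :
    formDrt P (ambientFrame b (.inr (.inl i)) P) = 0 := by
  rw [formDrt_eq, dirDeriv_ambientFrame_x b differentiableAt_id
    (u := fun y => y.2) mdifferentiableAt_snd, dirDeriv_liftX_snd, mul_zero]

theorem formDrt_ambientFrame_r (u : Unit) (P : ℝ × G × ℝ) :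
    formDrt P (ambientFrame b (.inr (.inr u)) P) = P.1 := by
  rw [formDrt_eq, dirDeriv_ambientFrame_r b differentiableAt_id
    (u := fun y => y.2) mdifferentiableAt_snd, dirDeriv_liftR_snd, mul_one, id]

theorem ambientMetric_apply (γ : BilinFamily E G) (P : ℝ × G × ℝ)
    (v w : TangentSpace (ambientModel E) P) :
    ambientMetric γ P v w = formDrt P v * formDt P w + formDt P v * formDrt P w
      + P.1 ^ 2 * γ P.2.1 P.2.2 (projG P v) (projG P w) := by
  simp [ambientMetric]

/-- The components of a family of bilinear forms in the left-invariant frame. -/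
def famGram (γ : BilinFamily E G) (i j : κ) (y : G × ℝ) : ℝ :=
  γ y.1 y.2 (leftFrame b i y.1) (leftFrame b j y.1)

/-- The components of `2 d(ρt) dt + t² a` in the frame `∂_t, e_i, ∂_ρ`. -/
def ambGram (a : κ → κ → G × ℝ → ℝ) : Unit ⊕ κ ⊕ Unit → Unit ⊕ κ ⊕ Unit → ℝ × G × ℝ → ℝ
  | .inl _, .inl _ => fun P => 2 * P.2.2
  | .inl _, .inr (.inl _) => fun _ => 0
  | .inl _, .inr (.inr _) => fun P => P.1
  | .inr (.inl _), .inl _ => fun _ => 0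
  | .inr (.inl i), .inr (.inl j) => fun P => P.1 ^ 2 * a i j P.2
  | .inr (.inl _), .inr (.inr _) => fun _ => 0
  | .inr (.inr _), .inl _ => fun P => P.1
  | .inr (.inr _), .inr _ => fun _ => 0

theorem gram_ambientFrame (γ : BilinFamily E G) (I J : Unit ⊕ κ ⊕ Unit) (P : ℝ × G × ℝ) :
    gram (ambientMetric γ) (ambientFrame b) P I J = ambGram (famGram b γ) I J P := by
  rcases I with u | i | u <;> rcases J with v | j | v <;>
  simp only [gram, Matrix.of_apply, ambientMetric_apply, formDt_ambientFrame_t,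
    formDt_ambientFrame_x, formDt_ambientFrame_r, formDrt_ambientFrame_t, formDrt_ambientFrame_x,
    formDrt_ambientFrame_r, projG_ambientFrame_t, projG_ambientFrame_x, projG_ambientFrame_r,
    map_zero, LinearMap.zero_apply, ambGram, famGram] <;> ring

/-- The derivatives along the frame of the components `ambGram`. -/
def ambGramDeriv (a : κ → κ → G × ℝ → ℝ) (I J K : Unit ⊕ κ ⊕ Unit) (P : ℝ × G × ℝ) : ℝ :=
  match I, J, K with
  | .inl _, .inl _, .inr (.inr _) => 1
  | .inl _, .inr (.inr _), .inl _ => 1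
  | .inl _, .inr (.inl i), .inr (.inl j) => 2 * P.1 * a i j P.2
  | .inr (.inl k), .inr (.inl i), .inr (.inl j) => P.1 ^ 2 * dirDeriv (liftX b k) (a i j) P.2
  | .inr (.inr _), .inl _, .inl _ => 2
  | .inr (.inr _), .inr (.inl i), .inr (.inl j) => P.1 ^ 2 * dirDeriv (liftR E G) (a i j) P.2
  | _, _, _ => 0

theorem dirDeriv_ambGram {a : κ → κ → G × ℝ → ℝ} {P : ℝ × G × ℝ}
    (ha : ∀ i j, MDifferentiableAt (sliceModel E) 𝓘(ℝ, ℝ) (a i j) P.2)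
    (I J K : Unit ⊕ κ ⊕ Unit) :
    dirDeriv (ambientFrame b I) (ambGram a J K) P = ambGramDeriv b a I J K P := by
  have hsq : DifferentiableAt ℝ (fun t : ℝ => t ^ 2) P.1 := by fun_prop
  have h0 : ∀ I, dirDeriv (ambientFrame b I) (fun _ => (0 : ℝ)) P = 0 :=
    fun I => dirDeriv_const _ _ _
  -- The entries `t` and `2ρ` are put in the form `φ(t) u(x, ρ)`, with a constant for one of the
  -- factors.
  have ht : (fun Q : ℝ × G × ℝ => Q.1)
      = fun Q => id Q.1 * (fun _ : G × ℝ => (1 : ℝ)) Q.2 := by simp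
  have hr : (fun Q : ℝ × G × ℝ => 2 * Q.2.2)
      = fun Q => (fun _ : ℝ => (2 : ℝ)) Q.1 * (fun y : G × ℝ => y.2) Q.2 := by simp
  have h1 : MDifferentiableAt (sliceModel E) 𝓘(ℝ, ℝ) (fun _ : G × ℝ => (1 : ℝ)) P.2 :=
    mdifferentiableAt_const
  have h2 : MDifferentiableAt (sliceModel E) 𝓘(ℝ, ℝ) (fun y : G × ℝ => y.2) P.2 :=
    mdifferentiableAt_snd
  have h3 : DifferentiableAt ℝ (fun _ : ℝ => (2 : ℝ)) P.1 := by fun_prop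
  rcases I with u | k | u <;> rcases J with v | i | v <;> rcases K with w | j | w <;>
    simp only [ambGram, ambGramDeriv, h0, ht, hr] <;>
    first
    | rw [dirDeriv_ambientFrame_t b hsq (ha _ _)]; simp
    | rw [dirDeriv_ambientFrame_x b hsq (ha _ _)]
    | rw [dirDeriv_ambientFrame_r b hsq (ha _ _)]
    | rw [dirDeriv_ambientFrame_t b differentiableAt_id h1, deriv_id, one_mul]
    | rw [dirDeriv_ambientFrame_x b differentiableAt_id h1, dirDeriv_const, mul_zero]
    | rw [dirDeriv_ambientFrame_r b differentiableAt_id h1, dirDeriv_const, mul_zero]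
    | rw [dirDeriv_ambientFrame_t b h3 h2, deriv_const, zero_mul]
    | rw [dirDeriv_ambientFrame_x b h3 h2, dirDeriv_liftX_snd, mul_zero]
    | rw [dirDeriv_ambientFrame_r b h3 h2, dirDeriv_liftR_snd, mul_one]

end AmbientGram

/-! ### Geometry of the slices `ρ = const` and the Koszul expressions upstairs -/

section Slice

set_option linter.unusedSectionVars false

variable {E : Type*} [NormedAddCommGroup E] [NormedSpace ℝ E]
  {G : Type*} [TopologicalSpace G] [ChartedSpace E G] [Group G] [LieGroup 𝓘(ℝ, E) ∞ G]
  [CompleteSpace E]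
  {κ : Type*} [Fintype κ] [DecidableEq κ] (b : Module.Basis κ ℝ (GroupLieAlgebra 𝓘(ℝ, E) G))
  (a : κ → κ → G × ℝ → ℝ)

/-- The matrix of components at a point. -/
def slMat (y : G × ℝ) : Matrix κ κ ℝ := Matrix.of fun i j => a i j y

/-- The Koszul expression of the metrics with components `a` on the slices `ρ = const`. -/
def slKoszul (i j k : κ) (y : G × ℝ) : ℝ :=
  (1 / 2) * (dirDeriv (liftX b i) (a j k) y + dirDeriv (liftX b j) (a i k) y
    - dirDeriv (liftX b k) (a i j) y
    + ∑ l, structConst b l i j * a l k y - ∑ l, structConst b l i k * a l j y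
    - ∑ l, structConst b l j k * a l i y)

/-- The connection coefficients of the metrics with components `a` on the slices. -/
def slConn (k i j : κ) (y : G × ℝ) : ℝ := ∑ l, (slMat a y)⁻¹ k l * slKoszul b a i j l y

variable (E) in
/-- Half the derivative in `ρ` of the metrics with components `a`, with one index raised. -/
def slShape (k i : κ) (y : G × ℝ) : ℝ :=
  ∑ l, (slMat a y)⁻¹ k l * (1 / 2 * dirDeriv (liftR E G) (a i l) y)

/-- The components of the Ricci tensors of the metrics with components `a` on the slices. -/
def slRicci (j k : κ) (y : G × ℝ) : ℝ :=
  ∑ i, (dirDeriv (liftX b i) (slConn b a i j k) y - dirDeriv (liftX b j) (slConn b a i i k) y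
    + ∑ m, (slConn b a m j k y * slConn b a i i m y
      - slConn b a m i k y * slConn b a i j m y
      - (slConn b a m i j y - slConn b a m j i y) * slConn b a i m k y))

/-- The Koszul expressions of `2 d(ρt) dt + t² a` in the frame `∂_t, e_i, ∂_ρ`. -/
def ambKoszul (I J K : Unit ⊕ κ ⊕ Unit) (P : ℝ × G × ℝ) : ℝ :=
  match I, J, K with
  | .inl _, .inr (.inl j), .inr (.inl k) => P.1 * a j k P.2
  | .inl _, .inr (.inr _), .inl _ => 1
  | .inr (.inl i), .inl _, .inr (.inl k) => P.1 * a i k P.2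
  | .inr (.inl i), .inr (.inl j), .inl _ => - (P.1 * a i j P.2)
  | .inr (.inl i), .inr (.inl j), .inr (.inl k) => P.1 ^ 2 * slKoszul b a i j k P.2
  | .inr (.inl i), .inr (.inl j), .inr (.inr _) =>
      - (1 / 2 * P.1 ^ 2 * dirDeriv (liftR E G) (a i j) P.2)
  | .inr (.inl i), .inr (.inr _), .inr (.inl k) =>
      1 / 2 * P.1 ^ 2 * dirDeriv (liftR E G) (a i k) P.2
  | .inr (.inr _), .inl _, .inl _ => 1
  | .inr (.inr _), .inr (.inl j), .inr (.inl k) =>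
      1 / 2 * P.1 ^ 2 * dirDeriv (liftR E G) (a j k) P.2
  | _, _, _ => 0

/-- The structure functions of the frame `∂_t, e_i, ∂_ρ`. -/
def ambStruct (K I J : Unit ⊕ κ ⊕ Unit) : ℝ :=
  match K, I, J with
  | .inr (.inl k), .inr (.inl i), .inr (.inl j) => structConst b k i j
  | _, _, _ => 0

theorem mlieBracket_ambientFrame (I J : Unit ⊕ κ ⊕ Unit) (P : ℝ × G × ℝ) :
    mlieBracket (ambientModel E) (ambientFrame b I) (ambientFrame b J) P
      = ∑ K, ambStruct b K I J • ambientFrame b K P := by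
  have h0 : ∀ v : TangentSpace (ambientModel E) P, (0 : ℝ) • v = 0 := fun v => zero_smul ℝ v
  rcases I with u | i | u <;> rcases J with v | j | v <;>
    simp only [Fintype.sum_sum_type, ambStruct, h0, Finset.sum_const_zero, zero_add, add_zero]
  · exact mlieBracket_ambientFrame_tt b u v P
  · exact mlieBracket_ambientFrame_tx b u j P
  · exact mlieBracket_ambientFrame_tr b u v P
  · rw [mlieBracket_swap_apply, mlieBracket_ambientFrame_tx, neg_zero]
  · exact mlieBracket_ambientFrame_x b i j P
  · exact mlieBracket_ambientFrame_xr b i v P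
  · rw [mlieBracket_swap_apply, mlieBracket_ambientFrame_tr, neg_zero]
  · rw [mlieBracket_swap_apply, mlieBracket_ambientFrame_xr, neg_zero]
  · exact mlieBracket_ambientFrame_rr b u v P

theorem koszul_ambientFrame (γ : BilinFamily E G) {P : ℝ × G × ℝ}
    (ha : ∀ i j, MDifferentiableAt (sliceModel E) 𝓘(ℝ, ℝ) (famGram b γ i j) P.2)
    (I J K : Unit ⊕ κ ⊕ Unit) :
    koszul (ambientMetric γ) (ambientFrame b) I J K P = ambKoszul b (famGram b γ) I J K P := by
  have hg : ∀ I J, (fun Q => gram (ambientMetric γ) (ambientFrame b) Q I J)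
      = ambGram (famGram b γ) I J := fun I J => funext fun Q => gram_ambientFrame b γ I J Q
  have hb : ∀ I J K, ambientMetric γ P
      (mlieBracket (ambientModel E) (ambientFrame b I) (ambientFrame b J) P) (ambientFrame b K P)
      = ∑ L, ambStruct b L I J * ambGram (famGram b γ) L K P := by
    intro I J K
    rw [mlieBracket_ambientFrame]
    simp only [map_sum, map_smul, LinearMap.sum_apply, LinearMap.smul_apply, smul_eq_mul]
    exact Finset.sum_congr rfl fun L _ => by rw [← gram_ambientFrame]; rfl
  simp only [koszul, hg, hb, dirDeriv_ambGram b ha]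
  rcases I with u | i | u <;> rcases J with v | j | v <;> rcases K with w | k | w <;>
    simp only [ambGramDeriv, ambKoszul, Fintype.sum_sum_type, ambStruct, ambGram, zero_mul,
      Finset.sum_const_zero, mul_zero] <;>
    first
    | ring1
    | (simp only [slKoszul, mul_left_comm _ (P.1 ^ 2), ← Finset.mul_sum]; ring1)

end Slice

/-! ### Connection coefficients of the ambient metric and their derivatives -/

section AmbientConn

set_option linter.unusedSectionVars false
set_option linter.unusedSimpArgs false

variable {E : Type*} [NormedAddCommGroup E] [NormedSpace ℝ E]
  {G : Type*} [TopologicalSpace G] [ChartedSpace E G] [Group G] [LieGroup 𝓘(ℝ, E) ∞ G]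
  [CompleteSpace E]
  {κ : Type*} [Fintype κ] [DecidableEq κ] (b : Module.Basis κ ℝ (GroupLieAlgebra 𝓘(ℝ, E) G))
  (a : κ → κ → G × ℝ → ℝ)

/-- The inverse of the matrix `ambGram`. -/
def ambInv (P : ℝ × G × ℝ) : Unit ⊕ κ ⊕ Unit → Unit ⊕ κ ⊕ Unit → ℝ
  | .inl _, .inr (.inr _) => P.1⁻¹
  | .inr (.inr _), .inl _ => P.1⁻¹
  | .inr (.inr _), .inr (.inr _) => - (2 * P.2.2 * P.1⁻¹ ^ 2)
  | .inr (.inl i), .inr (.inl j) => P.1⁻¹ ^ 2 * (slMat a P.2)⁻¹ i j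
  | _, _ => 0

theorem sum_slMat_mul_inv {y : G × ℝ} (h : (slMat a y).det ≠ 0) (i j : κ) :
    ∑ l, a i l y * (slMat a y)⁻¹ l j = if i = j then 1 else 0 := by
  have := congrFun (congrFun (Matrix.mul_nonsing_inv (slMat a y) (isUnit_iff_ne_zero.2 h)) i) j
  rwa [Matrix.mul_apply, Matrix.one_apply] at this

theorem sum_inv_mul_slMat {y : G × ℝ} (h : (slMat a y).det ≠ 0) (i j : κ) :
    ∑ l, (slMat a y)⁻¹ i l * a l j y = if i = j then 1 else 0 := by
  have := congrFun (congrFun (Matrix.nonsing_inv_mul (slMat a y) (isUnit_iff_ne_zero.2 h)) i) j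
  rwa [Matrix.mul_apply, Matrix.one_apply] at this

theorem gram_ambientFrame_inv (γ : BilinFamily E G) {P : ℝ × G × ℝ} (ht : P.1 ≠ 0)
    (hdet : (slMat (famGram b γ) P.2).det ≠ 0) (I J : Unit ⊕ κ ⊕ Unit) :
    (gram (ambientMetric γ) (ambientFrame b) P)⁻¹ I J = ambInv (famGram b γ) P I J := by
  -- The `e_i` are orthogonal to `∂_t` and `∂_ρ`, so the matrix splits into the block `t² a` and the
  -- block with rows `(2ρ, t)` and `(t, 0)`. The inverse is confirmed by multiplication.
  have : gram (ambientMetric γ) (ambientFrame b) P * Matrix.of (ambInv (famGram b γ) P) = 1 := by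
    ext I J
    rw [Matrix.mul_apply]
    simp only [gram_ambientFrame, Matrix.of_apply, Fintype.sum_sum_type]
    rcases I with u | i | u <;> rcases J with v | j | v <;>
      simp only [ambGram, ambInv, zero_mul, mul_zero, Finset.sum_const_zero, Matrix.one_apply,
        Finset.univ_unique, Finset.sum_singleton, add_zero, zero_add, reduceCtorEq, if_false,
        Sum.inl.injEq, Sum.inr.injEq, if_true, mul_inv_cancel₀ ht]
    · field_simp; ring
    · have : ∀ l, P.1 ^ 2 * famGram b γ i l P.2
          * (P.1⁻¹ ^ 2 * (slMat (famGram b γ) P.2)⁻¹ l j)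
          = famGram b γ i l P.2 * (slMat (famGram b γ) P.2)⁻¹ l j := fun l => by
        field_simp
      simp only [this]
      exact sum_slMat_mul_inv _ hdet i j
  rw [Matrix.inv_eq_right_inv this]; rfl

/-- The connection coefficients of `2 d(ρt) dt + t² a` in the frame `∂_t, e_i, ∂_ρ`. -/
def ambConn (K I J : Unit ⊕ κ ⊕ Unit) : ℝ × G × ℝ → ℝ :=
  match K, I, J with
  | .inl _, .inl _, _ => fun _ => 0
  | .inl _, .inr (.inr _), _ => fun _ => 0
  | .inl _, .inr (.inl _), .inl _ => fun _ => 0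
  | .inl _, .inr (.inl i), .inr (.inl j) =>
      fun P => P.1 * (-(1 / 2) * dirDeriv (liftR E G) (a i j) P.2)
  | .inl _, .inr (.inl _), .inr (.inr _) => fun _ => 0
  | .inr (.inl _), .inl _, .inl _ => fun _ => 0
  | .inr (.inl k), .inl _, .inr (.inl i) => fun P => P.1⁻¹ * (if k = i then 1 else 0)
  | .inr (.inl _), .inl _, .inr (.inr _) => fun _ => 0
  | .inr (.inl k), .inr (.inl i), .inl _ => fun P => P.1⁻¹ * (if k = i then 1 else 0)
  | .inr (.inl k), .inr (.inl i), .inr (.inl j) => fun P => 1 * slConn b a k i j P.2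
  | .inr (.inl k), .inr (.inl i), .inr (.inr _) => fun P => 1 * slShape E a k i P.2
  | .inr (.inl _), .inr (.inr _), .inl _ => fun _ => 0
  | .inr (.inl k), .inr (.inr _), .inr (.inl i) => fun P => 1 * slShape E a k i P.2
  | .inr (.inl _), .inr (.inr _), .inr (.inr _) => fun _ => 0
  | .inr (.inr _), .inl _, .inl _ => fun _ => 0
  | .inr (.inr _), .inl _, .inr (.inl _) => fun _ => 0
  | .inr (.inr _), .inl _, .inr (.inr _) => fun P => P.1⁻¹ * 1
  | .inr (.inr _), .inr (.inl _), .inl _ => fun _ => 0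
  | .inr (.inr _), .inr (.inl i), .inr (.inl j) =>
      fun P => 1 * (-a i j P.2 + P.2.2 * dirDeriv (liftR E G) (a i j) P.2)
  | .inr (.inr _), .inr (.inl _), .inr (.inr _) => fun _ => 0
  | .inr (.inr _), .inr (.inr _), .inl _ => fun P => P.1⁻¹ * 1
  | .inr (.inr _), .inr (.inr _), .inr _ => fun _ => 0

theorem connCoeff_ambientFrame (γ : BilinFamily E G) {P : ℝ × G × ℝ} (ht : P.1 ≠ 0)
    (hdet : (slMat (famGram b γ) P.2).det ≠ 0)
    (hsymm : ∀ i j, famGram b γ i j P.2 = famGram b γ j i P.2)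
    (ha : ∀ i j, MDifferentiableAt (sliceModel E) 𝓘(ℝ, ℝ) (famGram b γ i j) P.2)
    (K I J : Unit ⊕ κ ⊕ Unit) :
    connCoeff (ambientMetric γ) (ambientFrame b) K I J P = ambConn b (famGram b γ) K I J P := by
  simp only [connCoeff, gram_ambientFrame_inv b γ ht hdet, koszul_ambientFrame b γ ha,
    Fintype.sum_sum_type]
  have hδ : ∀ k i, ∑ l, P.1⁻¹ ^ 2 * (slMat (famGram b γ) P.2)⁻¹ k l * (P.1 * famGram b γ i l P.2)
      = P.1⁻¹ * if k = i then 1 else 0 := by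
    intro k i
    rw [← sum_inv_mul_slMat _ hdet, Finset.mul_sum]
    refine Finset.sum_congr rfl fun l _ => ?_
    rw [hsymm i l]; field_simp
  have hS : ∀ k i, ∑ l, P.1⁻¹ ^ 2 * (slMat (famGram b γ) P.2)⁻¹ k l
      * (1 / 2 * P.1 ^ 2 * dirDeriv (liftR E G) (famGram b γ i l) P.2)
      = slShape E (famGram b γ) k i P.2 := by
    intro k i
    refine Finset.sum_congr rfl fun l _ => ?_
    field_simp
  have hC : ∀ k i j, ∑ l, P.1⁻¹ ^ 2 * (slMat (famGram b γ) P.2)⁻¹ k l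
      * (P.1 ^ 2 * slKoszul b (famGram b γ) i j l P.2) = slConn b (famGram b γ) k i j P.2 := by
    intro k i j
    refine Finset.sum_congr rfl fun l _ => ?_
    field_simp
  rcases K with u | k | u <;> rcases I with v | i | v <;> rcases J with w | j | w <;>
    simp only [ambInv, ambKoszul, ambConn, zero_mul, mul_zero, Finset.sum_const_zero,
      Finset.univ_unique, Finset.sum_singleton, add_zero, zero_add, hδ, hS, hC, one_mul, mul_one]
  all_goals field_simp

variable (E) in
/-- The derivatives of the functions `ambConn` along `∂_t`. -/
def ambConnDerivT (K I J : Unit ⊕ κ ⊕ Unit) (P : ℝ × G × ℝ) : ℝ :=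
  match K, I, J with
  | .inl _, .inl _, _ => 0
  | .inl _, .inr (.inr _), _ => 0
  | .inl _, .inr (.inl _), .inl _ => 0
  | .inl _, .inr (.inl i), .inr (.inl j) => -(1 / 2) * dirDeriv (liftR E G) (a i j) P.2
  | .inl _, .inr (.inl _), .inr (.inr _) => 0
  | .inr (.inl _), .inl _, .inl _ => 0
  | .inr (.inl k), .inl _, .inr (.inl i) => -P.1⁻¹ ^ 2 * (if k = i then 1 else 0)
  | .inr (.inl _), .inl _, .inr (.inr _) => 0
  | .inr (.inl k), .inr (.inl i), .inl _ => -P.1⁻¹ ^ 2 * (if k = i then 1 else 0)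
  | .inr (.inl _), .inr (.inl _), .inr (.inl _) => 0
  | .inr (.inl _), .inr (.inl _), .inr (.inr _) => 0
  | .inr (.inl _), .inr (.inr _), .inl _ => 0
  | .inr (.inl _), .inr (.inr _), .inr (.inl _) => 0
  | .inr (.inl _), .inr (.inr _), .inr (.inr _) => 0
  | .inr (.inr _), .inl _, .inl _ => 0
  | .inr (.inr _), .inl _, .inr (.inl _) => 0
  | .inr (.inr _), .inl _, .inr (.inr _) => -P.1⁻¹ ^ 2
  | .inr (.inr _), .inr (.inl _), .inl _ => 0
  | .inr (.inr _), .inr (.inl _), .inr (.inl _) => 0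
  | .inr (.inr _), .inr (.inl _), .inr (.inr _) => 0
  | .inr (.inr _), .inr (.inr _), .inl _ => -P.1⁻¹ ^ 2
  | .inr (.inr _), .inr (.inr _), .inr _ => 0

/-- The derivatives of the functions `ambConn` along `e_l`. -/
def ambConnDerivX (l : κ) (K I J : Unit ⊕ κ ⊕ Unit) (P : ℝ × G × ℝ) : ℝ :=
  match K, I, J with
  | .inl _, .inl _, _ => 0
  | .inl _, .inr (.inr _), _ => 0
  | .inl _, .inr (.inl _), .inl _ => 0
  | .inl _, .inr (.inl i), .inr (.inl j) =>
      P.1 * dirDeriv (liftX b l) (fun y => -(1 / 2) * dirDeriv (liftR E G) (a i j) y) P.2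
  | .inl _, .inr (.inl _), .inr (.inr _) => 0
  | .inr (.inl _), .inl _, .inl _ => 0
  | .inr (.inl _), .inl _, .inr (.inl _) => 0
  | .inr (.inl _), .inl _, .inr (.inr _) => 0
  | .inr (.inl _), .inr (.inl _), .inl _ => 0
  | .inr (.inl k), .inr (.inl i), .inr (.inl j) => dirDeriv (liftX b l) (slConn b a k i j) P.2
  | .inr (.inl k), .inr (.inl i), .inr (.inr _) => dirDeriv (liftX b l) (slShape E a k i) P.2
  | .inr (.inl _), .inr (.inr _), .inl _ => 0
  | .inr (.inl k), .inr (.inr _), .inr (.inl i) => dirDeriv (liftX b l) (slShape E a k i) P.2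
  | .inr (.inl _), .inr (.inr _), .inr (.inr _) => 0
  | .inr (.inr _), .inl _, .inl _ => 0
  | .inr (.inr _), .inl _, .inr (.inl _) => 0
  | .inr (.inr _), .inl _, .inr (.inr _) => 0
  | .inr (.inr _), .inr (.inl _), .inl _ => 0
  | .inr (.inr _), .inr (.inl i), .inr (.inl j) =>
      dirDeriv (liftX b l) (fun y => -a i j y + y.2 * dirDeriv (liftR E G) (a i j) y) P.2
  | .inr (.inr _), .inr (.inl _), .inr (.inr _) => 0
  | .inr (.inr _), .inr (.inr _), .inl _ => 0
  | .inr (.inr _), .inr (.inr _), .inr _ => 0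

/-- The derivatives of the functions `ambConn` along `∂_ρ`. -/
def ambConnDerivR (K I J : Unit ⊕ κ ⊕ Unit) (P : ℝ × G × ℝ) : ℝ :=
  match K, I, J with
  | .inl _, .inl _, _ => 0
  | .inl _, .inr (.inr _), _ => 0
  | .inl _, .inr (.inl _), .inl _ => 0
  | .inl _, .inr (.inl i), .inr (.inl j) =>
      P.1 * dirDeriv (liftR E G) (fun y => -(1 / 2) * dirDeriv (liftR E G) (a i j) y) P.2
  | .inl _, .inr (.inl _), .inr (.inr _) => 0
  | .inr (.inl _), .inl _, .inl _ => 0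
  | .inr (.inl _), .inl _, .inr (.inl _) => 0
  | .inr (.inl _), .inl _, .inr (.inr _) => 0
  | .inr (.inl _), .inr (.inl _), .inl _ => 0
  | .inr (.inl k), .inr (.inl i), .inr (.inl j) => dirDeriv (liftR E G) (slConn b a k i j) P.2
  | .inr (.inl k), .inr (.inl i), .inr (.inr _) => dirDeriv (liftR E G) (slShape E a k i) P.2
  | .inr (.inl _), .inr (.inr _), .inl _ => 0
  | .inr (.inl k), .inr (.inr _), .inr (.inl i) => dirDeriv (liftR E G) (slShape E a k i) P.2
  | .inr (.inl _), .inr (.inr _), .inr (.inr _) => 0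
  | .inr (.inr _), .inl _, .inl _ => 0
  | .inr (.inr _), .inl _, .inr (.inl _) => 0
  | .inr (.inr _), .inl _, .inr (.inr _) => 0
  | .inr (.inr _), .inr (.inl _), .inl _ => 0
  | .inr (.inr _), .inr (.inl i), .inr (.inl j) =>
      dirDeriv (liftR E G) (fun y => -a i j y + y.2 * dirDeriv (liftR E G) (a i j) y) P.2
  | .inr (.inr _), .inr (.inl _), .inr (.inr _) => 0
  | .inr (.inr _), .inr (.inr _), .inl _ => 0
  | .inr (.inr _), .inr (.inr _), .inr _ => 0

/-- The derivatives along the frame of the functions `ambConn`. -/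
def ambConnDeriv (L K I J : Unit ⊕ κ ⊕ Unit) (P : ℝ × G × ℝ) : ℝ :=
  match L with
  | .inl _ => ambConnDerivT E a K I J P
  | .inr (.inl l) => ambConnDerivX b a l K I J P
  | .inr (.inr _) => ambConnDerivR b a K I J P

variable {b a} {Ω : Set (G × ℝ)} {n m : ℕ∞ω}

theorem contMDiffOn_slX (hmn : m + 1 ≤ n) (hn : n ≤ ∞) (hm : m ≤ ∞) (hΩ : IsOpen Ω) (i : κ)
    {f : G × ℝ → ℝ} (hf : ContMDiffOn (sliceModel E) 𝓘(ℝ, ℝ) n f Ω) :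
    ContMDiffOn (sliceModel E) 𝓘(ℝ, ℝ) m (dirDeriv (liftX b i) f) Ω :=
  ContMDiffOn.dirDeriv hmn hn hΩ ((contMDiff_liftX b i).of_le hm) hf

theorem contMDiffOn_slR (hmn : m + 1 ≤ n) (hn : n ≤ ∞) (hm : m ≤ ∞) (hΩ : IsOpen Ω)
    {f : G × ℝ → ℝ} (hf : ContMDiffOn (sliceModel E) 𝓘(ℝ, ℝ) n f Ω) :
    ContMDiffOn (sliceModel E) 𝓘(ℝ, ℝ) m (dirDeriv (liftR E G) f) Ω :=
  ContMDiffOn.dirDeriv hmn hn hΩ (contMDiff_liftR.of_le hm) hf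

section Smooth

variable (hmn : m + 1 ≤ n) (hn : n ≤ ∞) (hm : m ≤ ∞) (hΩ : IsOpen Ω)
  (ha : ∀ i j, ContMDiffOn (sliceModel E) 𝓘(ℝ, ℝ) n (a i j) Ω)
  (hdet : ∀ y ∈ Ω, (slMat a y).det ≠ 0)
include hmn hn hm hΩ ha

theorem contMDiffOn_slKoszul (i j k : κ) :
    ContMDiffOn (sliceModel E) 𝓘(ℝ, ℝ) m (slKoszul b a i j k) Ω := by
  have hX : ∀ i j k, ContMDiffOn (sliceModel E) 𝓘(ℝ, ℝ) m (dirDeriv (liftX b i) (a j k)) Ω :=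
    fun i j k => contMDiffOn_slX hmn hn hm hΩ i (ha j k)
  have hs : ∀ i j k, ContMDiffOn (sliceModel E) 𝓘(ℝ, ℝ) m
      (fun y => ∑ l, structConst b l i j * a l k y) Ω := fun i j k =>
    contMDiffOn_fun_sum fun l _ => contMDiffOn_fun_mul contMDiffOn_const
      ((ha l k).of_le (le_self_add.trans hmn))
  exact contMDiffOn_fun_mul contMDiffOn_const
    ((((((hX i j k).add (hX j i k)).sub (hX k i j)).add (hs i j k)).sub (hs i k j)).sub (hs j k i))

include hdet

theorem contMDiffOn_slMat_inv (i j : κ) :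
    ContMDiffOn (sliceModel E) 𝓘(ℝ, ℝ) m (fun y => (slMat a y)⁻¹ i j) Ω :=
  contMDiffOn_matrix_inv (fun i j => (ha i j).of_le (le_self_add.trans hmn)) hdet i j

theorem contMDiffOn_slConn (k i j : κ) :
    ContMDiffOn (sliceModel E) 𝓘(ℝ, ℝ) m (slConn b a k i j) Ω :=
  contMDiffOn_fun_sum fun l _ => contMDiffOn_fun_mul
    (contMDiffOn_slMat_inv hmn hn hm hΩ ha hdet k l) (contMDiffOn_slKoszul hmn hn hm hΩ ha i j l)

theorem contMDiffOn_slShape (k i : κ) :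
    ContMDiffOn (sliceModel E) 𝓘(ℝ, ℝ) m (slShape E a k i) Ω :=
  contMDiffOn_fun_sum fun l _ => contMDiffOn_fun_mul
    (contMDiffOn_slMat_inv hmn hn hm hΩ ha hdet k l)
    (contMDiffOn_fun_mul contMDiffOn_const (contMDiffOn_slR hmn hn hm hΩ (ha i l)))

end Smooth

theorem dirDeriv_ambientFrame_mul (b : Module.Basis κ ℝ (GroupLieAlgebra 𝓘(ℝ, E) G)) {φ : ℝ → ℝ}
    {φ' : ℝ} {u : G × ℝ → ℝ} {P : ℝ × G × ℝ} (hφ : HasDerivAt φ φ' P.1)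
    (hu : MDifferentiableAt (sliceModel E) 𝓘(ℝ, ℝ) u P.2) (L : Unit ⊕ κ ⊕ Unit) :
    dirDeriv (ambientFrame b L) (fun Q : ℝ × G × ℝ => φ Q.1 * u Q.2) P =
      match L with
      | .inl _ => φ' * u P.2
      | .inr (.inl l) => φ P.1 * dirDeriv (liftX b l) u P.2
      | .inr (.inr _) => φ P.1 * dirDeriv (liftR E G) u P.2 := by
  rcases L with l | l | l
  · rw [dirDeriv_ambientFrame_t b hφ.differentiableAt hu, hφ.deriv]
  · exact dirDeriv_ambientFrame_x b hφ.differentiableAt hu l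
  · exact dirDeriv_ambientFrame_r b hφ.differentiableAt hu l

theorem dirDeriv_ambConn (hΩ : IsOpen Ω)
    (ha : ∀ i j, ContMDiffOn (sliceModel E) 𝓘(ℝ, ℝ) 2 (a i j) Ω)
    (hdet : ∀ y ∈ Ω, (slMat a y).det ≠ 0) {P : ℝ × G × ℝ} (ht : P.1 ≠ 0) (hP : P.2 ∈ Ω)
    (L K I J : Unit ⊕ κ ⊕ Unit) :
    dirDeriv (ambientFrame b L) (ambConn b a K I J) P = ambConnDeriv b a L K I J P := by
  have h12 : (1 : ℕ∞ω) + 1 ≤ 2 := by norm_num [one_add_one_eq_two]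
  have h1 : (1 : ℕ∞ω) ≤ ∞ := ENat.LEInfty.out
  have md : ∀ {f : G × ℝ → ℝ}, ContMDiffOn (sliceModel E) 𝓘(ℝ, ℝ) 1 f Ω →
      MDifferentiableAt (sliceModel E) 𝓘(ℝ, ℝ) f P.2 := fun hf =>
    (hf.contMDiffAt (hΩ.mem_nhds hP)).mdifferentiableAt one_ne_zero
  have hR : ∀ i j, ContMDiffOn (sliceModel E) 𝓘(ℝ, ℝ) 1 (dirDeriv (liftR E G) (a i j)) Ω :=
    fun i j => contMDiffOn_slR h12 two_le_infty h1 hΩ (ha i j)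
  have u1 := fun i j => md (contMDiffOn_fun_mul (contMDiffOn_const (c := -(1 / 2 : ℝ))) (hR i j))
  have u2 := fun i j => md ((((ha i j).of_le (le_self_add.trans h12)).neg).add
    (contMDiffOn_fun_mul (contMDiff_snd.contMDiffOn) (hR i j)))
  have u3 := fun k i j => md (contMDiffOn_slConn h12 two_le_infty h1 hΩ ha hdet (b := b) k i j)
  have u4 := fun k i => md (contMDiffOn_slShape h12 two_le_infty h1 hΩ ha hdet k i)
  have u5 : ∀ c : ℝ, MDifferentiableAt (sliceModel E) 𝓘(ℝ, ℝ) (fun _ : G × ℝ => c) P.2 :=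
    fun c => mdifferentiableAt_const
  have p1 : HasDerivAt (fun t : ℝ => t) 1 P.1 := hasDerivAt_id _
  have p2 : HasDerivAt (fun _ : ℝ => (1 : ℝ)) 0 P.1 := hasDerivAt_const _ _
  have p3 : HasDerivAt (fun t : ℝ => t⁻¹) (-P.1⁻¹ ^ 2) P.1 := by
    rw [inv_pow]; exact hasDerivAt_inv ht
  -- Each nonzero entry of `ambConn` was written as `φ(t) u(x, ρ)`, with a factor 1 where `t` does
  -- not occur. Hence one of the pairs built from `p1`, `p2`, `p3` and `u1`, ..., `u5` applies; the
  -- remaining entries are the constant 0.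
  rcases K with u | k | u <;> rcases I with v | i | v <;> rcases J with w | j | w
  case inl.inr.inl.inr.inl =>
    refine (dirDeriv_ambientFrame_mul b p1 (u1 i j) L).trans ?_
    rcases L with l | l | l <;> simp only [ambConnDeriv, ambConnDerivT, ambConnDerivX, ambConnDerivR, one_mul]
  case inr.inr.inr.inl.inr.inl =>
    refine (dirDeriv_ambientFrame_mul b p2 (u2 i j) L).trans ?_
    rcases L with l | l | l <;> simp only [ambConnDeriv, ambConnDerivT, ambConnDerivX, ambConnDerivR, one_mul, zero_mul] <;> rfl
  case inr.inl.inr.inl.inr.inl =>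
    refine (dirDeriv_ambientFrame_mul b p2 (u3 k i j) L).trans ?_
    rcases L with l | l | l <;> simp only [ambConnDeriv, ambConnDerivT, ambConnDerivX, ambConnDerivR, one_mul, zero_mul]
  case inr.inl.inr.inl.inr.inr =>
    refine (dirDeriv_ambientFrame_mul b p2 (u4 k i) L).trans ?_
    rcases L with l | l | l <;> simp only [ambConnDeriv, ambConnDerivT, ambConnDerivX, ambConnDerivR, one_mul, zero_mul]
  case inr.inl.inr.inr.inr.inl =>
    refine (dirDeriv_ambientFrame_mul b p2 (u4 k j) L).trans ?_
    rcases L with l | l | l <;> simp only [ambConnDeriv, ambConnDerivT, ambConnDerivX, ambConnDerivR, one_mul, zero_mul]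
  case inr.inl.inr.inl.inl =>
    refine (dirDeriv_ambientFrame_mul b p3 (u5 _) L).trans ?_
    rcases L with l | l | l <;> simp only [ambConnDeriv, ambConnDerivT, ambConnDerivX, ambConnDerivR, dirDeriv_const, mul_zero]
  case inr.inl.inl.inr.inl =>
    refine (dirDeriv_ambientFrame_mul b p3 (u5 _) L).trans ?_
    rcases L with l | l | l <;> simp only [ambConnDeriv, ambConnDerivT, ambConnDerivX, ambConnDerivR, dirDeriv_const, mul_zero]
  case inr.inr.inl.inr.inr =>
    refine (dirDeriv_ambientFrame_mul b p3 (u5 _) L).trans ?_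
    rcases L with l | l | l <;> simp only [ambConnDeriv, ambConnDerivT, ambConnDerivX, ambConnDerivR, dirDeriv_const, mul_zero, mul_one]
  case inr.inr.inr.inr.inl =>
    refine (dirDeriv_ambientFrame_mul b p3 (u5 _) L).trans ?_
    rcases L with l | l | l <;> simp only [ambConnDeriv, ambConnDerivT, ambConnDerivX, ambConnDerivR, dirDeriv_const, mul_zero, mul_one]
  all_goals
    simp only [ambConn, dirDeriv_const]
    rcases L with l | l | l <;> rfl

end AmbientConn

/-! ### The Ricci contraction as pure algebra in the coefficients -/

section Table

set_option linter.unusedSimpArgs false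

variable {κ : Type*} [Fintype κ] [DecidableEq κ]

/-- The pattern of the connection coefficients of an ambient metric in the frame `∂_t, e_i, ∂_ρ`. -/
def tabConn (s : ℝ) (T V : κ → κ → ℝ) (C : κ → κ → κ → ℝ) (S : κ → κ → ℝ)
    (K I J : Unit ⊕ κ ⊕ Unit) : ℝ :=
  match K, I, J with
  | .inl _, .inl _, _ => 0
  | .inl _, .inr (.inr _), _ => 0
  | .inl _, .inr (.inl _), .inl _ => 0
  | .inl _, .inr (.inl i), .inr (.inl j) => T i j
  | .inl _, .inr (.inl _), .inr (.inr _) => 0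
  | .inr (.inl _), .inl _, .inl _ => 0
  | .inr (.inl k), .inl _, .inr (.inl i) => s * (if k = i then 1 else 0)
  | .inr (.inl _), .inl _, .inr (.inr _) => 0
  | .inr (.inl k), .inr (.inl i), .inl _ => s * (if k = i then 1 else 0)
  | .inr (.inl k), .inr (.inl i), .inr (.inl j) => C k i j
  | .inr (.inl k), .inr (.inl i), .inr (.inr _) => S k i
  | .inr (.inl _), .inr (.inr _), .inl _ => 0
  | .inr (.inl k), .inr (.inr _), .inr (.inl i) => S k i
  | .inr (.inl _), .inr (.inr _), .inr (.inr _) => 0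
  | .inr (.inr _), .inl _, .inl _ => 0
  | .inr (.inr _), .inl _, .inr (.inl _) => 0
  | .inr (.inr _), .inl _, .inr (.inr _) => s
  | .inr (.inr _), .inr (.inl _), .inl _ => 0
  | .inr (.inr _), .inr (.inl i), .inr (.inl j) => V i j
  | .inr (.inr _), .inr (.inl _), .inr (.inr _) => 0
  | .inr (.inr _), .inr (.inr _), .inl _ => s
  | .inr (.inr _), .inr (.inr _), .inr _ => 0

/-- The pattern of the derivatives of `tabConn` along the frame `∂_t, e_i, ∂_ρ`. -/
def tabDeriv (s' : ℝ) (T' : κ → κ → ℝ) (TX VX : κ → κ → κ → ℝ) (CX : κ → κ → κ → κ → ℝ)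
    (SX : κ → κ → κ → ℝ) (TR VR : κ → κ → ℝ) (CR : κ → κ → κ → ℝ) (SR : κ → κ → ℝ)
    (L : Unit ⊕ κ ⊕ Unit) : Unit ⊕ κ ⊕ Unit → Unit ⊕ κ ⊕ Unit → Unit ⊕ κ ⊕ Unit → ℝ :=
  match L with
  | .inl _ => tabConn s' T' 0 0 0
  | .inr (.inl l) => tabConn 0 (TX l) (VX l) (CX l) (SX l)
  | .inr (.inr _) => tabConn 0 TR VR CR SR

/-- The Ricci tensor in terms of the connection coefficients and their derivatives. -/
def ricciSum {ι : Type*} [Fintype ι] (Γ : ι → ι → ι → ℝ) (D : ι → ι → ι → ι → ℝ) (J K : ι) : ℝ :=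
  ∑ I, (D I I J K - D J I I K
    + ∑ M, (Γ M J K * Γ I I M - Γ M I K * Γ I J M - (Γ M I J - Γ M J I) * Γ I M K))

variable (s s' : ℝ) (T V : κ → κ → ℝ) (C : κ → κ → κ → ℝ) (S : κ → κ → ℝ)
  (T' : κ → κ → ℝ) (TX VX : κ → κ → κ → ℝ) (CX : κ → κ → κ → κ → ℝ)
  (SX : κ → κ → κ → ℝ) (TR VR : κ → κ → ℝ) (CR : κ → κ → κ → ℝ) (SR : κ → κ → ℝ)

/-- In the application `s = 1/t` and `s' = -1/t²`, so the right-hand side is zero. -/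
theorem ricciSum_tab_tt :
    ricciSum (tabConn s T V C S) (tabDeriv s' T' TX VX CX SX TR VR CR SR) (.inl ()) (.inl ())
      = -(Fintype.card κ + 1) * (s' + s ^ 2) := by
  simp only [ricciSum, Fintype.sum_sum_type]
  simp only [tabDeriv]
  simp only [tabConn]
  simp only [Pi.zero_apply, zero_mul, mul_zero, add_zero, zero_add, sub_zero, zero_sub, sub_self,
    Finset.sum_const_zero]
  simp only [mul_ite, ite_mul, if_true, mul_one, one_mul, mul_zero, zero_mul, Finset.univ_unique,
    Finset.sum_singleton]
  simp only [Finset.sum_add_distrib, Finset.sum_sub_distrib, Finset.sum_neg_distrib,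
    Finset.sum_ite_eq, Finset.sum_ite_eq', Finset.mem_univ, if_true, Finset.sum_const,
    Finset.card_univ, nsmul_eq_mul, Finset.card_singleton, Nat.cast_one, one_mul]
  ring

theorem ricciSum_tab_tx (k : κ) :
    ricciSum (tabConn s T V C S) (tabDeriv s' T' TX VX CX SX TR VR CR SR) (.inl ()) (.inr (.inl k))
      = 0 := by
  simp only [ricciSum, Fintype.sum_sum_type]
  simp only [tabDeriv]
  simp only [tabConn]
  simp only [Pi.zero_apply, zero_mul, mul_zero, add_zero, zero_add, sub_zero, zero_sub, sub_self,
    Finset.sum_const_zero]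
  simp only [mul_ite, ite_mul, if_true, mul_one, one_mul, mul_zero, zero_mul, Finset.univ_unique,
    Finset.sum_singleton]
  simp only [Finset.sum_add_distrib, Finset.sum_sub_distrib, Finset.sum_neg_distrib,
    Finset.sum_ite_eq, Finset.sum_ite_eq', Finset.mem_univ, if_true, Finset.sum_const,
    Finset.card_univ, nsmul_eq_mul, Finset.card_singleton, Nat.cast_one, one_mul]
  simp only [mul_comm s, sub_self]

theorem ricciSum_tab_tr :
    ricciSum (tabConn s T V C S) (tabDeriv s' T' TX VX CX SX TR VR CR SR) (.inl ()) (.inr (.inr ()))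
      = 0 := by
  simp only [ricciSum, Fintype.sum_sum_type]
  simp only [tabDeriv]
  simp only [tabConn]
  simp only [Pi.zero_apply, zero_mul, mul_zero, add_zero, zero_add, sub_zero, zero_sub, sub_self,
    Finset.sum_const_zero]
  simp only [mul_ite, ite_mul, if_true, mul_one, one_mul, mul_zero, zero_mul, Finset.univ_unique,
    Finset.sum_singleton]
  simp only [Finset.sum_add_distrib, Finset.sum_sub_distrib, Finset.sum_neg_distrib,
    Finset.sum_ite_eq, Finset.sum_ite_eq', Finset.mem_univ, if_true, Finset.sum_const,
    Finset.card_univ, nsmul_eq_mul, Finset.card_singleton, Nat.cast_one, one_mul]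
  simp only [mul_comm s, neg_add_cancel]

theorem ricciSum_tab_xt (j : κ) :
    ricciSum (tabConn s T V C S) (tabDeriv s' T' TX VX CX SX TR VR CR SR) (.inr (.inl j)) (.inl ())
      = 0 := by
  simp only [ricciSum, Fintype.sum_sum_type]
  simp only [tabDeriv]
  simp only [tabConn]
  simp only [Pi.zero_apply, zero_mul, mul_zero, add_zero, zero_add, sub_zero, zero_sub, sub_self,
    Finset.sum_const_zero]
  simp only [mul_ite, ite_mul, if_true, mul_one, one_mul, mul_zero, zero_mul, Finset.univ_unique,
    Finset.sum_singleton]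
  simp only [Finset.sum_add_distrib, Finset.sum_sub_distrib, Finset.sum_neg_distrib,
    Finset.sum_ite_eq, Finset.sum_ite_eq', Finset.mem_univ, if_true, Finset.sum_const,
    Finset.card_univ, nsmul_eq_mul, Finset.card_singleton, Nat.cast_one, one_mul]
  simp only [sub_mul, Finset.sum_sub_distrib, mul_comm s, sub_self]

/-- This block carries the evolution equation in `ρ`; its last sum is the Ricci tensor of the slice.
The symmetry of `V` removes the torsion term `(V i j - V j i) S`. -/
theorem ricciSum_tab_xx (hT : ∀ i j, T i j = T j i) (hV : ∀ i j, V i j = V j i) (j k : κ) :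
    ricciSum (tabConn s T V C S) (tabDeriv s' T' TX VX CX SX TR VR CR SR) (.inr (.inl j)) (.inr (.inl k))
      = T' j k + VR j k + (Fintype.card κ - 1) * (s * T j k) + V j k * ∑ i, S i i
        - ∑ m, (S m k * V j m + V m k * S m j)
        + ∑ i, (CX i i j k - CX j i i k + ∑ m, (C m j k * C i i m - C m i k * C i j m
          - (C m i j - C m j i) * C i m k)) := by
  simp only [ricciSum, Fintype.sum_sum_type]
  simp only [tabDeriv]
  simp only [tabConn]
  simp only [Pi.zero_apply, zero_mul, mul_zero, add_zero, zero_add, sub_zero, zero_sub, sub_self,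
    Finset.sum_const_zero]
  simp only [mul_ite, ite_mul, if_true, mul_one, one_mul, mul_zero, zero_mul, Finset.univ_unique,
    Finset.sum_singleton]
  simp only [Finset.sum_add_distrib, Finset.sum_sub_distrib, Finset.sum_neg_distrib,
    Finset.sum_ite_eq, Finset.sum_ite_eq', Finset.mem_univ, if_true, Finset.sum_const,
    Finset.card_univ, nsmul_eq_mul, Finset.card_singleton, Nat.cast_one, one_mul]
  rw [hT k j, Finset.mul_sum]
  simp only [hV _ j, sub_self, zero_mul, Finset.sum_const_zero]
  ring

theorem ricciSum_tab_xr (j : κ) :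
    ricciSum (tabConn s T V C S) (tabDeriv s' T' TX VX CX SX TR VR CR SR) (.inr (.inl j)) (.inr (.inr ()))
      = ∑ i, (SX i i j - SX j i i
        + ∑ m, (S m j * C i i m - S m i * C i j m - (C m i j - C m j i) * S i m)) := by
  simp only [ricciSum, Fintype.sum_sum_type]
  simp only [tabDeriv]
  simp only [tabConn]
  simp only [Pi.zero_apply, zero_mul, mul_zero, add_zero, zero_add, sub_zero, zero_sub, sub_self,
    Finset.sum_const_zero]

theorem ricciSum_tab_rt :
    ricciSum (tabConn s T V C S) (tabDeriv s' T' TX VX CX SX TR VR CR SR) (.inr (.inr ())) (.inl ())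
      = 0 := by
  simp only [ricciSum, Fintype.sum_sum_type]
  simp only [tabDeriv]
  simp only [tabConn]
  simp only [Pi.zero_apply, zero_mul, mul_zero, add_zero, zero_add, sub_zero, zero_sub, sub_self,
    Finset.sum_const_zero]
  simp only [mul_ite, ite_mul, if_true, mul_one, one_mul, mul_zero, zero_mul, Finset.univ_unique,
    Finset.sum_singleton]
  simp only [Finset.sum_add_distrib, Finset.sum_sub_distrib, Finset.sum_neg_distrib,
    Finset.sum_ite_eq, Finset.sum_ite_eq', Finset.mem_univ, if_true, Finset.sum_const,
    Finset.card_univ, nsmul_eq_mul, Finset.card_singleton, Nat.cast_one, one_mul]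
  exact neg_add_cancel _

theorem ricciSum_tab_rx (k : κ) :
    ricciSum (tabConn s T V C S) (tabDeriv s' T' TX VX CX SX TR VR CR SR) (.inr (.inr ())) (.inr (.inl k))
      = ∑ i, (SX i i k - CR i i k + ∑ m, (S m k * C i i m - C m i k * S i m)) := by
  simp only [ricciSum, Fintype.sum_sum_type]
  simp only [tabDeriv]
  simp only [tabConn]
  simp only [Pi.zero_apply, zero_mul, mul_zero, add_zero, zero_add, sub_zero, zero_sub, sub_self,
    Finset.sum_const_zero]

theorem ricciSum_tab_rr :
    ricciSum (tabConn s T V C S) (tabDeriv s' T' TX VX CX SX TR VR CR SR) (.inr (.inr ())) (.inr (.inr ()))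
      = -(∑ i, SR i i) - ∑ i, ∑ m, S m i * S i m := by
  simp only [ricciSum, Fintype.sum_sum_type]
  simp only [tabDeriv]
  simp only [tabConn]
  simp only [Pi.zero_apply, zero_mul, mul_zero, add_zero, zero_add, sub_zero, zero_sub, sub_self,
    Finset.sum_const_zero]
  simp only [sub_eq_add_neg, Finset.sum_add_distrib, Finset.sum_neg_distrib]

end Table

/-! ### The Ricci tensor of an ambient metric in terms of the slices -/

section AmbientRicci

set_option linter.unusedSectionVars false

variable {E : Type*} [NormedAddCommGroup E] [NormedSpace ℝ E]
  {G : Type*} [TopologicalSpace G] [ChartedSpace E G] [Group G] [LieGroup 𝓘(ℝ, E) ∞ G]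
  [CompleteSpace E]
  {κ : Type*} [Fintype κ] [DecidableEq κ] (b : Module.Basis κ ℝ (GroupLieAlgebra 𝓘(ℝ, E) G))
  (a : κ → κ → G × ℝ → ℝ)

/-- The components of the Ricci tensor of `2 d(ρt) dt + t² a` in the frame `∂_t, e_i, ∂_ρ`. -/
def ambRicci (J K : Unit ⊕ κ ⊕ Unit) (y : G × ℝ) : ℝ :=
  match J, K with
  | .inr (.inl j), .inr (.inl k) =>
      y.2 * dirDeriv (liftR E G) (dirDeriv (liftR E G) (a j k)) y
        + (1 - Fintype.card κ / 2) * dirDeriv (liftR E G) (a j k) y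
        + (-a j k y + y.2 * dirDeriv (liftR E G) (a j k) y) * ∑ i, slShape E a i i y
        - y.2 * ∑ m, (slShape E a m k y * dirDeriv (liftR E G) (a j m) y
            + dirDeriv (liftR E G) (a m k) y * slShape E a m j y)
        + slRicci b a j k y
  | .inr (.inr _), .inr (.inr _) =>
      -(∑ i, dirDeriv (liftR E G) (slShape E a i i) y)
        - ∑ i, ∑ m, slShape E a m i y * slShape E a i m y
  | .inr (.inr _), .inr (.inl k) =>
      ∑ i, (dirDeriv (liftX b i) (slShape E a i k) y - dirDeriv (liftR E G) (slConn b a i i k) y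
        + ∑ m, (slShape E a m k y * slConn b a i i m y - slConn b a m i k y * slShape E a i m y))
  | .inr (.inl j), .inr (.inr _) =>
      ∑ i, (dirDeriv (liftX b i) (slShape E a i j) y - dirDeriv (liftX b j) (slShape E a i i) y
        + ∑ m, (slShape E a m j y * slConn b a i i m y - slShape E a m i y * slConn b a i j m y
          - (slConn b a m i j y - slConn b a m j i y) * slShape E a i m y))
  | .inl _, _ => 0
  | .inr (.inl _), .inl _ => 0
  | .inr (.inr _), .inl _ => 0

theorem ambConn_eq_tabConn (K I J : Unit ⊕ κ ⊕ Unit) (P : ℝ × G × ℝ) :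
    ambConn b a K I J P = tabConn P.1⁻¹
      (fun i j => P.1 * (-(1 / 2) * dirDeriv (liftR E G) (a i j) P.2))
      (fun i j => -a i j P.2 + P.2.2 * dirDeriv (liftR E G) (a i j) P.2)
      (fun k i j => slConn b a k i j P.2) (fun k i => slShape E a k i P.2) K I J := by
  rcases K with u | k | u <;> rcases I with v | i | v <;> rcases J with w | j | w <;>
    simp only [ambConn, tabConn, one_mul, mul_one]

theorem ambConnDeriv_eq_tabDeriv (L K I J : Unit ⊕ κ ⊕ Unit) (P : ℝ × G × ℝ) :
    ambConnDeriv b a L K I J P = tabDeriv (-P.1⁻¹ ^ 2)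
      (fun i j => -(1 / 2) * dirDeriv (liftR E G) (a i j) P.2)
      (fun l i j => P.1 * dirDeriv (liftX b l)
        (fun y => -(1 / 2) * dirDeriv (liftR E G) (a i j) y) P.2)
      (fun l i j => dirDeriv (liftX b l)
        (fun y => -a i j y + y.2 * dirDeriv (liftR E G) (a i j) y) P.2)
      (fun l k i j => dirDeriv (liftX b l) (slConn b a k i j) P.2)
      (fun l k i => dirDeriv (liftX b l) (slShape E a k i) P.2)
      (fun i j => P.1 * dirDeriv (liftR E G)
        (fun y => -(1 / 2) * dirDeriv (liftR E G) (a i j) y) P.2)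
      (fun i j => dirDeriv (liftR E G)
        (fun y => -a i j y + y.2 * dirDeriv (liftR E G) (a i j) y) P.2)
      (fun k i j => dirDeriv (liftR E G) (slConn b a k i j) P.2)
      (fun k i => dirDeriv (liftR E G) (slShape E a k i) P.2) L K I J := by
  rcases L with l | l | l <;> rcases K with u | k | u <;> rcases I with v | i | v <;>
    rcases J with w | j | w <;>
    simp only [ambConnDeriv, ambConnDerivT, ambConnDerivX, ambConnDerivR, tabDeriv, tabConn,
      zero_mul, Pi.zero_apply]

/-- The index raised in the definition of the shape operator is lowered again. -/
theorem sum_slShape_mul {y : G × ℝ} (hdet : (slMat a y).det ≠ 0)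
    (hsymm : ∀ i j, dirDeriv (liftR E G) (a i j) y = dirDeriv (liftR E G) (a j i) y) (j k : κ) :
    ∑ m, slShape E a m k y * a j m y = 1 / 2 * dirDeriv (liftR E G) (a j k) y := by
  simp only [slShape, Finset.sum_mul]
  rw [Finset.sum_comm]
  have : ∀ l, ∑ m, (slMat a y)⁻¹ m l * (1 / 2 * dirDeriv (liftR E G) (a k l) y) * a j m y
      = (if j = l then 1 else 0) * (1 / 2 * dirDeriv (liftR E G) (a k l) y) := fun l => by
    rw [← sum_slMat_mul_inv a hdet, Finset.sum_mul]
    exact Finset.sum_congr rfl fun m _ => by ring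
  simp only [this, ite_mul, one_mul, zero_mul, Finset.sum_ite_eq, Finset.mem_univ, if_true]
  rw [hsymm k j]

/-- The powers of `t` cancel in every component, so Ricci-flatness is a system of equations for the
components `γ_{ij}` on `G × ℝ` alone. -/
theorem ricci_ambientFrame {γ : BilinFamily E G} {Ω : Set (G × ℝ)} (hΩ : IsOpen Ω)
    (ha : ∀ i j, ContMDiffOn (sliceModel E) 𝓘(ℝ, ℝ) 2 (famGram b γ i j) Ω)
    (hsymm : ∀ y ∈ Ω, ∀ i j, famGram b γ i j y = famGram b γ j i y)
    (hdet : ∀ y ∈ Ω, (slMat (famGram b γ) y).det ≠ 0) {P : ℝ × G × ℝ} (ht : 0 < P.1)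
    (hP : P.2 ∈ Ω) (J K : Unit ⊕ κ ⊕ Unit) :
    ricci (ambientMetric γ) (ambientFrame b) J K P = ambRicci b (famGram b γ) J K P.2 := by
  set a := famGram b γ with ha_def
  -- The connection coefficients are differentiated once more, so their formula is needed on a
  -- neighbourhood of `P`.
  have hnear : ∀ᶠ Q : ℝ × G × ℝ in 𝓝 P, 0 < Q.1 ∧ Q.2 ∈ Ω :=
    ((isOpen_lt continuous_const continuous_fst).inter (hΩ.preimage continuous_snd)).mem_nhds
      ⟨ht, hP⟩
  have hmd : ∀ y ∈ Ω, ∀ i j, MDifferentiableAt (sliceModel E) 𝓘(ℝ, ℝ) (a i j) y := fun y hy i j =>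
    ((ha i j).contMDiffAt (hΩ.mem_nhds hy)).mdifferentiableAt (by simp)
  have hc : ∀ Q : ℝ × G × ℝ, 0 < Q.1 → Q.2 ∈ Ω → ∀ K I J,
      connCoeff (ambientMetric γ) (ambientFrame b) K I J Q = ambConn b a K I J Q :=
    fun Q h1 h2 K I J => connCoeff_ambientFrame b γ h1.ne' (hdet _ h2) (hsymm _ h2) (hmd _ h2) K I J
  have hd : ∀ L K I J, dirDeriv (ambientFrame b L)
      (connCoeff (ambientMetric γ) (ambientFrame b) K I J) P = ambConnDeriv b a L K I J P := by
    intro L K I J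
    rw [← dirDeriv_ambConn hΩ ha hdet ht.ne' hP]
    exact dirDeriv_congr (hnear.mono fun Q hQ => hc Q hQ.1 hQ.2 K I J)
  have hsR : ∀ i j, dirDeriv (liftR E G) (a i j) P.2 = dirDeriv (liftR E G) (a j i) P.2 :=
    fun i j => dirDeriv_congr (Filter.eventually_of_mem (hΩ.mem_nhds hP) fun y hy => hsymm y hy i j)
  have hR1 : ∀ i j, MDifferentiableAt (sliceModel E) 𝓘(ℝ, ℝ) (dirDeriv (liftR E G) (a i j)) P.2 :=
    fun i j => ((contMDiffOn_slR (m := 1) (by norm_num [one_add_one_eq_two]) two_le_infty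
      ENat.LEInfty.out hΩ (ha i j)).contMDiffAt (hΩ.mem_nhds hP)).mdifferentiableAt one_ne_zero
  have hVR : ∀ i j, dirDeriv (liftR E G)
      (fun y => -a i j y + y.2 * dirDeriv (liftR E G) (a i j) y) P.2
        = P.2.2 * dirDeriv (liftR E G) (dirDeriv (liftR E G) (a i j)) P.2 := by
    intro i j
    have h1 : MDifferentiableAt (sliceModel E) 𝓘(ℝ, ℝ) (fun y : G × ℝ => y.2) P.2 :=
      mdifferentiableAt_snd
    simp only [neg_eq_neg_one_mul (a i j _)]
    rw [dirDeriv_add (f := fun y => -1 * a i j y) (g := fun y => y.2 * dirDeriv (liftR E G) (a i j) y)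
        (mdifferentiableAt_const.mul (hmd _ hP i j)) (h1.mul (hR1 i j)),
      dirDeriv_const_mul _ (hmd _ hP i j), dirDeriv_mul h1 (hR1 i j), dirDeriv_liftR_snd]
    ring
  simp only [ricci, hc P ht hP, hd, ambConn_eq_tabConn, ambConnDeriv_eq_tabDeriv]
  change ricciSum (tabConn _ _ _ _ _) (tabDeriv _ _ _ _ _ _ _ _ _ _) J K = _
  rcases J with ⟨⟩ | j | ⟨⟩ <;> rcases K with ⟨⟩ | k | ⟨⟩
  · rw [ricciSum_tab_tt, ambRicci]; ring
  · rw [ricciSum_tab_tx, ambRicci]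
  · rw [ricciSum_tab_tr, ambRicci]
  · rw [ricciSum_tab_xt, ambRicci]
  · rw [ricciSum_tab_xx, ambRicci, hVR]
    · have e1 := sum_slShape_mul a (hdet _ hP) hsR j k
      have e2 := sum_slShape_mul a (hdet _ hP) hsR k j
      -- The `-a` part of the coefficients `V` contributes one full `∂_ρ a`. With the `-n/2` from
      -- the coefficients `T`, namely `-1/2` from `T'` and `-(n-1)/2` from `(n-1) s T`, this makes
      -- the factor `1 - n/2`.
      have e3 : ∑ m, (slShape E a m k P.2 * (-a j m P.2 + P.2.2 * dirDeriv (liftR E G) (a j m) P.2)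
          + (-a m k P.2 + P.2.2 * dirDeriv (liftR E G) (a m k) P.2) * slShape E a m j P.2)
          = P.2.2 * ∑ m, (slShape E a m k P.2 * dirDeriv (liftR E G) (a j m) P.2
            + dirDeriv (liftR E G) (a m k) P.2 * slShape E a m j P.2)
            - dirDeriv (liftR E G) (a j k) P.2 := by
        have : dirDeriv (liftR E G) (a j k) P.2 = ∑ m, slShape E a m k P.2 * a j m P.2
            + ∑ m, slShape E a m j P.2 * a k m P.2 := by
          rw [e1, e2, hsR k j]; ring
        rw [this, Finset.mul_sum, ← Finset.sum_add_distrib, ← Finset.sum_sub_distrib]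
        refine Finset.sum_congr rfl fun m _ => ?_
        rw [hsymm _ hP m k]; ring
      have ht0 := ht.ne'
      rw [e3, slRicci]
      field_simp
      ring
    · intro i j; rw [hsR i j]
    · intro i j; rw [hsR i j, hsymm _ hP i j]
  · rw [ricciSum_tab_xr, ambRicci]
  · rw [ricciSum_tab_rt, ambRicci]
  · rw [ricciSum_tab_rx, ambRicci]
  · rw [ricciSum_tab_rr, ambRicci]

end AmbientRicci

/-! ### The weight filtration of the semi-direct sum -/

section Grading

/-- The weights of the elements of an adapted basis. -/
def wt {p r : ℕ} : AdaptedIndex p r → ℕ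
  | .inl _ => 2
  | .inr (.inl _) => 1
  | .inr (.inr _) => 0

/-- The brackets respect the filtration of the Lie algebra by the weights. -/
def IsGradedBasis {p r : ℕ} {L : Type*} [LieRing L] [LieAlgebra ℝ L]
    (b : Module.Basis (AdaptedIndex p r) ℝ L) : Prop :=
  ∀ k i j, structConst b k i j ≠ 0 → wt i + wt j ≤ wt k

theorem structConst_map {κ L L' : Type*} [LieRing L] [LieAlgebra ℝ L] [LieRing L']
    [LieAlgebra ℝ L'] (b : Module.Basis κ ℝ L) (ψ : L ≃ₗ⁅ℝ⁆ L') (k i j : κ) :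
    structConst (b.map ψ.toLinearEquiv) k i j = structConst b k i j := by
  have h : ⁅ψ (b i), ψ (b j)⁆ = ψ ⁅b i, b j⁆ := (ψ.map_lie _ _).symm
  have h2 : ψ.toLinearEquiv.symm (ψ ⁅b i, b j⁆) = ⁅b i, b j⁆ := ψ.toLinearEquiv.symm_apply_apply _
  simp only [structConst, Module.Basis.map_apply, Module.Basis.map_repr, LinearEquiv.trans_apply]
  change b.repr (ψ.toLinearEquiv.symm ⁅ψ (b i), ψ (b j)⁆) k = _
  rw [h, h2]

theorem structConst_swap {κ L : Type*} [LieRing L] [LieAlgebra ℝ L] (b : Module.Basis κ ℝ L)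
    (k i j : κ) : structConst b k i j = -structConst b k j i := by
  rw [structConst, ← lie_skew, map_neg]; rfl

variable {𝔥 𝔨 : Type*} [LieRing 𝔥] [LieAlgebra ℝ 𝔥] [LieRing 𝔨] [LieAlgebra ℝ 𝔨]
    (φ : 𝔥 →ₗ⁅ℝ⁆ LieDerivation ℝ 𝔨 𝔨) {p r : ℕ}
    (bk : Module.Basis (Fin p ⊕ Fin r) ℝ 𝔨) (bh : Module.Basis (Fin p) ℝ 𝔥)

theorem adaptedBasis_iz (a : Fin p) : adaptedBasis φ bk bh (iz a) = ⟨bk (.inl a), 0⟩ := by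
  have : adaptedBasis φ bk bh (iz a) = (LieAlgebra.SemiDirectSum.toProdl φ).symm
      ((bk.prod bh) (.inl (.inl a))) := by simp [adaptedBasis, iz]
  rw [this, Module.Basis.prod_apply]; rfl

theorem adaptedBasis_im (a : Fin r) : adaptedBasis φ bk bh (im a) = ⟨bk (.inr a), 0⟩ := by
  have : adaptedBasis φ bk bh (im a) = (LieAlgebra.SemiDirectSum.toProdl φ).symm
      ((bk.prod bh) (.inl (.inr a))) := by simp [adaptedBasis, im]
  rw [this, Module.Basis.prod_apply]; rfl

theorem adaptedBasis_ih (a : Fin p) : adaptedBasis φ bk bh (ih a) = ⟨0, bh a⟩ := by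
  have : adaptedBasis φ bk bh (ih a) = (LieAlgebra.SemiDirectSum.toProdl φ).symm
      ((bk.prod bh) (.inr a)) := by simp [adaptedBasis, ih]
  rw [this, Module.Basis.prod_apply]; rfl

theorem adaptedBasis_repr_iz (x : LieAlgebra.SemiDirectSum 𝔨 𝔥 φ) (a : Fin p) :
    (adaptedBasis φ bk bh).repr x (iz a) = bk.repr x.left (.inl a) := by
  simp [adaptedBasis, iz]

theorem adaptedBasis_repr_im (x : LieAlgebra.SemiDirectSum 𝔨 𝔥 φ) (a : Fin r) :
    (adaptedBasis φ bk bh).repr x (im a) = bk.repr x.left (.inr a) := by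
  simp [adaptedBasis, im]

theorem adaptedBasis_repr_ih (x : LieAlgebra.SemiDirectSum 𝔨 𝔥 φ) (a : Fin p) :
    (adaptedBasis φ bk bh).repr x (ih a) = bh.repr x.right a := by
  simp [adaptedBasis, ih]

variable {bk}

theorem repr_inr_eq_zero_of_mem_center
    (h_centre : Submodule.span ℝ (Set.range fun a : Fin p => bk (Sum.inl a))
      = (LieAlgebra.center ℝ 𝔨).toSubmodule) {x : 𝔨} (hx : ∀ y : 𝔨, ⁅x, y⁆ = 0) (A : Fin r) :
    bk.repr x (.inr A) = 0 := by
  have hx' : x ∈ Submodule.span ℝ (Set.range fun a : Fin p => bk (Sum.inl a)) := by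
    rw [h_centre]
    refine (LieModule.mem_maxTrivSubmodule ℝ 𝔨 𝔨 x).2 fun y => ?_
    rw [← lie_skew, hx, neg_zero]
  clear hx
  induction hx' using Submodule.span_induction with
  | mem x h => obtain ⟨a, rfl⟩ := h; simp
  | zero => simp
  | add x y _ _ h1 h2 => rw [map_add, Finsupp.add_apply, h1, h2, add_zero]
  | smul c x _ h => rw [map_smul, Finsupp.smul_apply, h, smul_zero]

theorem lie_inl_eq_zero
    (h_centre : Submodule.span ℝ (Set.range fun a : Fin p => bk (Sum.inl a))
      = (LieAlgebra.center ℝ 𝔨).toSubmodule) (a : Fin p) (x : 𝔨) : ⁅bk (.inl a), x⁆ = 0 := by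
  have : bk (.inl a) ∈ (LieAlgebra.center ℝ 𝔨).toSubmodule := by
    rw [← h_centre]; exact Submodule.subset_span ⟨a, rfl⟩
  rw [← lie_skew, (LieModule.mem_maxTrivSubmodule ℝ 𝔨 𝔨 _).1 this x, neg_zero]

/-- The possible violations of the weight inequality are excluded by four facts: `𝔨` is an ideal,
`[𝔨, 𝔨]` lies in the centre, the centre commutes with `𝔨`, and derivations preserve the centre. -/
theorem isGradedBasis_adaptedBasis (h_nilp : ∀ x y z : 𝔨, ⁅x, ⁅y, z⁆⁆ = 0)
    (h_centre : Submodule.span ℝ (Set.range fun a : Fin p => bk (Sum.inl a))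
      = (LieAlgebra.center ℝ 𝔨).toSubmodule) : IsGradedBasis (adaptedBasis φ bk bh) := by
  have hz := lie_inl_eq_zero h_centre
  have hz' : ∀ a (x : 𝔨), ⁅x, bk (.inl a)⁆ = 0 := fun a x => by rw [← lie_skew, hz, neg_zero]
  -- For central `z` and a derivation `D`, `0 = D[z, y] = [Dz, y] + [z, Dy] = [Dz, y]`, so `Dz` is
  -- central.
  have hφ : ∀ u a A, bk.repr (φ u (bk (.inl a))) (.inr A) = 0 := by
    intro u a A
    refine repr_inr_eq_zero_of_mem_center h_centre (fun y => ?_) A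
    have := (φ u).apply_lie_eq_add (bk (.inl a)) y
    rw [hz, map_zero, hz, zero_add] at this
    exact this.symm
  have hkk : ∀ (x y : 𝔨) A, bk.repr ⁅x, y⁆ (.inr A) = 0 := fun x y A =>
    repr_inr_eq_zero_of_mem_center h_centre (fun z => by rw [← lie_skew, h_nilp, neg_zero]) A
  intro k i j h
  contrapose! h
  rcases i with i | i | i <;> rcases j with j | j | j <;> rcases k with k | k | k <;>
    simp only [wt] at h <;> (try omega) <;>
    simp only [structConst, adaptedBasis_repr_iz, adaptedBasis_repr_im, adaptedBasis_repr_ih,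
      adaptedBasis_iz, adaptedBasis_im, adaptedBasis_ih, LieAlgebra.SemiDirectSum.lie_eq_mk,
      hz, hz', hφ, hkk, map_zero, map_neg, lie_zero, zero_lie, add_zero, zero_add,
      sub_zero, zero_sub, Finsupp.coe_neg, Finsupp.coe_zero, Pi.neg_apply, Pi.zero_apply, neg_zero,
      LieDerivation.zero_apply]

/-- A complement of the centre whose elements commute with each other would be central, hence zero.
This excludes a one-dimensional complement, and also a trivial centre, since `[𝔨, 𝔨]` is central.
Consequently `n = 3` cannot occur, which is what makes `ρ^{n/2}` twice continuously differentiable.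
-/
theorem one_le_of_centre (h_nilp : ∀ x y z : 𝔨, ⁅x, ⁅y, z⁆⁆ = 0) (hn : 3 ≤ 2 * p + r)
    (h_centre : Submodule.span ℝ (Set.range fun a : Fin p => bk (Sum.inl a))
      = (LieAlgebra.center ℝ 𝔨).toSubmodule) : r ≠ 1 ∧ 1 ≤ p := by
  have key : (∀ A B, ⁅bk (.inr A), bk (.inr B)⁆ = 0) → r = 0 := by
    intro h
    by_contra hr
    let A : Fin r := ⟨0, by omega⟩
    have h0 : ∀ y : 𝔨, ⁅bk (.inr A), y⁆ = 0 := by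
      intro y
      rw [← bk.sum_repr y, lie_sum]
      refine Finset.sum_eq_zero fun i _ => ?_
      rw [lie_smul]
      rcases i with i | i
      · rw [← lie_skew, lie_inl_eq_zero h_centre, neg_zero, smul_zero]
      · rw [h, smul_zero]
    have := repr_inr_eq_zero_of_mem_center h_centre h0 A
    simp at this
  constructor
  · rintro rfl
    have := key fun A B => by rw [Subsingleton.elim A B, lie_self]
    omega
  · by_contra hp
    obtain rfl : p = 0 := by omega
    have := key fun A B => by
      have hkk : ∀ C, bk.repr ⁅bk (.inr A), bk (.inr B)⁆ (.inr C) = 0 := fun C =>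
        repr_inr_eq_zero_of_mem_center h_centre (fun z => by rw [← lie_skew, h_nilp, neg_zero]) C
      refine bk.repr.injective (Finsupp.ext fun i => ?_)
      rcases i with i | i
      · exact i.elim0
      · rw [hkk, map_zero]; rfl
    omega

end Grading

/-! ### The matrix of the left-invariant metric and its weights -/

section AdaptedMatrix

variable {p r : ℕ} (gz : Matrix (Fin p) (Fin p) ℝ) (gm : Matrix (Fin r) (Fin r) ℝ)

/-- The components of the metric `2 g_{ac̄} Θ^a ∘ Θ^c̄ + g_{AB} Θ^A ∘ Θ^B`. -/
def adaptedMatrix : Matrix (AdaptedIndex p r) (AdaptedIndex p r) ℝ := Matrix.of fun i j =>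
  match i, j with
  | .inl a, .inr (.inr c) => gz a c
  | .inr (.inr c), .inl a => gz a c
  | .inr (.inl A), .inr (.inl B) => gm A B
  | _, _ => 0

/-- The inverse of `adaptedMatrix`. -/
def adaptedInv : Matrix (AdaptedIndex p r) (AdaptedIndex p r) ℝ := Matrix.of fun i j =>
  match i, j with
  | .inl a, .inr (.inr c) => gz⁻¹ c a
  | .inr (.inr c), .inl a => gz⁻¹ c a
  | .inr (.inl A), .inr (.inl B) => gm⁻¹ A B
  | _, _ => 0

variable {gz gm}

theorem adaptedMatrix_mul_adaptedInv (hgz : IsUnit gz.det) (hgm : IsUnit gm.det) :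
    adaptedMatrix gz gm * adaptedInv gz gm = 1 := by
  have hz : ∀ i j, ∑ l, gz i l * gz⁻¹ l j = (1 : Matrix _ _ ℝ) i j := fun i j => by
    rw [← Matrix.mul_nonsing_inv gz hgz, Matrix.mul_apply]
  have hz' : ∀ i j, ∑ l, gz⁻¹ i l * gz l j = (1 : Matrix _ _ ℝ) i j := fun i j => by
    rw [← Matrix.nonsing_inv_mul gz hgz, Matrix.mul_apply]
  have hm : ∀ i j, ∑ l, gm i l * gm⁻¹ l j = (1 : Matrix _ _ ℝ) i j := fun i j => by
    rw [← Matrix.mul_nonsing_inv gm hgm, Matrix.mul_apply]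
  ext i j
  rw [Matrix.mul_apply]
  rcases i with i | i | i <;> rcases j with j | j | j <;>
    simp [adaptedMatrix, adaptedInv, Fintype.sum_sum_type, hz, hm, Matrix.one_apply]
  have := hz' j i
  simp only [mul_comm (gz⁻¹ _ _)] at this
  rw [this, Matrix.one_apply]
  simp only [eq_comm]

theorem adaptedMatrix_symm (hgm : gm.IsSymm) (i j : AdaptedIndex p r) :
    adaptedMatrix gz gm i j = adaptedMatrix gz gm j i := by
  rcases i with i | i | i <;> rcases j with j | j | j <;> simp [adaptedMatrix]
  exact hgm.apply j i

/-- Lowering an index replaces the weight `w` by `2 - w`. The inverse has the same pattern, so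
raising an index does so too. -/
theorem wt_of_adaptedMatrix_ne_zero {i j : AdaptedIndex p r} (h : adaptedMatrix gz gm i j ≠ 0) :
    wt i + wt j = 2 := by
  rcases i with i | i | i <;> rcases j with j | j | j <;> simp_all [adaptedMatrix, wt]

theorem wt_of_adaptedInv_ne_zero {i j : AdaptedIndex p r} (h : adaptedInv gz gm i j ≠ 0) :
    wt i + wt j = 2 := by
  rcases i with i | i | i <;> rcases j with j | j | j <;> simp_all [adaptedInv, wt]

end AdaptedMatrix

/-! ### Curvature of left-invariant connections -/

section ConstantRicci

variable {κ : Type*} [Fintype κ] {L : Type*} [LieRing L] [LieAlgebra ℝ L]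
  (b : Module.Basis κ ℝ L)

theorem structConst_jacobi (l i j k : κ) :
    ∑ m, (structConst b m j k * structConst b l i m + structConst b m k i * structConst b l j m
      + structConst b m i j * structConst b l k m) = 0 := by
  have h : ∀ i j k, b.repr ⁅b i, ⁅b j, b k⁆⁆ l
      = ∑ m, structConst b m j k * structConst b l i m := by
    intro i j k
    conv_lhs => rw [← b.sum_repr ⁅b j, b k⁆, lie_sum, map_sum, Finsupp.finsetSum_apply]
    refine Finset.sum_congr rfl fun m _ => ?_
    rw [lie_smul, map_smul]; rfl
  rw [Finset.sum_add_distrib, Finset.sum_add_distrib, ← h, ← h, ← h, ← Finsupp.add_apply,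
    ← Finsupp.add_apply, ← map_add, ← map_add, lie_jacobi, map_zero, Finsupp.zero_apply]

/-- The components of the curvature of a left-invariant connection. -/
def constCurv (Γ : κ → κ → κ → ℝ) (l i j k : κ) : ℝ :=
  ∑ m, (Γ m j k * Γ l i m - Γ m i k * Γ l j m - (Γ m i j - Γ m j i) * Γ l m k)

/-- The components of the Ricci tensor of a left-invariant connection. -/
def constRic (Γ : κ → κ → κ → ℝ) (j k : κ) : ℝ := ∑ i, constCurv Γ i i j k

variable {b}

/-- For a torsion-free connection the structure constants are the antisymmetrised coefficients, and
the cyclic sum of the curvature becomes the Jacobi expression. -/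
theorem constCurv_bianchi {Γ : κ → κ → κ → ℝ} (hT : ∀ k i j, Γ k i j - Γ k j i = structConst b k i j)
    (l i j k : κ) : constCurv Γ l i j k + constCurv Γ l j k i + constCurv Γ l k i j = 0 := by
  rw [← structConst_jacobi b l i j k, constCurv, constCurv, constCurv, ← Finset.sum_add_distrib,
    ← Finset.sum_add_distrib]
  refine Finset.sum_congr rfl fun m _ => ?_
  simp only [← hT]; ring

/-- The constants `R_{āc̄}` enter the ambient family, which must be symmetric. The symmetry follows
by contracting the first Bianchi identity. -/
theorem constRic_symm {Γ : κ → κ → κ → ℝ} (hT : ∀ k i j, Γ k i j - Γ k j i = structConst b k i j)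
    (htr : ∀ i, ∑ m, Γ m i m = 0) (j k : κ) : constRic Γ j k = constRic Γ k j := by
  -- This is the trace of the curvature endomorphism, which vanishes because each connection
  -- endomorphism has trace zero and the remaining products cancel as a trace of a commutator.
  have h1 : ∑ i, constCurv Γ i j k i = 0 := by
    have e : ∀ i, constCurv Γ i j k i = ∑ m, Γ m k i * Γ i j m - ∑ m, Γ m j i * Γ i k m
        - ∑ m, (Γ m j k - Γ m k j) * Γ i m i := fun i => by
      rw [constCurv, Finset.sum_sub_distrib, Finset.sum_sub_distrib]
    simp only [e, Finset.sum_sub_distrib]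
    rw [Finset.sum_comm (f := fun i m => (Γ m j k - Γ m k j) * Γ i m i),
      Finset.sum_comm (f := fun i m => Γ m k i * Γ i j m)]
    simp only [← Finset.mul_sum, htr, mul_zero, Finset.sum_const_zero, sub_zero]
    simp only [mul_comm, sub_self]
  have h2 : constRic Γ j k + ∑ i, constCurv Γ i j k i + ∑ i, constCurv Γ i k i j = 0 := by
    rw [constRic, ← Finset.sum_add_distrib, ← Finset.sum_add_distrib]
    exact Finset.sum_eq_zero fun i _ => constCurv_bianchi hT i i j k
  have h3 : ∑ i, constCurv Γ i k i j = - constRic Γ k j := by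
    rw [constRic, ← Finset.sum_neg_distrib]
    refine Finset.sum_congr rfl fun i _ => ?_
    rw [constCurv, constCurv, ← Finset.sum_neg_distrib]
    exact Finset.sum_congr rfl fun m _ => by ring
  rw [h1, h3] at h2; linarith

variable (b) [DecidableEq κ] (g : Matrix κ κ ℝ)

/-- The Koszul expression of a left-invariant metric. -/
def constKoszul (i j k : κ) : ℝ :=
  (1 / 2) * (∑ l, structConst b l i j * g l k - ∑ l, structConst b l i k * g l j
    - ∑ l, structConst b l j k * g l i)

/-- The connection coefficients of a left-invariant metric. -/
def constConn (k i j : κ) : ℝ := ∑ l, g⁻¹ k l * constKoszul b g i j l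

variable {g}

theorem constConn_torsion (hg : IsUnit g.det) (hs : ∀ i j, g i j = g j i) (k i j : κ) :
    constConn b g k i j - constConn b g k j i = structConst b k i j := by
  have e : ∀ l, g⁻¹ k l * constKoszul b g i j l - g⁻¹ k l * constKoszul b g j i l
      = ∑ m, structConst b m i j * (g⁻¹ k l * g l m) := fun l => by
    rw [← mul_sub]
    have : constKoszul b g i j l - constKoszul b g j i l = ∑ m, structConst b m i j * g m l := by
      have : ∑ m, structConst b m j i * g m l = -∑ m, structConst b m i j * g m l := by
        rw [← Finset.sum_neg_distrib]
        exact Finset.sum_congr rfl fun m _ => by rw [structConst_swap b m j i]; ring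
      rw [constKoszul, constKoszul, this]; ring
    rw [this, Finset.mul_sum]
    exact Finset.sum_congr rfl fun m _ => by rw [hs m l]; ring
  rw [constConn, constConn, ← Finset.sum_sub_distrib]
  simp only [e]
  rw [Finset.sum_comm]
  simp only [← Finset.mul_sum]
  have : ∀ m, ∑ l, g⁻¹ k l * g l m = if k = m then 1 else 0 := fun m => by
    rw [← Matrix.mul_apply, Matrix.nonsing_inv_mul g hg, Matrix.one_apply]
  simp [this]

/-- The Koszul expression is antisymmetric in its last two arguments, as for every metric connection
in a frame with constant components, and `g⁻¹` is symmetric, so the trace equals its own negative.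
-/
theorem constConn_trace (hs : ∀ i j, g i j = g j i) (i : κ) : ∑ m, constConn b g m i m = 0 := by
  have hs' : ∀ i j, g⁻¹ i j = g⁻¹ j i := fun i j => by
    have : g.transpose = g := Matrix.ext fun i j => hs j i
    rw [← Matrix.transpose_apply g⁻¹, Matrix.transpose_nonsing_inv, this]
  have hK : ∀ j k, constKoszul b g i j k = - constKoszul b g i k j := fun j k => by
    have : ∑ l, structConst b l k j * g l i = -∑ l, structConst b l j k * g l i := by
      rw [← Finset.sum_neg_distrib]
      exact Finset.sum_congr rfl fun m _ => by rw [structConst_swap b m k j]; ring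
    rw [constKoszul, constKoszul, this]; ring
  have h : ∑ m, constConn b g m i m = -∑ m, constConn b g m i m := by
    conv_lhs => simp only [constConn]
    rw [Finset.sum_comm, ← Finset.sum_neg_distrib]
    refine Finset.sum_congr rfl fun m _ => ?_
    rw [constConn, ← Finset.sum_neg_distrib]
    exact Finset.sum_congr rfl fun l _ => by rw [hs' l m, hK l m]; ring
  linarith

end ConstantRicci

section LeftInvariant

set_option linter.unusedSectionVars false

variable {E : Type*} [NormedAddCommGroup E] [NormedSpace ℝ E] [CompleteSpace E]
  {G : Type*} [TopologicalSpace G] [ChartedSpace E G] [Group G] [LieGroup 𝓘(ℝ, E) ∞ G]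
  {κ : Type*} [Fintype κ] [DecidableEq κ] (b : Module.Basis κ ℝ (GroupLieAlgebra 𝓘(ℝ, E) G))

theorem connCoeff_of_const {g : BilinField 𝓘(ℝ, E) G} {g0 : Matrix κ κ ℝ}
    (hg : ∀ x, gram g (leftFrame b) x = g0) (k i j : κ) :
    connCoeff g (leftFrame b) k i j = fun _ => constConn b g0 k i j := by
  funext x
  have h0 : ∀ x i j, g x (leftFrame b i x) (leftFrame b j x) = g0 i j := fun x i j => by
    rw [← hg x]; rfl
  simp only [connCoeff, koszul, hg, dirDeriv_const, mlieBracket_leftFrame, map_sum, map_smul,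
    LinearMap.sum_apply, LinearMap.smul_apply, smul_eq_mul, h0, constConn, constKoszul, add_zero,
    zero_add, sub_zero]

theorem ricci_of_const {g : BilinField 𝓘(ℝ, E) G} {g0 : Matrix κ κ ℝ}
    (hg : ∀ x, gram g (leftFrame b) x = g0) (j k : κ) (x : G) :
    ricci g (leftFrame b) j k x = constRic (constConn b g0) j k := by
  simp only [ricci, connCoeff_of_const b hg, dirDeriv_const, sub_zero, zero_add]
  rfl

theorem gram_leftMetric {p r : ℕ} (b : Module.Basis (AdaptedIndex p r) ℝ (GroupLieAlgebra 𝓘(ℝ, E) G))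
    (gz : Matrix (Fin p) (Fin p) ℝ) (gm : Matrix (Fin r) (Fin r) ℝ) (x : G) :
    gram (leftMetric b gz gm) (leftFrame b) x = adaptedMatrix gz gm := by
  ext i j
  simp only [gram, leftMetric, Matrix.of_apply, LinearMap.add_apply, LinearMap.sum_apply,
    LinearMap.smul_apply, LinearMap.smulRight_apply, smul_eq_mul, coframe_leftFrame]
  rcases i with i | i | i <;> rcases j with j | j | j <;>
    simp [adaptedMatrix]

end LeftInvariant

/-! ### Cancellation of quadratic curvature terms by weights -/

section WeightAlgebra

variable {κ : Type*} [Fintype κ] {w : κ → ℕ}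

/-- In each product of two coefficients the weights of the contracted indices cancel when the two
inequalities are added, which leaves `w j + w k ≤ 0`. -/
theorem constRic_eq_zero {Γ : κ → κ → κ → ℝ} (hΓ : ∀ k i j, Γ k i j ≠ 0 → w i + w j ≤ w k)
    {j k : κ} (h : w j + w k ≠ 0) : constRic Γ j k = 0 := by
  refine Finset.sum_eq_zero fun i _ => Finset.sum_eq_zero fun m _ => ?_
  have e1 : Γ m j k * Γ i i m = 0 := by
    by_contra hne
    have h1 := hΓ _ _ _ (left_ne_zero_of_mul hne)
    have h2 := hΓ _ _ _ (right_ne_zero_of_mul hne)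
    omega
  have e2 : Γ m i k * Γ i j m = 0 := by
    by_contra hne
    have h1 := hΓ _ _ _ (left_ne_zero_of_mul hne)
    have h2 := hΓ _ _ _ (right_ne_zero_of_mul hne)
    omega
  have e3 : Γ m i j * Γ i m k = 0 := by
    by_contra hne
    have h1 := hΓ _ _ _ (left_ne_zero_of_mul hne)
    have h2 := hΓ _ _ _ (right_ne_zero_of_mul hne)
    omega
  have e4 : Γ m j i * Γ i m k = 0 := by
    by_contra hne
    have h1 := hΓ _ _ _ (left_ne_zero_of_mul hne)
    have h2 := hΓ _ _ _ (right_ne_zero_of_mul hne)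
    omega
  rw [sub_mul, e1, e2, e3, e4]; ring

/-- A product with at least one factor `δ` would give `w j + w k + 1 ≤ 0` by the same addition of
inequalities, which is impossible. So the correction is invisible in the quadratic part. -/
theorem constRic_add {Γ δ Γ' : κ → κ → κ → ℝ} (hΓ : ∀ k i j, Γ k i j ≠ 0 → w i + w j ≤ w k)
    (hδ : ∀ k i j, δ k i j ≠ 0 → w i + w j + 1 ≤ w k) (h : ∀ k i j, Γ' k i j = Γ k i j + δ k i j)
    (j k : κ) : constRic Γ' j k = constRic Γ j k := by
  have key : ∀ a b c d e f : κ, (w b + w c ≤ w a → w e + w f ≤ w d → w b + w c + 1 ≤ w a ∨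
      w e + w f + 1 ≤ w d → False) → Γ' a b c * Γ' d e f = Γ a b c * Γ d e f := by
    intro a b c d e f hk
    rw [h, h]
    have e1 : Γ a b c * δ d e f = 0 := by
      by_contra hne
      have h1 := hΓ _ _ _ (left_ne_zero_of_mul hne)
      have h2 := hδ _ _ _ (right_ne_zero_of_mul hne)
      exact hk h1 (by omega) (.inr h2)
    have e2 : δ a b c * Γ d e f = 0 := by
      by_contra hne
      have h1 := hδ _ _ _ (left_ne_zero_of_mul hne)
      have h2 := hΓ _ _ _ (right_ne_zero_of_mul hne)
      exact hk (by omega) h2 (.inl h1)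
    have e3 : δ a b c * δ d e f = 0 := by
      by_contra hne
      have h1 := hδ _ _ _ (left_ne_zero_of_mul hne)
      have h2 := hδ _ _ _ (right_ne_zero_of_mul hne)
      exact hk (by omega) (by omega) (.inl h1)
    linear_combination e1 + e2 + e3
  refine Finset.sum_congr rfl fun i _ => Finset.sum_congr rfl fun m _ => ?_
  rw [sub_mul, sub_mul, key m j k i i m (by omega), key m i k i j m (by omega),
    key m i j i m k (by omega), key m j i i m k (by omega)]

theorem sum_mul_ne_zero {f g : κ → ℝ} (h : ∑ l, f l * g l ≠ 0) : ∃ l, f l ≠ 0 ∧ g l ≠ 0 := by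
  obtain ⟨l, -, hl⟩ := Finset.exists_ne_zero_of_sum_ne_zero h
  exact ⟨l, left_ne_zero_of_mul hl, right_ne_zero_of_mul hl⟩

end WeightAlgebra

/-! ### Perturbations in the directions of `𝔥` and functions annihilated by `𝔷` -/

section Perturbation

set_option linter.unusedSectionVars false

variable {E : Type*} [NormedAddCommGroup E] [NormedSpace ℝ E]
  {G : Type*} [TopologicalSpace G] [ChartedSpace E G] [Group G] {p r : ℕ}

/-- The components of `h_{āc̄} Θ^ā Θ^c̄`. -/
def hExt (h : Fin p → Fin p → G × ℝ → ℝ) (i j : AdaptedIndex p r) : G × ℝ → ℝ :=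
  match i, j with
  | .inr (.inr a), .inr (.inr c) => h a c
  | _, _ => fun _ => 0

/-- The components of `2 g_{ac̄} Θ^a ∘ Θ^c̄ + g_{AB} Θ^A ∘ Θ^B + h_{āc̄} Θ^ā Θ^c̄`. -/
def pertComp (gz : Matrix (Fin p) (Fin p) ℝ) (gm : Matrix (Fin r) (Fin r) ℝ)
    (h : Fin p → Fin p → G × ℝ → ℝ) (i j : AdaptedIndex p r) (y : G × ℝ) : ℝ :=
  adaptedMatrix gz gm i j + hExt h i j y

variable {h : Fin p → Fin p → G × ℝ → ℝ} {gz : Matrix (Fin p) (Fin p) ℝ}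
  {gm : Matrix (Fin r) (Fin r) ℝ}

theorem hExt_of_wt {i j : AdaptedIndex p r} (hw : ¬ (wt i = 0 ∧ wt j = 0)) :
    hExt h i j = fun _ => 0 := by
  rcases i with i | i | i <;> rcases j with j | j | j <;> simp_all [wt, hExt]

theorem wt_of_hExt_ne_zero {i j : AdaptedIndex p r} {y : G × ℝ} (hne : hExt h i j y ≠ 0) :
    wt i = 0 ∧ wt j = 0 := by
  by_contra hw; rw [hExt_of_wt hw] at hne; exact hne rfl

theorem wt_of_dirDeriv_hExt_ne_zero {X : ∀ y : G × ℝ, TangentSpace (sliceModel E) y}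
    {i j : AdaptedIndex p r} {y : G × ℝ} (hne : dirDeriv X (hExt h i j) y ≠ 0) :
    wt i = 0 ∧ wt j = 0 := by
  by_contra hw; rw [hExt_of_wt hw] at hne; exact hne (dirDeriv_const _ _ _)

/-- The correction of the inverse matrix. -/
def invCorr (gz : Matrix (Fin p) (Fin p) ℝ) (gm : Matrix (Fin r) (Fin r) ℝ)
    (h : Fin p → Fin p → G × ℝ → ℝ) (i j : AdaptedIndex p r) (y : G × ℝ) : ℝ :=
  ∑ l, ∑ m, adaptedInv gz gm i l * hExt h l m y * adaptedInv gz gm m j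

theorem wt_of_invCorr_ne_zero {i j : AdaptedIndex p r} {y : G × ℝ}
    (hne : invCorr gz gm h i j y ≠ 0) : wt i = 2 ∧ wt j = 2 := by
  obtain ⟨l, -, hl⟩ := Finset.exists_ne_zero_of_sum_ne_zero hne
  obtain ⟨m, -, hm⟩ := Finset.exists_ne_zero_of_sum_ne_zero hl
  have h1 := wt_of_adaptedInv_ne_zero (right_ne_zero_of_mul hm)
  have h2 := wt_of_adaptedInv_ne_zero (left_ne_zero_of_mul (left_ne_zero_of_mul hm))
  have h3 := wt_of_hExt_ne_zero (right_ne_zero_of_mul (left_ne_zero_of_mul hm))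
  omega

/-- The Neumann series for the inverse of `g + h` stops after its linear term. In particular the
metric stays nondegenerate for every `h`, however large. -/
theorem slMat_pertComp_mul (hgz : IsUnit gz.det) (hgm : IsUnit gm.det) (y : G × ℝ) :
    slMat (pertComp gz gm h) y * (adaptedInv gz gm - Matrix.of fun i j => invCorr gz gm h i j y)
      = 1 := by
  set H : Matrix (AdaptedIndex p r) (AdaptedIndex p r) ℝ := Matrix.of fun i j => hExt h i j y
  have e1 : slMat (pertComp gz gm h) y = adaptedMatrix gz gm + H := rfl
  have e2 : (Matrix.of fun i j => invCorr gz gm h i j y)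
      = adaptedInv gz gm * H * adaptedInv gz gm := by
    ext i j
    simp only [Matrix.mul_apply, Matrix.of_apply, invCorr, Finset.sum_mul, H]
    exact Finset.sum_comm
  -- The inverse pairs weights with sum 2, while both factors `H` require weight 0 at the contracted
  -- indices.
  have e3 : H * adaptedInv gz gm * H = 0 := by
    ext i j
    simp only [Matrix.mul_apply, Finset.sum_mul, Matrix.zero_apply]
    refine Finset.sum_eq_zero fun l _ => Finset.sum_eq_zero fun m _ => ?_
    by_contra hm
    have h1 := wt_of_hExt_ne_zero (h := h) (y := y) (right_ne_zero_of_mul hm)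
    have h2 := wt_of_hExt_ne_zero (h := h) (y := y) (left_ne_zero_of_mul (left_ne_zero_of_mul hm))
    have h3 := wt_of_adaptedInv_ne_zero (right_ne_zero_of_mul (left_ne_zero_of_mul hm))
    omega
  have e4 := adaptedMatrix_mul_adaptedInv hgz hgm
  rw [e1, e2]
  calc _ = adaptedMatrix gz gm * adaptedInv gz gm + H * adaptedInv gz gm
        - (adaptedMatrix gz gm * adaptedInv gz gm) * H * adaptedInv gz gm
        - (H * adaptedInv gz gm * H) * adaptedInv gz gm := by noncomm_ring
    _ = 1 := by rw [e4, e3]; noncomm_ring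

theorem slMat_pertComp_inv (hgz : IsUnit gz.det) (hgm : IsUnit gm.det) (y : G × ℝ)
    (i j : AdaptedIndex p r) : (slMat (pertComp gz gm h) y)⁻¹ i j
      = adaptedInv gz gm i j - invCorr gz gm h i j y := by
  rw [Matrix.inv_eq_right_inv (slMat_pertComp_mul hgz hgm y)]; rfl

theorem det_pertComp_ne_zero (hgz : IsUnit gz.det) (hgm : IsUnit gm.det) (y : G × ℝ) :
    (slMat (pertComp gz gm h) y).det ≠ 0 := fun h0 => by
  have := congrArg Matrix.det (slMat_pertComp_mul (h := h) hgz hgm y)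
  rw [Matrix.det_mul, h0, zero_mul, Matrix.det_one] at this
  exact zero_ne_one this

variable [LieGroup 𝓘(ℝ, E) ∞ G] [CompleteSpace E]
  (b : Module.Basis (AdaptedIndex p r) ℝ (GroupLieAlgebra 𝓘(ℝ, E) G))

/-- The functions `h` are twice differentiable on the open set `Ω` and annihilated by the elements
of `𝔷`. -/
structure IsAdaptedPert (h : Fin p → Fin p → G × ℝ → ℝ) (Ω : Set (G × ℝ)) : Prop where
  isOpen : IsOpen Ω
  contMDiffOn : ∀ a c, ContMDiffOn (sliceModel E) 𝓘(ℝ, ℝ) 2 (h a c) Ω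
  annihilated : ∀ a c d, ∀ y ∈ Ω, dirDeriv (liftX b (iz d)) (h a c) y = 0

/-- `f` is differentiable on `Ω` and annihilated by the elements of `𝔷`. -/
def ZInv (f : G × ℝ → ℝ) (Ω : Set (G × ℝ)) : Prop :=
  ∀ y ∈ Ω, MDifferentiableAt (sliceModel E) 𝓘(ℝ, ℝ) f y ∧ ∀ d, dirDeriv (liftX b (iz d)) f y = 0

variable {b} {Ω : Set (G × ℝ)}

theorem ZInv.const (c : ℝ) : ZInv b (fun _ => c) Ω := fun _ _ =>
  ⟨mdifferentiableAt_const, fun _ => dirDeriv_const _ _ _⟩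

theorem ZInv.add {f g : G × ℝ → ℝ} (hf : ZInv b f Ω) (hg : ZInv b g Ω) :
    ZInv b (fun y => f y + g y) Ω := fun y hy =>
  ⟨(hf y hy).1.add (hg y hy).1, fun d => by
    rw [dirDeriv_add (hf y hy).1 (hg y hy).1, (hf y hy).2, (hg y hy).2, add_zero]⟩

theorem ZInv.mul {f g : G × ℝ → ℝ} (hf : ZInv b f Ω) (hg : ZInv b g Ω) :
    ZInv b (fun y => f y * g y) Ω := fun y hy =>
  ⟨(hf y hy).1.mul (hg y hy).1, fun d => by
    rw [dirDeriv_mul (hf y hy).1 (hg y hy).1, (hf y hy).2, (hg y hy).2, mul_zero, zero_mul,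
      add_zero]⟩

theorem ZInv.sub {f g : G × ℝ → ℝ} (hf : ZInv b f Ω) (hg : ZInv b g Ω) :
    ZInv b (fun y => f y - g y) Ω := by
  simpa only [neg_one_mul, ← sub_eq_add_neg] using hf.add ((ZInv.const (-1)).mul hg)

theorem ZInv.sum {α : Type*} {s : Finset α} {f : α → G × ℝ → ℝ} (hf : ∀ i ∈ s, ZInv b (f i) Ω) :
    ZInv b (fun y => ∑ i ∈ s, f i y) Ω := fun y hy =>
  ⟨mdifferentiableAt_fun_sum fun i hi => (hf i hi y hy).1, fun d => by
    rw [dirDeriv_sum fun i hi => (hf i hi y hy).1]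
    exact Finset.sum_eq_zero fun i hi => (hf i hi y hy).2 d⟩

theorem ZInv.congr {f g : G × ℝ → ℝ} (hΩ : IsOpen Ω) (hf : ZInv b f Ω)
    (hfg : ∀ y ∈ Ω, g y = f y) : ZInv b g Ω := fun y hy => by
  have he : g =ᶠ[𝓝 y] f := Filter.eventually_of_mem (hΩ.mem_nhds hy) hfg
  exact ⟨(hf y hy).1.congr_of_eventuallyEq he, fun d => by
    rw [dirDeriv_congr he]; exact (hf y hy).2 d⟩

/-- The bracket of an element of weight 2 with any `e_i` has weight at least 2, so it lies in `𝔷`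
and annihilates `f` as well. -/
theorem ZInv.liftX {f : G × ℝ → ℝ} (hb : IsGradedBasis b) (hΩ : IsOpen Ω)
    (hf2 : ContMDiffOn (sliceModel E) 𝓘(ℝ, ℝ) 2 f Ω) (hf : ZInv b f Ω) (i : AdaptedIndex p r) :
    ZInv b (dirDeriv (liftX b i) f) Ω := fun y hy => by
  refine ⟨((contMDiffOn_slX (m := 1) (by norm_num [one_add_one_eq_two]) two_le_infty
      ENat.LEInfty.out hΩ i hf2).contMDiffAt (hΩ.mem_nhds hy)).mdifferentiableAt one_ne_zero,
    fun d => ?_⟩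
  have h1 := dirDeriv_liftX_comm b (iz d) i hΩ hf2 hy
  have h2 : dirDeriv (_root_.liftX b i) (dirDeriv (_root_.liftX b (iz d)) f) y = 0 := by
    rw [dirDeriv_congr (g := fun _ => 0), dirDeriv_const]
    exact Filter.eventually_of_mem (hΩ.mem_nhds hy) fun z hz => (hf z hz).2 d
  rw [h2, sub_zero] at h1
  rw [h1]
  refine Finset.sum_eq_zero fun k _ => ?_
  by_contra hne
  have h3 := hb _ _ _ (left_ne_zero_of_mul hne)
  have h4 := right_ne_zero_of_mul hne
  rcases k with k | k | k
  · exact h4 ((hf y hy).2 k)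
  · change 2 + wt i ≤ 1 at h3; omega
  · change 2 + wt i ≤ 0 at h3; omega

theorem ZInv.liftR {f : G × ℝ → ℝ} (hΩ : IsOpen Ω)
    (hf2 : ContMDiffOn (sliceModel E) 𝓘(ℝ, ℝ) 2 f Ω) (hf : ZInv b f Ω) :
    ZInv b (dirDeriv (liftR E G) f) Ω := fun y hy => by
  refine ⟨((contMDiffOn_slR (m := 1) (by norm_num [one_add_one_eq_two]) two_le_infty
      ENat.LEInfty.out hΩ hf2).contMDiffAt (hΩ.mem_nhds hy)).mdifferentiableAt one_ne_zero,
    fun d => ?_⟩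
  rw [dirDeriv_liftX_liftR b (iz d) hΩ hf2 hy, dirDeriv_congr (g := fun _ => 0), dirDeriv_const]
  exact Filter.eventually_of_mem (hΩ.mem_nhds hy) fun z hz => (hf z hz).2 d

end Perturbation

/-! ### The Ricci equation becomes linear -/

section PertRicci

set_option linter.unusedSectionVars false

variable {E : Type*} [NormedAddCommGroup E] [NormedSpace ℝ E]
  {G : Type*} [TopologicalSpace G] [ChartedSpace E G] [Group G] [LieGroup 𝓘(ℝ, E) ∞ G]
  [CompleteSpace E] {p r : ℕ}
  {b : Module.Basis (AdaptedIndex p r) ℝ (GroupLieAlgebra 𝓘(ℝ, E) G)}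
  {h : Fin p → Fin p → G × ℝ → ℝ} {gz : Matrix (Fin p) (Fin p) ℝ}
  {gm : Matrix (Fin r) (Fin r) ℝ} {Ω : Set (G × ℝ)}

theorem adaptedMatrix_inv (hgz : IsUnit gz.det) (hgm : IsUnit gm.det) :
    (adaptedMatrix gz gm)⁻¹ = adaptedInv gz gm :=
  Matrix.inv_eq_right_inv (adaptedMatrix_mul_adaptedInv hgz hgm)

theorem isUnit_det_adaptedMatrix (hgz : IsUnit gz.det) (hgm : IsUnit gm.det) :
    IsUnit (adaptedMatrix gz gm).det :=
  Matrix.isUnit_det_of_right_inverse (adaptedMatrix_mul_adaptedInv hgz hgm)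

/-- A nonzero summand satisfies `wt i + wt j ≤ wt l = 2 - wt k`, and the bound is symmetric in the
three indices. -/
theorem wt_of_constKoszul_ne_zero (hb : IsGradedBasis b) {i j k : AdaptedIndex p r}
    (hne : constKoszul b (adaptedMatrix gz gm) i j k ≠ 0) : wt i + wt j + wt k ≤ 2 := by
  have key : ∀ i j k, 2 < wt i + wt j + wt k →
      ∑ l, structConst b l i j * adaptedMatrix gz gm l k = 0 := by
    intro i j k hw
    by_contra hne
    obtain ⟨l, h1, h2⟩ := sum_mul_ne_zero hne
    have h1 := hb _ _ _ h1
    have h2 := wt_of_adaptedMatrix_ne_zero h2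
    omega
  contrapose! hne
  rw [constKoszul, key i j k hne, key i k j (by omega), key j k i (by omega)]; ring

theorem wt_of_constConn_ne_zero (hb : IsGradedBasis b) (hgz : IsUnit gz.det) (hgm : IsUnit gm.det)
    {k i j : AdaptedIndex p r} (hne : constConn b (adaptedMatrix gz gm) k i j ≠ 0) :
    wt i + wt j ≤ wt k := by
  rw [constConn, adaptedMatrix_inv hgz hgm] at hne
  obtain ⟨l, h1, h2⟩ := sum_mul_ne_zero hne
  have h1 := wt_of_adaptedInv_ne_zero h1
  have h2 := wt_of_constKoszul_ne_zero hb h2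
  omega

theorem IsAdaptedPert.contMDiffOn_hExt (hp : IsAdaptedPert b h Ω) (i j : AdaptedIndex p r) :
    ContMDiffOn (sliceModel E) 𝓘(ℝ, ℝ) 2 (hExt h i j) Ω := by
  rcases i with i | i | i <;> rcases j with j | j | j <;>
    first | exact contMDiffOn_const | exact hp.contMDiffOn i j

theorem IsAdaptedPert.contMDiffOn_pertComp (hp : IsAdaptedPert b h Ω) (i j : AdaptedIndex p r) :
    ContMDiffOn (sliceModel E) 𝓘(ℝ, ℝ) 2 (pertComp gz gm h i j) Ω :=
  contMDiffOn_const.add (hp.contMDiffOn_hExt i j)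

theorem IsAdaptedPert.mdifferentiableAt_hExt (hp : IsAdaptedPert b h Ω) (i j : AdaptedIndex p r)
    {y : G × ℝ} (hy : y ∈ Ω) : MDifferentiableAt (sliceModel E) 𝓘(ℝ, ℝ) (hExt h i j) y :=
  ((hp.contMDiffOn_hExt i j).contMDiffAt (hp.isOpen.mem_nhds hy)).mdifferentiableAt two_ne_zero

theorem IsAdaptedPert.zInv_hExt (hp : IsAdaptedPert b h Ω) (i j : AdaptedIndex p r) :
    ZInv b (hExt h i j) Ω := fun y hy => by
  refine ⟨hp.mdifferentiableAt_hExt i j hy, fun d => ?_⟩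
  rcases i with i | i | i <;> rcases j with j | j | j <;>
    first | exact dirDeriv_const _ _ _ | exact hp.annihilated i j d y hy

theorem dirDeriv_pertComp (hp : IsAdaptedPert b h Ω)
    (X : ∀ y : G × ℝ, TangentSpace (sliceModel E) y) (i j : AdaptedIndex p r) {y : G × ℝ}
    (hy : y ∈ Ω) : dirDeriv X (pertComp gz gm h i j) y = dirDeriv X (hExt h i j) y := by
  rw [show pertComp gz gm h i j = fun y => (fun _ => adaptedMatrix gz gm i j) y + hExt h i j y
    from rfl, dirDeriv_add mdifferentiableAt_const (hp.mdifferentiableAt_hExt i j hy),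
    dirDeriv_const, zero_add]

theorem slKoszul_pertComp (hp : IsAdaptedPert b h Ω) (i j k : AdaptedIndex p r) {y : G × ℝ}
    (hy : y ∈ Ω) : slKoszul b (pertComp gz gm h) i j k y
      = constKoszul b (adaptedMatrix gz gm) i j k + slKoszul b (hExt h) i j k y := by
  have e : ∀ i j k, ∑ l, structConst b l i j * pertComp gz gm h l k y
      = ∑ l, structConst b l i j * adaptedMatrix gz gm l k
        + ∑ l, structConst b l i j * hExt h l k y := fun i j k => by
    simp only [pertComp, mul_add, Finset.sum_add_distrib]
  simp only [slKoszul, dirDeriv_pertComp hp _ _ _ hy, constKoszul, e]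
  ring

/-- The bracket terms force all weights to be zero. In the derivative terms both indices of `h` have
weight 0, and the derivative has weight at most 1 because elements of `𝔷` annihilate `h`. So the
bound is one better than for the metric `g`. -/
theorem wt_of_slKoszul_hExt_ne_zero (hb : IsGradedBasis b) (hp : IsAdaptedPert b h Ω)
    {i j k : AdaptedIndex p r} {y : G × ℝ} (hy : y ∈ Ω) (hne : slKoszul b (hExt h) i j k y ≠ 0) :
    wt i + wt j + wt k ≤ 1 := by
  have key : ∀ i j k, 1 < wt i + wt j + wt k →
      ∑ l, structConst b l i j * hExt h l k y = 0 := by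
    intro i j k hw
    by_contra hne
    obtain ⟨l, h1, h2⟩ := sum_mul_ne_zero hne
    have h1 := hb _ _ _ h1
    have h2 := wt_of_hExt_ne_zero h2
    omega
  have key2 : ∀ i j k : AdaptedIndex p r, 1 < wt i + wt j + wt k → dirDeriv (liftX b i) (hExt h j k) y = 0 := by
    intro i j k hw
    by_contra hne
    have h2 := wt_of_dirDeriv_hExt_ne_zero hne
    rcases i with i | i | i
    · exact hne ((hp.zInv_hExt j k y hy).2 i)
    · change 1 < 1 + _ + _ at hw; omega
    · change 1 < 0 + _ + _ at hw; omega
  contrapose! hne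
  rw [slKoszul, key i j k hne, key i k j (by omega), key j k i (by omega), key2 i j k hne,
    key2 j i k (by omega), key2 k i j (by omega)]
  ring

/-- The difference of the connection coefficients of the metric `pertComp` and of those of the
left-invariant metric. -/
def connCorr (b : Module.Basis (AdaptedIndex p r) ℝ (GroupLieAlgebra 𝓘(ℝ, E) G))
    (gz : Matrix (Fin p) (Fin p) ℝ) (gm : Matrix (Fin r) (Fin r) ℝ)
    (h : Fin p → Fin p → G × ℝ → ℝ) (k i j : AdaptedIndex p r) (y : G × ℝ) : ℝ :=
  ∑ l, adaptedInv gz gm k l * slKoszul b (hExt h) i j l y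
    - ∑ l, invCorr gz gm h k l y
      * (constKoszul b (adaptedMatrix gz gm) i j l + slKoszul b (hExt h) i j l y)

theorem slConn_pertComp (hgz : IsUnit gz.det) (hgm : IsUnit gm.det) (hp : IsAdaptedPert b h Ω)
    (k i j : AdaptedIndex p r) {y : G × ℝ} (hy : y ∈ Ω) :
    slConn b (pertComp gz gm h) k i j y
      = constConn b (adaptedMatrix gz gm) k i j + connCorr b gz gm h k i j y := by
  simp only [slConn, slMat_pertComp_inv hgz hgm, slKoszul_pertComp hp _ _ _ hy, constConn,
    adaptedMatrix_inv hgz hgm, connCorr, ← Finset.sum_add_distrib, ← Finset.sum_sub_distrib]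
  exact Finset.sum_congr rfl fun l _ => by ring

/-- In the first sum the sharper bound for `h` is raised by `g⁻¹`. In the second, the correction of
the inverse needs weight 2 at both indices, which forces `wt i = wt j = 0` and `wt k = 2`. -/
theorem wt_of_connCorr_ne_zero (hb : IsGradedBasis b) (hp : IsAdaptedPert b h Ω)
    {k i j : AdaptedIndex p r} {y : G × ℝ} (hy : y ∈ Ω) (hne : connCorr b gz gm h k i j y ≠ 0) :
    wt i + wt j + 1 ≤ wt k := by
  contrapose! hne
  rw [connCorr]
  have e1 : ∑ l, adaptedInv gz gm k l * slKoszul b (hExt h) i j l y = 0 := by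
    by_contra h0
    obtain ⟨l, h1, h2⟩ := sum_mul_ne_zero h0
    have h1 := wt_of_adaptedInv_ne_zero h1
    have h2 := wt_of_slKoszul_hExt_ne_zero hb hp hy h2
    omega
  have e2 : ∑ l, invCorr gz gm h k l y
      * (constKoszul b (adaptedMatrix gz gm) i j l + slKoszul b (hExt h) i j l y) = 0 := by
    by_contra h0
    obtain ⟨l, h1, h2⟩ := sum_mul_ne_zero h0
    have h1 := wt_of_invCorr_ne_zero h1
    by_cases h3 : constKoszul b (adaptedMatrix gz gm) i j l = 0
    · rw [h3, zero_add] at h2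
      have h2 := wt_of_slKoszul_hExt_ne_zero hb hp hy h2
      omega
    · have h3 := wt_of_constKoszul_ne_zero hb h3
      omega
  rw [e1, e2, sub_zero]

theorem zInv_slConn_pertComp (hb : IsGradedBasis b) (hgz : IsUnit gz.det) (hgm : IsUnit gm.det)
    (hp : IsAdaptedPert b h Ω) (k i j : AdaptedIndex p r) :
    ZInv b (slConn b (pertComp gz gm h) k i j) Ω := by
  have hk : ∀ i j k, ZInv b (slKoszul b (hExt h) i j k) Ω := fun i j k => by
    have hX : ∀ i j k, ZInv b (dirDeriv (liftX b i) (hExt h j k)) Ω := fun i j k =>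
      (hp.zInv_hExt j k).liftX hb hp.isOpen (hp.contMDiffOn_hExt j k) i
    have hs : ∀ i j k, ZInv b (fun y => ∑ l, structConst b l i j * hExt h l k y) Ω := fun i j k =>
      ZInv.sum fun l _ => (ZInv.const _).mul (hp.zInv_hExt l k)
    exact (ZInv.const _).mul ((((((hX i j k).add (hX j i k)).sub (hX k i j)).add (hs i j k)).sub
      (hs i k j)).sub (hs j k i))
  have hi : ∀ i j, ZInv b (invCorr gz gm h i j) Ω := fun i j =>
    ZInv.sum fun l _ => ZInv.sum fun m _ =>
      ((ZInv.const _).mul (hp.zInv_hExt l m)).mul (ZInv.const _)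
  refine ZInv.congr hp.isOpen ?_ fun y hy => slConn_pertComp hgz hgm hp k i j hy
  exact (ZInv.const _).add ((ZInv.sum fun l _ => (ZInv.const _).mul (hk i j l)).sub
    (ZInv.sum fun l _ => (hi k l).mul ((ZInv.const _).add (hk i j l))))

theorem slShape_pertComp (hgz : IsUnit gz.det) (hgm : IsUnit gm.det) (hp : IsAdaptedPert b h Ω)
    (k i : AdaptedIndex p r) {y : G × ℝ} (hy : y ∈ Ω) :
    slShape E (pertComp gz gm h) k i y
      = ∑ l, adaptedInv gz gm k l * (1 / 2 * dirDeriv (liftR E G) (hExt h i l) y) := by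
  simp only [slShape, slMat_pertComp_inv hgz hgm, dirDeriv_pertComp hp _ _ _ hy]
  refine Finset.sum_congr rfl fun l _ => ?_
  rw [sub_mul, sub_eq_self]
  by_contra hne
  have h1 := wt_of_invCorr_ne_zero (left_ne_zero_of_mul hne)
  have h2 := wt_of_dirDeriv_hExt_ne_zero (right_ne_zero_of_mul (right_ne_zero_of_mul hne))
  omega

/-- The shape operator maps the directions of `𝔥` into `𝔷` and annihilates the rest, so it is trace
free and its square is zero. -/
theorem wt_of_slShape_ne_zero (hgz : IsUnit gz.det) (hgm : IsUnit gm.det)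
    (hp : IsAdaptedPert b h Ω) {k i : AdaptedIndex p r} {y : G × ℝ} (hy : y ∈ Ω)
    (hne : slShape E (pertComp gz gm h) k i y ≠ 0) : wt k = 2 ∧ wt i = 0 := by
  rw [slShape_pertComp hgz hgm hp k i hy] at hne
  obtain ⟨l, h1, h2⟩ := sum_mul_ne_zero hne
  have h1 := wt_of_adaptedInv_ne_zero h1
  have h2 := wt_of_dirDeriv_hExt_ne_zero (right_ne_zero_of_mul h2)
  omega

theorem zInv_slShape_pertComp (hgz : IsUnit gz.det) (hgm : IsUnit gm.det)
    (hp : IsAdaptedPert b h Ω) (k i : AdaptedIndex p r) :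
    ZInv b (slShape E (pertComp gz gm h) k i) Ω := by
  refine ZInv.congr hp.isOpen ?_ fun y hy => slShape_pertComp hgz hgm hp k i hy
  exact ZInv.sum fun l _ => (ZInv.const _).mul ((ZInv.const _).mul
    ((hp.zInv_hExt i l).liftR hp.isOpen (hp.contMDiffOn_hExt i l)))


/-- Without a strict gain of weight the correction vanishes and the coefficient is a constant. This
covers in particular the coefficients `Γ^i_{ik}` that occur in traces. -/
theorem slConn_trace (hb : IsGradedBasis b) (hgz : IsUnit gz.det) (hgm : IsUnit gm.det)
    (hp : IsAdaptedPert b h Ω) {i j k : AdaptedIndex p r} (hw : wt k ≤ wt i + wt j)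
    {X : ∀ y : G × ℝ, TangentSpace (sliceModel E) y} {y : G × ℝ} (hy : y ∈ Ω) :
    dirDeriv X (slConn b (pertComp gz gm h) k i j) y = 0 := by
  rw [dirDeriv_congr (g := fun _ => constConn b (adaptedMatrix gz gm) k i j), dirDeriv_const]
  refine Filter.eventually_of_mem (hp.isOpen.mem_nhds hy) fun z hz => ?_
  rw [slConn_pertComp hgz hgm hp k i j hz, add_eq_left]
  by_contra hne
  have := wt_of_connCorr_ne_zero hb hp hz hne
  omega

theorem slKoszul_hExt_ih_ih_im (hb : IsGradedBasis b) (a c : Fin p) (B : Fin r) (y : G × ℝ) :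
    slKoszul b (hExt h) (ih a) (ih c) (im B) y = -(1 / 2) * dirDeriv (liftX b (im B)) (h a c) y := by
  have e1 : ∀ a, (hExt h (ih a) (im B) : G × ℝ → ℝ) = fun _ => 0 := fun a => rfl
  have e2 : ∑ l, structConst b l (ih a) (ih c) * hExt h l (im B) y = 0 := by
    by_contra hne
    obtain ⟨l, h1, h2⟩ := sum_mul_ne_zero hne
    have h2 := (wt_of_hExt_ne_zero h2).2
    simp [wt] at h2
  have e3 : ∀ a c, ∑ l, structConst b l (ih a) (im B) * hExt h l (ih c) y = 0 := by
    intro a c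
    by_contra hne
    obtain ⟨l, h1, h2⟩ := sum_mul_ne_zero hne
    have h2 := (wt_of_hExt_ne_zero h2).1
    have h1 := hb _ _ _ h1
    change 0 + 1 ≤ _ at h1
    omega
  rw [slKoszul, e1, e1, e2, e3, e3, dirDeriv_const, dirDeriv_const]
  change 1 / 2 * (0 + 0 - dirDeriv (liftX b (im B)) (h a c) y + 0 - 0 - 0) = _
  ring

/-- These coefficients contain the `e_B`-derivatives of `h`; their divergence produces the
Laplacian. -/
theorem slConn_im_ih_ih (hb : IsGradedBasis b) (hgz : IsUnit gz.det) (hgm : IsUnit gm.det)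
    (hp : IsAdaptedPert b h Ω) (A : Fin r) (a c : Fin p) {y : G × ℝ} (hy : y ∈ Ω) :
    slConn b (pertComp gz gm h) (im A) (ih a) (ih c) y
      = constConn b (adaptedMatrix gz gm) (im A) (ih a) (ih c)
        + ∑ B, gm⁻¹ A B * (-(1 / 2) * dirDeriv (liftX b (im B)) (h a c) y) := by
  have e : ∀ l, invCorr gz gm h (im A) l y = 0 := fun l => by
    by_contra hne
    have := (wt_of_invCorr_ne_zero hne).1
    simp [wt] at this
  simp only [slConn_pertComp hgz hgm hp _ _ _ hy, connCorr, e, zero_mul, Finset.sum_const_zero,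
    sub_zero, Fintype.sum_sum_type]
  simp [adaptedInv, slKoszul_hExt_ih_ih_im hb]

/-- The quadratic part does not see `h`. In the divergence `e_i Γ^i_{jk}`, the indices `i` of `𝔷`
drop out because the coefficients are annihilated by `𝔷`, and those of `𝔥` because an upper index of
weight 0 leaves only constants. The terms `e_j Γ^i_{ik}` differentiate constants. -/
theorem slRicci_pertComp (hb : IsGradedBasis b) (hgz : IsUnit gz.det) (hgm : IsUnit gm.det)
    (hp : IsAdaptedPert b h Ω) (j k : AdaptedIndex p r) {y : G × ℝ} (hy : y ∈ Ω) :
    slRicci b (pertComp gz gm h) j k y = constRic (constConn b (adaptedMatrix gz gm)) j k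
      + ∑ A, dirDeriv (liftX b (im A)) (slConn b (pertComp gz gm h) (im A) j k) y := by
  have e1 : ∀ i, dirDeriv (liftX b j) (slConn b (pertComp gz gm h) i i k) y = 0 := fun i =>
    slConn_trace hb hgz hgm hp (by omega) hy
  have e2 : ∀ d, dirDeriv (liftX b (iz d)) (slConn b (pertComp gz gm h) (iz d) j k) y = 0 :=
    fun d => (zInv_slConn_pertComp hb hgz hgm hp (iz d) j k y hy).2 d
  have e3 : ∀ d, dirDeriv (liftX b (ih d)) (slConn b (pertComp gz gm h) (ih d) j k) y = 0 :=
    fun d => slConn_trace hb hgz hgm hp (Nat.zero_le _) hy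
  simp only [slRicci, e1, sub_zero]
  rw [Finset.sum_add_distrib, add_comm]
  congr 1
  · exact constRic_add (w := wt) (fun _ _ _ => wt_of_constConn_ne_zero hb hgz hgm)
      (fun _ _ _ => wt_of_connCorr_ne_zero hb hp hy)
      (fun k i j => slConn_pertComp hgz hgm hp k i j hy) j k
  · simp only [Fintype.sum_sum_type, e2, e3, Finset.sum_const_zero, zero_add, add_zero]

theorem slRicci_pertComp_ih_ih (hb : IsGradedBasis b) (hgz : IsUnit gz.det)
    (hgm : IsUnit gm.det) (hp : IsAdaptedPert b h Ω) (a c : Fin p) {y : G × ℝ} (hy : y ∈ Ω) :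
    slRicci b (pertComp gz gm h) (ih a) (ih c) y
      = constRic (constConn b (adaptedMatrix gz gm)) (ih a) (ih c)
        - 1 / 2 * ∑ A, ∑ B, gm⁻¹ A B
          * dirDeriv (liftX b (im A)) (dirDeriv (liftX b (im B)) (h a c)) y := by
  rw [slRicci_pertComp hb hgz hgm hp _ _ hy, sub_eq_add_neg, add_right_inj, Finset.mul_sum,
    ← Finset.sum_neg_distrib]
  refine Finset.sum_congr rfl fun A _ => ?_
  have hd : ∀ B, MDifferentiableAt (sliceModel E) 𝓘(ℝ, ℝ)
      (dirDeriv (liftX b (im B)) (h a c)) y := fun B =>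
    ((contMDiffOn_slX (m := 1) (by norm_num [one_add_one_eq_two]) two_le_infty ENat.LEInfty.out
      hp.isOpen (im B) (hp.contMDiffOn a c)).contMDiffAt
        (hp.isOpen.mem_nhds hy)).mdifferentiableAt one_ne_zero
  have hd2 : ∀ B, MDifferentiableAt (sliceModel E) 𝓘(ℝ, ℝ)
      (fun y => gm⁻¹ A B * (-(1 / 2) * dirDeriv (liftX b (im B)) (h a c) y)) y := fun B =>
    mdifferentiableAt_const.mul (mdifferentiableAt_const.mul (hd B))
  rw [dirDeriv_congr (g := fun y => (fun _ => constConn b (adaptedMatrix gz gm) (im A) (ih a) (ih c)) y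
        + (fun y => ∑ B, gm⁻¹ A B * (-(1 / 2) * dirDeriv (liftX b (im B)) (h a c) y)) y),
    dirDeriv_add mdifferentiableAt_const (mdifferentiableAt_fun_sum fun B _ => hd2 B),
    dirDeriv_const, zero_add, dirDeriv_sum fun B _ => hd2 B, Finset.mul_sum,
    ← Finset.sum_neg_distrib]
  · refine Finset.sum_congr rfl fun B _ => ?_
    rw [dirDeriv_const_mul (f := fun y => -(1 / 2) * dirDeriv (liftX b (im B)) (h a c) y) _
      (mdifferentiableAt_const.mul (hd B)), dirDeriv_const_mul _ (hd B)]
    ring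
  · exact Filter.eventually_of_mem (hp.isOpen.mem_nhds hy) fun z hz =>
      slConn_im_ih_ih hb hgz hgm hp A a c hz

/-- The constant part vanishes by weights. The divergence differentiates constants, since `e_A` has
weight 1 and `j`, `k` together have at least weight 1. -/
theorem slRicci_pertComp_eq_zero (hb : IsGradedBasis b) (hgz : IsUnit gz.det)
    (hgm : IsUnit gm.det) (hp : IsAdaptedPert b h Ω) {j k : AdaptedIndex p r}
    (hw : wt j + wt k ≠ 0) {y : G × ℝ} (hy : y ∈ Ω) :
    slRicci b (pertComp gz gm h) j k y = 0 := by
  rw [slRicci_pertComp hb hgz hgm hp _ _ hy, constRic_eq_zero (w := wt)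
    (fun _ _ _ => wt_of_constConn_ne_zero hb hgz hgm) hw, zero_add]
  refine Finset.sum_eq_zero fun A _ => slConn_trace hb hgz hgm hp ?_ hy
  change 1 ≤ _
  omega

theorem slShape_trace (hgz : IsUnit gz.det) (hgm : IsUnit gm.det) (hp : IsAdaptedPert b h Ω)
    (i : AdaptedIndex p r) {y : G × ℝ} (hy : y ∈ Ω) : slShape E (pertComp gz gm h) i i y = 0 := by
  by_contra hne
  have := wt_of_slShape_ne_zero hgz hgm hp hy hne
  omega

theorem dirDeriv_slShape_trace (hgz : IsUnit gz.det) (hgm : IsUnit gm.det)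
    (hp : IsAdaptedPert b h Ω) (X : ∀ y : G × ℝ, TangentSpace (sliceModel E) y)
    {k i : AdaptedIndex p r} (hw : ¬ (wt k = 2 ∧ wt i = 0)) {y : G × ℝ} (hy : y ∈ Ω) :
    dirDeriv X (slShape E (pertComp gz gm h) k i) y = 0 := by
  rw [dirDeriv_congr (g := fun _ => 0), dirDeriv_const]
  refine Filter.eventually_of_mem (hp.isOpen.mem_nhds hy) fun z hz => ?_
  by_contra hne
  exact hw (wt_of_slShape_ne_zero hgz hgm hp hz hne)

/-- The terms of the general formula that are nonlinear in `∂_ρ h` contain the trace of the shape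
operator or contract its upper index, of weight 2, with an index of `∂_ρ h`, of weight 0. -/
theorem ambRicci_pertComp_inner (hgz : IsUnit gz.det) (hgm : IsUnit gm.det)
    (hp : IsAdaptedPert b h Ω) (j k : AdaptedIndex p r) {y : G × ℝ} (hy : y ∈ Ω) :
    ambRicci b (pertComp gz gm h) (.inr (.inl j)) (.inr (.inl k)) y
      = y.2 * dirDeriv (liftR E G) (dirDeriv (liftR E G) (hExt h j k)) y
        + (1 - ((2 * p + r : ℕ) : ℝ) / 2) * dirDeriv (liftR E G) (hExt h j k) y
        + slRicci b (pertComp gz gm h) j k y := by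
  have e1 : ∑ m, (slShape E (pertComp gz gm h) m k y
      * dirDeriv (liftR E G) (pertComp gz gm h j m) y
      + dirDeriv (liftR E G) (pertComp gz gm h m k) y * slShape E (pertComp gz gm h) m j y) = 0 := by
    refine Finset.sum_eq_zero fun m _ => ?_
    rw [dirDeriv_pertComp hp _ _ _ hy, dirDeriv_pertComp hp _ _ _ hy]
    have e : ∀ k, wt m ≠ 0 ∨ slShape E (pertComp gz gm h) m k y = 0 := fun k => by
      by_contra! hne
      have := (wt_of_slShape_ne_zero hgz hgm hp hy hne.2).1
      omega
    have e' : ∀ i j : AdaptedIndex p r, wt i ≠ 0 ∨ wt j ≠ 0 → dirDeriv (liftR E G) (hExt h i j) y = 0 := fun i j hw => by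
      by_contra hne
      have := wt_of_dirDeriv_hExt_ne_zero hne
      omega
    by_cases hm : wt m = 0
    · rw [(e k).resolve_left (by omega), (e j).resolve_left (by omega)]; ring
    · rw [e' _ _ (.inl hm), e' _ _ (.inr hm)]; ring
  have e2 : dirDeriv (liftR E G) (dirDeriv (liftR E G) (pertComp gz gm h j k)) y
      = dirDeriv (liftR E G) (dirDeriv (liftR E G) (hExt h j k)) y :=
    dirDeriv_congr (Filter.eventually_of_mem (hp.isOpen.mem_nhds hy) fun z hz =>
      dirDeriv_pertComp hp _ _ _ hz)
  have e3 : (Fintype.card (AdaptedIndex p r) : ℝ) = ((2 * p + r : ℕ) : ℝ) := by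
    simp only [Fintype.card_sum, Fintype.card_fin]; push_cast; ring
  simp only [ambRicci, e1, e2, e3]
  simp only [dirDeriv_pertComp hp _ _ _ hy, slShape_trace hgz hgm hp _ hy, Finset.sum_const_zero]
  ring

/-- The Ricci tensor of the ambient metric of `pertComp` in the directions of `𝔥`. -/
theorem ambRicci_pertComp_ih_ih (hb : IsGradedBasis b) (hgz : IsUnit gz.det)
    (hgm : IsUnit gm.det) (hp : IsAdaptedPert b h Ω) (a c : Fin p) {y : G × ℝ} (hy : y ∈ Ω) :
    ambRicci b (pertComp gz gm h) (.inr (.inl (ih a))) (.inr (.inl (ih c))) y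
      = y.2 * dirDeriv (liftR E G) (dirDeriv (liftR E G) (h a c)) y
        + (1 - ((2 * p + r : ℕ) : ℝ) / 2) * dirDeriv (liftR E G) (h a c) y
        + constRic (constConn b (adaptedMatrix gz gm)) (ih a) (ih c)
        - 1 / 2 * ∑ A, ∑ B, gm⁻¹ A B
          * dirDeriv (liftX b (im A)) (dirDeriv (liftX b (im B)) (h a c)) y := by
  rw [ambRicci_pertComp_inner hgz hgm hp _ _ hy, slRicci_pertComp_ih_ih hb hgz hgm hp a c hy]
  change y.2 * dirDeriv (liftR E G) (dirDeriv (liftR E G) (h a c)) y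
    + _ * dirDeriv (liftR E G) (h a c) y + _ = _
  ring

/-- The other components of the Ricci tensor of the ambient metric of `pertComp` vanish. -/
theorem ambRicci_pertComp_eq_zero (hb : IsGradedBasis b) (hgz : IsUnit gz.det)
    (hgm : IsUnit gm.det) (hp : IsAdaptedPert b h Ω)
    {J K : Unit ⊕ AdaptedIndex p r ⊕ Unit}
    (hJK : ∀ a c, ¬ (J = .inr (.inl (ih a)) ∧ K = .inr (.inl (ih c)))) {y : G × ℝ} (hy : y ∈ Ω) :
    ambRicci b (pertComp gz gm h) J K y = 0 := by
  have hs : ∀ k i, ¬ (wt k = 2 ∧ wt i = 0) → slShape E (pertComp gz gm h) k i y = 0 := by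
    intro k i hw
    by_contra hne
    exact hw (wt_of_slShape_ne_zero hgz hgm hp hy hne)
  have hc : ∀ k i j, ¬ (wt i + wt j ≤ wt k) → slConn b (pertComp gz gm h) k i j y = 0 := by
    intro k i j hw
    rw [slConn_pertComp hgz hgm hp k i j hy]
    by_contra hne
    by_cases h0 : constConn b (adaptedMatrix gz gm) k i j = 0
    · rw [h0, zero_add] at hne
      have := wt_of_connCorr_ne_zero hb hp hy hne
      omega
    · exact hw (wt_of_constConn_ne_zero hb hgz hgm h0)
  -- The shape operator needs upper weight 2 and lower weight 0, and the connection coefficients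
  -- cannot lose weight from their lower indices to their upper one. In every contraction below
  -- these requirements contradict each other.
  have hsc : ∀ i j l m n : AdaptedIndex p r, (wt i = 2 → wt j = 0 → wt m + wt n ≤ wt l → False) →
      slShape E (pertComp gz gm h) i j y * slConn b (pertComp gz gm h) l m n y = 0 := by
    intro i j l m n hw
    by_cases h1 : wt i = 2 ∧ wt j = 0
    · rw [hc _ _ _ (fun h2 => hw h1.1 h1.2 h2), mul_zero]
    · rw [hs _ _ h1, zero_mul]
  have hsX : ∀ i k, dirDeriv (liftX b i) (slShape E (pertComp gz gm h) i k) y = 0 := by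
    intro i k
    rcases i with i | i | i
    · exact (zInv_slShape_pertComp hgz hgm hp _ k y hy).2 i
    · exact dirDeriv_slShape_trace hgz hgm hp _ (by simp [wt]) hy
    · exact dirDeriv_slShape_trace hgz hgm hp _ (by simp [wt]) hy
  have htr : ∀ X : ∀ y : G × ℝ, TangentSpace (sliceModel E) y, ∀ i,
      dirDeriv X (slShape E (pertComp gz gm h) i i) y = 0 := fun X i =>
    dirDeriv_slShape_trace hgz hgm hp _ (by omega) hy
  rcases J with J | j | J <;> rcases K with K | k | K <;> try rfl
  · have hw : ¬ (wt j = 0 ∧ wt k = 0) := by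
      rintro ⟨h1, h2⟩
      rcases j with j | j | j <;> rcases k with k | k | k <;> simp [wt] at h1 h2
      exact hJK j k ⟨rfl, rfl⟩
    rw [ambRicci_pertComp_inner hgz hgm hp _ _ hy,
      slRicci_pertComp_eq_zero hb hgz hgm hp (by omega) hy, hExt_of_wt hw, dirDeriv_const,
      dirDeriv_congr (g := fun _ => 0) (Filter.Eventually.of_forall fun z => dirDeriv_const _ _ _),
      dirDeriv_const]
    ring
  · simp only [ambRicci, hsX, htr, sub_zero, zero_add]
    refine Finset.sum_eq_zero fun i _ => Finset.sum_eq_zero fun m _ => ?_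
    rw [sub_mul, hsc _ _ _ _ _ (by omega), hsc _ _ _ _ _ (by omega), mul_comm,
      hsc _ _ _ _ _ (by omega), mul_comm, hsc _ _ _ _ _ (by omega)]
    ring
  · simp only [ambRicci, hsX, slConn_trace hb hgz hgm hp (Nat.le_add_right _ _) hy, sub_zero, zero_add]
    refine Finset.sum_eq_zero fun i _ => Finset.sum_eq_zero fun m _ => ?_
    rw [hsc _ _ _ _ _ (by omega), mul_comm, hsc _ _ _ _ _ (by omega)]
    ring
  · simp only [ambRicci, htr, Finset.sum_const_zero, neg_zero, zero_sub, neg_eq_zero]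
    refine Finset.sum_eq_zero fun i _ => Finset.sum_eq_zero fun m _ => ?_
    by_cases h1 : wt m = 2 ∧ wt i = 0
    · rw [hs i m (by omega), mul_zero]
    · rw [hs _ _ h1, zero_mul]

end PertRicci

/-! ### Regularity of the function `ρ^{n/2}` -/

section HalfPow

/-- At the origin the difference quotient is `|x|^q`, which tends to 0; elsewhere `sign(x) x = |x|`.
-/
theorem hasDerivAt_abs_rpow_mul {q : ℝ} (hq : 0 < q) (x : ℝ) :
    HasDerivAt (fun x : ℝ => |x| ^ q * x) ((q + 1) * |x| ^ q) x := by
  rcases eq_or_ne x 0 with rfl | hx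
  · rw [abs_zero, Real.zero_rpow hq.ne', mul_zero, hasDerivAt_iff_tendsto_slope]
    have h : Filter.Tendsto (fun x : ℝ => |x| ^ q) (𝓝[≠] 0) (𝓝 0) := by
      have : Continuous fun x : ℝ => |x| ^ q := continuous_abs.rpow_const fun _ => .inr hq.le
      have h2 := this.tendsto 0
      rw [abs_zero, Real.zero_rpow hq.ne'] at h2
      exact h2.mono_left nhdsWithin_le_nhds
    refine h.congr' ?_
    filter_upwards [self_mem_nhdsWithin] with y hy
    have hy : y ≠ 0 := hy
    simp only [slope_def_field, mul_zero, sub_zero]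
    field_simp
  · have hd := ((hasDerivAt_abs hx).rpow_const (p := q) (.inl (abs_ne_zero.2 hx))).mul
      (hasDerivAt_id x)
    refine hd.congr_deriv ?_
    have hs : (SignType.sign x : ℝ) * x = |x| := sign_mul_self x
    have : |x| ^ (q - 1) * |x| = |x| ^ q := by
      rw [← Real.rpow_add_one (abs_ne_zero.2 hx)]; congr 1; ring
    simp only [id, mul_one]
    calc _ = q * (|x| ^ (q - 1) * ((SignType.sign x : ℝ) * x)) + |x| ^ q := by ring
      _ = _ := by rw [hs, this]; ring

/-- The exponent of `ρ^{n/2}` is large enough for two continuous derivatives. -/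
theorem exists_deriv_halfPow {n : ℕ} (hn : 4 ≤ n) : ∃ H₁ H₂ : ℝ → ℝ,
    (∀ x, HasDerivAt (halfPow n) (H₁ x) x) ∧ (∀ x, HasDerivAt H₁ (H₂ x) x) ∧ Continuous H₂ ∧
    (∀ x, x * H₁ x = n / 2 * halfPow n x) ∧ (∀ x, x * H₂ x = (n / 2 - 1) * H₁ x) := by
  rcases Nat.even_or_odd n with he | ho
  · obtain ⟨m, rfl⟩ := he
    obtain ⟨k, rfl⟩ : ∃ k, m = k + 2 := ⟨m - 2, by omega⟩
    have e : halfPow (k + 2 + (k + 2)) = fun x => x ^ (k + 2) := by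
      funext x; rw [halfPow, if_pos ⟨_, rfl⟩]; congr 1; omega
    refine ⟨fun x => (k + 2) * x ^ (k + 1), fun x => (k + 2) * ((k + 1) * x ^ k), fun x => ?_,
      fun x => ?_, by fun_prop, fun x => ?_, fun x => ?_⟩
    · rw [e]; simpa using hasDerivAt_pow (k + 2) x
    · exact ((hasDerivAt_pow (k + 1) x).const_mul (k + 2 : ℝ)).congr_deriv (by push_cast; simp)
    · rw [e]; push_cast; ring
    · push_cast; ring
  -- An odd `n ≥ 4` is at least 5, so `n/2 - 2 > 0` and the second derivative, a multiple of
  -- `|x|^{n/2-2}`, is continuous.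
  · have h5 : (5 : ℝ) ≤ n := by
      have : 5 ≤ n := by obtain ⟨m, rfl⟩ := ho; omega
      exact_mod_cast this
    have e : halfPow n = fun x => |x| ^ ((n : ℝ) / 2) := by
      funext x; rw [halfPow, if_neg (Nat.not_even_iff_odd.2 ho)]
    set α : ℝ := (n : ℝ) / 2 with hα
    have hα1 : 0 < α - 2 := by rw [hα]; linarith
    have hmul : ∀ x : ℝ, x * (|x| ^ (α - 2) * x) = |x| ^ α := fun x => by
      rcases eq_or_ne x 0 with rfl | hx
      · rw [zero_mul, abs_zero, Real.zero_rpow (by linarith)]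
      · have : |x| ^ α = |x| ^ (α - 2) * |x| ^ (2 : ℕ) := by
          rw [← Real.rpow_natCast, ← Real.rpow_add (abs_pos.2 hx)]; congr 1; push_cast; ring
        rw [this, sq_abs]; ring
    refine ⟨fun x => α * (|x| ^ (α - 2) * x), fun x => α * ((α - 2 + 1) * |x| ^ (α - 2)),
      fun x => ?_, fun x => ?_, ?_, fun x => ?_, fun x => ?_⟩
    · rw [e]; exact (hasDerivAt_abs_rpow x (by linarith)).congr_deriv (by ring)
    · exact (hasDerivAt_abs_rpow_mul hα1 x).const_mul α
    · exact continuous_const.mul (continuous_const.mul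
        (continuous_abs.rpow_const fun _ => .inr hα1.le))
    · rw [e]; linear_combination α * hmul x
    · ring

theorem contDiff_halfPow_two {n : ℕ} (hn : 4 ≤ n) : ContDiff ℝ 2 (halfPow n) := by
  obtain ⟨H₁, H₂, h1, h2, h3, -, -⟩ := exists_deriv_halfPow hn
  have e1 : deriv (halfPow n) = H₁ := funext fun x => (h1 x).deriv
  have e2 : deriv H₁ = H₂ := funext fun x => (h2 x).deriv
  rw [show (2 : ℕ∞ω) = 1 + 1 by norm_num [one_add_one_eq_two], contDiff_succ_iff_deriv]
  refine ⟨fun x => (h1 x).differentiableAt, fun h => absurd h (by simp), ?_⟩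
  rw [e1, contDiff_one_iff_deriv, e2]
  exact ⟨fun x => (h2 x).differentiableAt, h3⟩

theorem contDiff_halfPow {n : ℕ} (hn : 4 ≤ n) :
    ContDiff ℝ (if Even n then ∞ else 2) (halfPow n) := by
  split_ifs with he
  · have e : halfPow n = fun x => x ^ (n / 2) := by funext x; rw [halfPow, if_pos he]
    rw [e]; fun_prop
  · exact contDiff_halfPow_two hn

theorem contDiffAt_halfPow (n : ℕ) {x : ℝ} (hx : x ≠ 0) : ContDiffAt ℝ ∞ (halfPow n) x := by
  rcases Nat.even_or_odd n with he | ho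
  · have e : halfPow n = fun x => x ^ (n / 2) := by funext x; rw [halfPow, if_pos he]
    rw [e]; fun_prop
  · have e : halfPow n = fun x => |x| ^ ((n : ℝ) / 2) := by
      funext x; rw [halfPow, if_neg (Nat.not_even_iff_odd.2 ho)]
    rw [e]
    exact (contDiffAt_abs hx).rpow_const_of_ne (abs_ne_zero.2 hx)

theorem halfPow_zero {n : ℕ} (hn : 4 ≤ n) : halfPow n 0 = 0 := by
  rw [halfPow]
  split_ifs
  · exact zero_pow (by omega)
  · rw [abs_zero, Real.zero_rpow]; positivity

end HalfPow

/-! ### From frame components to normal form; the families of metrics -/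

section FrameExpansion

set_option linter.unusedSectionVars false

variable {E : Type*} [NormedAddCommGroup E] [NormedSpace ℝ E] [CompleteSpace E]
  {G : Type*} [TopologicalSpace G] [ChartedSpace E G] [Group G] [LieGroup 𝓘(ℝ, E) ∞ G]
  {κ : Type*} [Fintype κ] [DecidableEq κ] (b : Module.Basis κ ℝ (GroupLieAlgebra 𝓘(ℝ, E) G))

theorem mulInvariantVectorField_eq_sum (v : GroupLieAlgebra 𝓘(ℝ, E) G) (x : G) :
    mulInvariantVectorField v x = ∑ i, b.repr v i • leftFrame b i x := by
  conv_lhs => rw [← b.sum_repr v]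
  exact mulInvariantVectorField_sum _ _ _ _

theorem tangent_eq_sum (x : G) (v : TangentSpace 𝓘(ℝ, E) x) :
    v = ∑ i, b.repr (toLieAlgebra x v) i • leftFrame b i x := by
  rw [← mulInvariantVectorField_eq_sum, mulInvariantVectorField_toLieAlgebra]

theorem family_eq_sum (γ : BilinFamily E G) (y : G × ℝ) (c d : κ → ℝ) :
    γ y.1 y.2 (∑ i, c i • leftFrame b i y.1) (∑ i, d i • leftFrame b i y.1)
      = ∑ i, ∑ j, c i * d j * famGram b γ i j y := by
  rw [map_sum (γ y.1 y.2), LinearMap.sum_apply]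
  refine Finset.sum_congr rfl fun i _ => ?_
  rw [map_sum]
  refine Finset.sum_congr rfl fun j _ => ?_
  rw [map_smul, map_smul, LinearMap.smul_apply, smul_eq_mul, smul_eq_mul, famGram]
  ring

/-- Any vector expands in the left-invariant frame, so symmetry, nondegeneracy and regularity can be
checked on the matrix of components. -/
theorem isNormalForm_of_famGram {γ : BilinFamily E G} {g : BilinField 𝓘(ℝ, E) G}
    {Ω : Set (G × ℝ)} {m : ℕ∞ω}
    (hs : ∀ y ∈ Ω, ∀ i j, famGram b γ i j y = famGram b γ j i y)
    (hd : ∀ y ∈ Ω, (slMat (famGram b γ) y).det ≠ 0)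
    (hm : ∀ i j, ContMDiffOn (sliceModel E) 𝓘(ℝ, ℝ) m (famGram b γ i j) Ω)
    (h0 : ∀ x, (x, (0 : ℝ)) ∈ Ω → γ x 0 = g x) : IsNormalForm m g γ Ω where
  symm y hy v w := by
    rw [tangent_eq_sum b y.1 v, tangent_eq_sum b y.1 w, family_eq_sum, family_eq_sum,
      Finset.sum_comm]
    refine Finset.sum_congr rfl fun i _ => Finset.sum_congr rfl fun j _ => ?_
    rw [hs y hy i j]; ring
  nondeg y hy v hv := by
    set c : κ → ℝ := fun i => b.repr (toLieAlgebra y.1 v) i with hc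
    have h1 : Matrix.vecMul c (slMat (famGram b γ) y) = 0 := by
      funext j
      have := hv (∑ i, (if i = j then (1 : ℝ) else 0) • leftFrame b i y.1)
      rw [tangent_eq_sum b y.1 v, family_eq_sum] at this
      simp only [mul_ite, mul_one, mul_zero, ite_mul, zero_mul, Finset.sum_ite_eq',
        Finset.mem_univ, if_true] at this
      exact this
    have h2 := Matrix.eq_zero_of_vecMul_eq_zero (hd y hy) h1
    rw [tangent_eq_sum b y.1 v]
    exact Finset.sum_eq_zero fun i _ => by
      rw [show b.repr (toLieAlgebra y.1 v) i = 0 from congrFun h2 i, zero_smul]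
  contMDiffOn v w := by
    refine (contMDiffOn_fun_sum (t := Finset.univ)
      (f := fun i y => ∑ j, b.repr v i * b.repr w j * famGram b γ i j y) fun i _ =>
      contMDiffOn_fun_sum fun j _ => contMDiffOn_fun_mul contMDiffOn_const (hm i j)).congr ?_
    intro y hy
    rw [mulInvariantVectorField_eq_sum b, mulInvariantVectorField_eq_sum b, family_eq_sum]
  initial := h0

end FrameExpansion

section Family

set_option linter.unusedSectionVars false

variable {E : Type*} [NormedAddCommGroup E] [NormedSpace ℝ E] [CompleteSpace E]
  {G : Type*} [TopologicalSpace G] [ChartedSpace E G] [Group G] [LieGroup 𝓘(ℝ, E) ∞ G] {p r : ℕ}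
  {b : Module.Basis (AdaptedIndex p r) ℝ (GroupLieAlgebra 𝓘(ℝ, E) G)}
  {gz : Matrix (Fin p) (Fin p) ℝ} {gm : Matrix (Fin r) (Fin r) ℝ} {Ω : Set (G × ℝ)}
  {f : Fin p → Fin p → G → ℝ → ℝ}

variable (b gz gm) in
/-- The functions `2ρ/(n-2) R_{āc̄} + ρ^{n/2} f_{āc̄}(x, ρ)`. -/
def familyPert (f : Fin p → Fin p → G → ℝ → ℝ) (a c : Fin p) (y : G × ℝ) : ℝ :=
  2 * y.2 / (((2 * p + r : ℕ) : ℝ) - 2) * constRic (constConn b (adaptedMatrix gz gm)) (ih a) (ih c)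
    + halfPow (2 * p + r) y.2 * f a c y.1 y.2

theorem famGram_ambientFamily (f : Fin p → Fin p → G → ℝ → ℝ) :
    famGram b (ambientFamily b gz gm f) = pertComp gz gm (familyPert b gz gm f) := by
  funext i j y
  have h1 : leftMetric b gz gm y.1 (leftFrame b i y.1) (leftFrame b j y.1)
      = adaptedMatrix gz gm i j := by rw [← gram_leftMetric b gz gm y.1]; rfl
  simp only [famGram, ambientFamily, LinearMap.add_apply, LinearMap.sum_apply,
    LinearMap.smul_apply, LinearMap.smulRight_apply, smul_eq_mul, coframe_leftFrame, h1, pertComp,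
    ricci_of_const b (gram_leftMetric b gz gm)]
  congr 1
  rcases i with i | i | i <;> rcases j with j | j | j <;> simp [hExt, familyPert]

theorem familyPert_symm (hgz : IsUnit gz.det) (hgm : IsUnit gm.det) (hs : gm.IsSymm)
    (hf : ∀ a c, f a c = f c a) (a c : Fin p) :
    familyPert b gz gm f a c = familyPert b gz gm f c a := by
  have hR := constRic_symm (constConn_torsion (b := b) (isUnit_det_adaptedMatrix hgz hgm)
    (adaptedMatrix_symm hs)) (constConn_trace b (adaptedMatrix_symm hs)) (ih a) (ih c)
  funext y
  rw [familyPert, familyPert, hf a c, hR]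

theorem pertComp_symm {h : Fin p → Fin p → G × ℝ → ℝ} (hs : gm.IsSymm) (hf : ∀ a c, h a c = h c a)
    (i j : AdaptedIndex p r) (y : G × ℝ) : pertComp gz gm h i j y = pertComp gz gm h j i y := by
  rw [pertComp, pertComp, adaptedMatrix_symm hs i j]
  congr 1
  rcases i with i | i | i <;> rcases j with j | j | j <;> first | rfl | simp [hExt, hf i j]

theorem isNormalForm_ambientFamily (hn : 4 ≤ 2 * p + r) (hgz : IsUnit gz.det)
    (hgm : IsUnit gm.det) (hs : gm.IsSymm) {m : ℕ∞ω} (hf : ∀ a c, f a c = f c a)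
    (hm : ∀ a c, ContMDiffOn (sliceModel E) 𝓘(ℝ, ℝ) m
      (fun y : G × ℝ => halfPow (2 * p + r) y.2 * f a c y.1 y.2) Ω) :
    IsNormalForm m (leftMetric b gz gm) (ambientFamily b gz gm f) Ω := by
  refine isNormalForm_of_famGram b ?_ ?_ ?_ ?_
  · intro y _ i j
    rw [famGram_ambientFamily]
    exact pertComp_symm hs (familyPert_symm hgz hgm hs hf) i j y
  · intro y _
    rw [famGram_ambientFamily]
    exact det_pertComp_ne_zero hgz hgm y
  · intro i j
    rw [famGram_ambientFamily]
    have hF : ∀ a c, ContMDiffOn (sliceModel E) 𝓘(ℝ, ℝ) m (familyPert b gz gm f a c) Ω :=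
      fun a c => by
        refine (contMDiffOn_fun_mul (g := fun _ => constRic (constConn b (adaptedMatrix gz gm))
          (ih a) (ih c)) ?_ contMDiffOn_const).add (hm a c)
        simp only [div_eq_mul_inv]
        exact contMDiffOn_fun_mul (contMDiffOn_fun_mul contMDiffOn_const contMDiff_snd.contMDiffOn)
          contMDiffOn_const
    refine contMDiffOn_const.add ?_
    rcases i with i | i | i <;> rcases j with j | j | j <;>
      first | exact contMDiffOn_const | exact hF i j
  · intro x _
    simp only [ambientFamily, halfPow_zero hn, mul_zero, zero_div, zero_mul, add_zero, zero_smul,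
      Finset.sum_const_zero]

end Family

/-! ### Reduction to a Fuchsian equation -/

section FamilyRicci

set_option linter.unusedSectionVars false

variable {E : Type*} [NormedAddCommGroup E] [NormedSpace ℝ E] [CompleteSpace E]
  {G : Type*} [TopologicalSpace G] [ChartedSpace E G] [Group G] [LieGroup 𝓘(ℝ, E) ∞ G] {p r : ℕ}
  {b : Module.Basis (AdaptedIndex p r) ℝ (GroupLieAlgebra 𝓘(ℝ, E) G)}
  {gz : Matrix (Fin p) (Fin p) ℝ} {gm : Matrix (Fin r) (Fin r) ℝ} {Ω : Set (G × ℝ)}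
  {f : Fin p → Fin p → G → ℝ → ℝ}

/-- The conditions on the coefficients `f_{āc̄}(x, ρ)` that determine the shape of the Ricci tensor
of the ambient metric. -/
structure IsCoeff (b : Module.Basis (AdaptedIndex p r) ℝ (GroupLieAlgebra 𝓘(ℝ, E) G))
    (f : Fin p → Fin p → G → ℝ → ℝ) (Ω : Set (G × ℝ)) : Prop where
  isOpen : IsOpen Ω
  symm : ∀ a c, f a c = f c a
  contMDiffOn : ∀ a c, ContMDiffOn (sliceModel E) 𝓘(ℝ, ℝ) 2 (fun y : G × ℝ => f a c y.1 y.2) Ω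
  annihilated : ∀ a c d, ∀ y ∈ Ω,
    dirDeriv (liftX b (iz d)) (fun y : G × ℝ => f a c y.1 y.2) y = 0

/-- The differential operator whose kernel gives the Ricci-flat ambient metrics. -/
def fuchs (b : Module.Basis (AdaptedIndex p r) ℝ (GroupLieAlgebra 𝓘(ℝ, E) G))
    (gm : Matrix (Fin r) (Fin r) ℝ) (s : G × ℝ → ℝ) (y : G × ℝ) : ℝ :=
  y.2 * dirDeriv (liftR E G) (dirDeriv (liftR E G) s) y
    + (((2 * p + r : ℕ) : ℝ) / 2 + 1) * dirDeriv (liftR E G) s y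
    - 1 / 2 * ∑ A, ∑ B, gm⁻¹ A B * dirDeriv (liftX b (im A)) (dirDeriv (liftX b (im B)) s) y

section

variable {φ : ℝ → ℝ} {φ' : ℝ} {s : G × ℝ → ℝ} {y : G × ℝ}

theorem mdifferentiableAt_comp_snd (hφ : DifferentiableAt ℝ φ y.2) :
    MDifferentiableAt (sliceModel E) 𝓘(ℝ, ℝ) (fun y : G × ℝ => φ y.2) y :=
  MDifferentiableAt.comp (I' := 𝓘(ℝ, ℝ)) y hφ.mdifferentiableAt mdifferentiableAt_snd

theorem dirDeriv_liftR_comp_snd_mul (hφ : HasDerivAt φ φ' y.2)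
    (hs : MDifferentiableAt (sliceModel E) 𝓘(ℝ, ℝ) s y) :
    dirDeriv (liftR E G) (fun y => φ y.2 * s y) y
      = φ' * s y + φ y.2 * dirDeriv (liftR E G) s y := by
  have h1 := mdifferentiableAt_comp_snd (E := E) (G := G) hφ.differentiableAt
  rw [dirDeriv_mul (f := fun y : G × ℝ => φ y.2) h1 hs, dirDeriv_liftR (E := E) (G := G) h1,
    hφ.deriv]

theorem dirDeriv_liftX_comp_snd_mul (hφ : DifferentiableAt ℝ φ y.2)
    (hs : MDifferentiableAt (sliceModel E) 𝓘(ℝ, ℝ) s y) (i : AdaptedIndex p r) :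
    dirDeriv (liftX b i) (fun y => φ y.2 * s y) y = φ y.2 * dirDeriv (liftX b i) s y := by
  have h1 := mdifferentiableAt_comp_snd (E := E) (G := G) hφ
  have h2 : dirDeriv (liftX b i) (fun y : G × ℝ => φ y.2) y = 0 := by
    rw [dirDeriv_liftX b h1]
    exact dirDeriv_const (J := 𝓘(ℝ, E)) _ (φ y.2) _
  rw [dirDeriv_mul (f := fun y : G × ℝ => φ y.2) h1 hs, h2, zero_mul, zero_add]

end

theorem contMDiff_halfPow_snd (hn : 4 ≤ 2 * p + r) : ContMDiff (sliceModel E) 𝓘(ℝ, ℝ) 2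
    (fun y : G × ℝ => halfPow (2 * p + r) y.2) :=
  (contDiff_halfPow_two hn).contMDiff.comp contMDiff_snd

theorem isAdaptedPert_familyPert (hn : 4 ≤ 2 * p + r) (hf : IsCoeff b f Ω) :
    IsAdaptedPert b (familyPert b gz gm f) Ω where
  isOpen := hf.isOpen
  contMDiffOn a c := by
    refine (contMDiffOn_fun_mul (g := fun _ => constRic (constConn b (adaptedMatrix gz gm))
      (ih a) (ih c)) ?_ contMDiffOn_const).add
      (contMDiffOn_fun_mul (contMDiff_halfPow_snd hn).contMDiffOn (hf.contMDiffOn a c))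
    simp only [div_eq_mul_inv]
    exact contMDiffOn_fun_mul (contMDiffOn_fun_mul contMDiffOn_const contMDiff_snd.contMDiffOn)
      contMDiffOn_const
  annihilated a c d y hy := by
    have hs : MDifferentiableAt (sliceModel E) 𝓘(ℝ, ℝ) (fun y : G × ℝ => f a c y.1 y.2) y :=
      ((hf.contMDiffOn a c).contMDiffAt (hf.isOpen.mem_nhds hy)).mdifferentiableAt two_ne_zero
    have hH := ((contDiff_halfPow_two hn).differentiable two_ne_zero) y.2
    have hl : DifferentiableAt ℝ (fun ρ : ℝ => 2 * ρ / (((2 * p + r : ℕ) : ℝ) - 2)) y.2 := by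
      fun_prop
    have e := dirDeriv_liftX_comp_snd_mul (b := b) hH hs (iz d)
    have e2 := dirDeriv_liftX_comp_snd_mul (b := b) hl (mdifferentiableAt_const
      (c := constRic (constConn b (adaptedMatrix gz gm)) (ih a) (ih c))) (iz d)
    rw [hf.annihilated a c d y hy, mul_zero] at e
    rw [dirDeriv_const, mul_zero] at e2
    have h1 : MDifferentiableAt (sliceModel E) 𝓘(ℝ, ℝ) (fun y : G × ℝ =>
        2 * y.2 / (((2 * p + r : ℕ) : ℝ) - 2)
          * constRic (constConn b (adaptedMatrix gz gm)) (ih a) (ih c)) y :=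
      (mdifferentiableAt_comp_snd hl).mul mdifferentiableAt_const
    have h2 : MDifferentiableAt (sliceModel E) 𝓘(ℝ, ℝ) (fun y : G × ℝ =>
        halfPow (2 * p + r) y.2 * f a c y.1 y.2) y := (mdifferentiableAt_comp_snd hH).mul hs
    exact (dirDeriv_add h1 h2).trans (by rw [e, e2, add_zero])

/-- Both inhomogeneity and indicial root are removed by the form of the family: the linear term in
`ρ` absorbs `R_{āc̄}`, and the factor `ρ^{n/2}` removes the undifferentiated terms in `f`. -/
theorem ricci_ambientFamily (hb : IsGradedBasis b) (hn : 4 ≤ 2 * p + r) (hgz : IsUnit gz.det)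
    (hgm : IsUnit gm.det) (hs : gm.IsSymm) (hf : IsCoeff b f Ω) {P : ℝ × G × ℝ} (ht : 0 < P.1)
    (hP : P.2 ∈ Ω) (J K : Unit ⊕ AdaptedIndex p r ⊕ Unit) :
    ricci (ambientMetric (ambientFamily b gz gm f)) (ambientFrame b) J K P
      = match J, K with
        | .inr (.inl (.inr (.inr a))), .inr (.inl (.inr (.inr c))) =>
            halfPow (2 * p + r) P.2.2 * fuchs b gm (fun y => f a c y.1 y.2) P.2
        | _, _ => 0 := by
  have hp := isAdaptedPert_familyPert (gz := gz) (gm := gm) hn hf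
  have hg := famGram_ambientFamily (b := b) (gz := gz) (gm := gm) f
  rw [ricci_ambientFrame b (Ω := Ω) hf.isOpen (by rw [hg]; exact hp.contMDiffOn_pertComp)
    (by rw [hg]; exact fun y _ i j => pertComp_symm hs (familyPert_symm hgz hgm hs hf.symm) i j y)
    (by rw [hg]; exact fun y _ => det_pertComp_ne_zero hgz hgm y) ht hP, hg]
  have key : ∀ a c, ambRicci b (pertComp gz gm (familyPert b gz gm f)) (.inr (.inl (ih a)))
      (.inr (.inl (ih c))) P.2
      = halfPow (2 * p + r) P.2.2 * fuchs b gm (fun y => f a c y.1 y.2) P.2 := by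
    intro a c
    set s : G × ℝ → ℝ := fun y => f a c y.1 y.2 with hs_def
    set Q := constRic (constConn b (adaptedMatrix gz gm)) (ih a) (ih c) with hQ
    set n : ℝ := ((2 * p + r : ℕ) : ℝ) with hn_def
    have hn2 : n - 2 ≠ 0 := by
      have : (4 : ℝ) ≤ n := by rw [hn_def]; exact_mod_cast hn
      linarith
    obtain ⟨H₁, H₂, hH1, hH2, -, hH3, hH4⟩ := exists_deriv_halfPow hn
    rw [← hn_def] at hH3 hH4
    have hl : ∀ x : ℝ, HasDerivAt (fun ρ : ℝ => 2 * ρ / (n - 2)) (2 / (n - 2)) x := fun x => by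
      simpa using ((hasDerivAt_id x).const_mul 2).div_const (n - 2)
    have h12 : (1 : ℕ∞ω) + 1 ≤ 2 := by norm_num [one_add_one_eq_two]
    have md1 : ∀ {u : G × ℝ → ℝ}, ContMDiffOn (sliceModel E) 𝓘(ℝ, ℝ) 1 u Ω → ∀ z ∈ Ω,
        MDifferentiableAt (sliceModel E) 𝓘(ℝ, ℝ) u z := fun hu z hz =>
      (hu.contMDiffAt (hf.isOpen.mem_nhds hz)).mdifferentiableAt one_ne_zero
    have hsC : ContMDiffOn (sliceModel E) 𝓘(ℝ, ℝ) 2 s Ω := hf.contMDiffOn a c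
    have ms := md1 (hsC.of_le one_le_two)
    have mR := md1 (contMDiffOn_slR h12 two_le_infty ENat.LEInfty.out hf.isOpen hsC)
    have mX := fun B : Fin r => md1 (contMDiffOn_slX (b := b) h12 two_le_infty ENat.LEInfty.out
      hf.isOpen (im B) hsC)
    have mQ : ∀ z : G × ℝ, MDifferentiableAt (sliceModel E) 𝓘(ℝ, ℝ)
        (fun y : G × ℝ => 2 * y.2 / (n - 2) * Q) z := fun z =>
      (mdifferentiableAt_comp_snd (hl z.2).differentiableAt).mul mdifferentiableAt_const
    have mH : ∀ z ∈ Ω, MDifferentiableAt (sliceModel E) 𝓘(ℝ, ℝ)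
        (fun y : G × ℝ => halfPow (2 * p + r) y.2 * s y) z := fun z hz =>
      (mdifferentiableAt_comp_snd (hH1 z.2).differentiableAt).mul (ms z hz)
    have eR : ∀ z ∈ Ω, dirDeriv (liftR E G) (familyPert b gz gm f a c) z
        = 2 / (n - 2) * Q + (H₁ z.2 * s z + halfPow (2 * p + r) z.2 * dirDeriv (liftR E G) s z) := by
      intro z hz
      refine (dirDeriv_add (mQ z) (mH z hz)).trans ?_
      rw [dirDeriv_liftR_comp_snd_mul (hH1 z.2) (ms z hz),
        dirDeriv_liftR_comp_snd_mul (hl z.2) mdifferentiableAt_const, dirDeriv_const, mul_zero,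
        add_zero]
    have eRR : dirDeriv (liftR E G) (dirDeriv (liftR E G) (familyPert b gz gm f a c)) P.2
        = (H₂ P.2.2 * s P.2 + H₁ P.2.2 * dirDeriv (liftR E G) s P.2)
          + (H₁ P.2.2 * dirDeriv (liftR E G) s P.2
            + halfPow (2 * p + r) P.2.2 * dirDeriv (liftR E G) (dirDeriv (liftR E G) s) P.2) := by
      have m1 : MDifferentiableAt (sliceModel E) 𝓘(ℝ, ℝ) (fun y : G × ℝ => H₁ y.2 * s y) P.2 :=
        (mdifferentiableAt_comp_snd (hH2 P.2.2).differentiableAt).mul (ms _ hP)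
      have m2 : MDifferentiableAt (sliceModel E) 𝓘(ℝ, ℝ) (fun y : G × ℝ =>
          halfPow (2 * p + r) y.2 * dirDeriv (liftR E G) s y) P.2 :=
        (mdifferentiableAt_comp_snd (hH1 P.2.2).differentiableAt).mul (mR _ hP)
      rw [dirDeriv_congr (Filter.eventually_of_mem (hf.isOpen.mem_nhds hP) eR)]
      refine (dirDeriv_add mdifferentiableAt_const (m1.add m2)).trans ?_
      rw [dirDeriv_const, zero_add]
      refine (dirDeriv_add m1 m2).trans ?_
      rw [dirDeriv_liftR_comp_snd_mul (hH2 _) (ms _ hP),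
        dirDeriv_liftR_comp_snd_mul (hH1 _) (mR _ hP)]
    have eX : ∀ B, ∀ z ∈ Ω, dirDeriv (liftX b (im B)) (familyPert b gz gm f a c) z
        = halfPow (2 * p + r) z.2 * dirDeriv (liftX b (im B)) s z := by
      intro B z hz
      refine (dirDeriv_add (mQ z) (mH z hz)).trans ?_
      rw [dirDeriv_liftX_comp_snd_mul (hH1 z.2).differentiableAt (ms z hz),
        dirDeriv_liftX_comp_snd_mul (hl z.2).differentiableAt mdifferentiableAt_const,
        dirDeriv_const, mul_zero, zero_add]
    have eXX : ∀ A B, dirDeriv (liftX b (im A)) (dirDeriv (liftX b (im B))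
        (familyPert b gz gm f a c)) P.2 = halfPow (2 * p + r) P.2.2
          * dirDeriv (liftX b (im A)) (dirDeriv (liftX b (im B)) s) P.2 := by
      intro A B
      rw [dirDeriv_congr (Filter.eventually_of_mem (hf.isOpen.mem_nhds hP) (eX B)),
        dirDeriv_liftX_comp_snd_mul (hH1 _).differentiableAt (mX B _ hP)]
    have eS : ∑ A, ∑ B, gm⁻¹ A B * dirDeriv (liftX b (im A)) (dirDeriv (liftX b (im B))
        (familyPert b gz gm f a c)) P.2 = halfPow (2 * p + r) P.2.2 * ∑ A, ∑ B, gm⁻¹ A B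
          * dirDeriv (liftX b (im A)) (dirDeriv (liftX b (im B)) s) P.2 := by
      simp only [Finset.mul_sum, eXX]
      exact Finset.sum_congr rfl fun A _ => Finset.sum_congr rfl fun B _ => by ring
    -- The first-order term applied to `2ρR/(n-2)` gives `-R`; this fixes the constant `2/(n-2)`.
    have e0 : (1 - n / 2) * (2 / (n - 2)) = -1 := by field_simp; ring
    rw [ambRicci_pertComp_ih_ih hb hgz hgm hp a c hP, eRR, eR _ hP, eS, fuchs]
    -- With `H = ρ^{n/2}`, the Euler relation `ρ H'' = (n/2 - 1) H'` cancels the terms in `s`, and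
    -- `2ρ H' = n H` turns the coefficient of `s'` into `(n + 1 - n/2) H = (n/2 + 1) H`.
    linear_combination s P.2 * hH4 P.2.2 + 2 * dirDeriv (liftR E G) s P.2 * hH3 P.2.2 + Q * e0
  split
  · exact key _ _
  · refine ambRicci_pertComp_eq_zero hb hgz hgm hp ?_ hP
    rintro a c ⟨rfl, rfl⟩
    simp_all

end FamilyRicci

/-! ### The coefficients of the series and its truncations -/

section Coefficients

set_option linter.unusedSectionVars false

variable {E : Type*} [NormedAddCommGroup E] [NormedSpace ℝ E] [CompleteSpace E]
  {G : Type*} [TopologicalSpace G] [ChartedSpace E G] [Group G] [LieGroup 𝓘(ℝ, E) ∞ G] {p r : ℕ}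
  {b : Module.Basis (AdaptedIndex p r) ℝ (GroupLieAlgebra 𝓘(ℝ, E) G)}
  {gm : Matrix (Fin r) (Fin r) ℝ} {f g F : G → ℝ}

theorem contMDiff_leftDeriv {κ : Type*} (b : Module.Basis κ ℝ (GroupLieAlgebra 𝓘(ℝ, E) G))
    (hf : ContMDiff 𝓘(ℝ, E) 𝓘(ℝ, ℝ) ∞ f) (i : κ) :
    ContMDiff 𝓘(ℝ, E) 𝓘(ℝ, ℝ) ∞ (leftDeriv (b i) f) := by
  rw [← contMDiffOn_univ] at hf ⊢
  exact ContMDiffOn.dirDeriv (by simp) le_rfl isOpen_univ (contMDiff_leftFrame b i) hf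

theorem contMDiff_lapl (hf : ContMDiff 𝓘(ℝ, E) 𝓘(ℝ, ℝ) ∞ f) :
    ContMDiff 𝓘(ℝ, E) 𝓘(ℝ, ℝ) ∞ (lapl b gm f) := by
  rw [← contMDiffOn_univ]
  exact contMDiffOn_fun_sum fun A _ => contMDiffOn_fun_sum fun B _ =>
    contMDiffOn_fun_mul contMDiffOn_const
      (contMDiff_leftDeriv b (contMDiff_leftDeriv b hf _) _).contMDiffOn

theorem contMDiff_iterate_lapl (hf : ContMDiff 𝓘(ℝ, E) 𝓘(ℝ, ℝ) ∞ f) (k : ℕ) :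
    ContMDiff 𝓘(ℝ, E) 𝓘(ℝ, ℝ) ∞ ((lapl b gm)^[k] f) := by
  induction k with
  | zero => exact hf
  | succ k ih => rw [Function.iterate_succ_apply']; exact contMDiff_lapl ih

theorem contMDiff_serCoeff (hF : ContMDiff 𝓘(ℝ, E) 𝓘(ℝ, ℝ) ∞ F) (k : ℕ) :
    ContMDiff 𝓘(ℝ, E) 𝓘(ℝ, ℝ) ∞ (serCoeff b gm F k) := by
  rw [← contMDiffOn_univ]
  unfold serCoeff
  simp only [div_eq_mul_inv]
  exact contMDiffOn_fun_mul (contMDiff_iterate_lapl hF k).contMDiffOn contMDiffOn_const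

theorem leftDeriv_const_mul (hf : ContMDiff 𝓘(ℝ, E) 𝓘(ℝ, ℝ) ∞ f) (c : ℝ)
    (v : GroupLieAlgebra 𝓘(ℝ, E) G) :
    leftDeriv v (fun x => c * f x) = fun x => c * leftDeriv v f x :=
  funext fun _ => dirDeriv_const_mul c (hf.mdifferentiable (by simp) _)

theorem lapl_const_mul (hf : ContMDiff 𝓘(ℝ, E) 𝓘(ℝ, ℝ) ∞ f) (c : ℝ) (x : G) :
    lapl b gm (fun x => c * f x) x = c * lapl b gm f x := by
  simp only [lapl, leftDeriv_const_mul hf, leftDeriv_const_mul (contMDiff_leftDeriv b hf _),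
    Finset.mul_sum]
  exact Finset.sum_congr rfl fun A _ => Finset.sum_congr rfl fun B _ => by ring

/-- The recursion for the coefficients of the series. -/
theorem serCoeff_succ (hF : ContMDiff 𝓘(ℝ, E) 𝓘(ℝ, ℝ) ∞ F) (k : ℕ) (x : G) :
    (k + 1) * (2 * (k + 1) + ((2 * p + r : ℕ) : ℝ)) * serCoeff b gm F (k + 1) x
      = lapl b gm (serCoeff b gm F k) x := by
  have e : serCoeff b gm F k = fun x => (k.factorial
      * ∏ i ∈ Finset.Icc 1 k, (2 * (i : ℝ) + (2 * p + r : ℕ)))⁻¹ * ((lapl b gm)^[k] F) x := by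
    funext x; rw [serCoeff, div_eq_inv_mul]
  rw [e, lapl_const_mul (contMDiff_iterate_lapl hF k), serCoeff, Function.iterate_succ_apply',
    Finset.prod_Icc_succ_top (by omega), Nat.factorial_succ]
  have h1 : (k.factorial : ℝ) ≠ 0 := by exact_mod_cast k.factorial_ne_zero
  have h2 : ∏ i ∈ Finset.Icc 1 k, (2 * (i : ℝ) + (2 * p + r : ℕ)) ≠ 0 :=
    Finset.prod_ne_zero_iff.2 fun i hi => by
      have : 1 ≤ i := (Finset.mem_Icc.1 hi).1
      positivity
  have h3 : 2 * ((k + 1 : ℕ) : ℝ) + ((2 * p + r : ℕ) : ℝ) ≠ 0 := by positivity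
  set n : ℝ := ((2 * p + r : ℕ) : ℝ)
  push_cast at h3 ⊢
  have h4 : (k : ℝ) + 1 ≠ 0 := by positivity
  have h5 : ((k : ℝ) + 1) * 2 + n ≠ 0 := by rwa [mul_comm]
  field_simp

theorem mdifferentiableAt_comp_fst (hf : MDifferentiable 𝓘(ℝ, E) 𝓘(ℝ, ℝ) f) (y : G × ℝ) :
    MDifferentiableAt (sliceModel E) 𝓘(ℝ, ℝ) (fun y : G × ℝ => f y.1) y :=
  MDifferentiableAt.comp (I' := 𝓘(ℝ, E)) y (hf y.1) mdifferentiableAt_fst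

theorem contMDiff_comp_fst (hf : ContMDiff 𝓘(ℝ, E) 𝓘(ℝ, ℝ) ∞ f) :
    ContMDiff (sliceModel E) 𝓘(ℝ, ℝ) ∞ (fun y : G × ℝ => f y.1) := hf.comp contMDiff_fst

theorem dirDeriv_liftX_comp_fst {κ : Type*} (b : Module.Basis κ ℝ (GroupLieAlgebra 𝓘(ℝ, E) G))
    (hf : ContMDiff 𝓘(ℝ, E) 𝓘(ℝ, ℝ) ∞ f) (i : κ) :
    dirDeriv (liftX b i) (fun y : G × ℝ => f y.1) = fun y => leftDeriv (b i) f y.1 :=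
  funext fun y => dirDeriv_liftX b (mdifferentiableAt_comp_fst (hf.mdifferentiable (by simp)) y) i

/-- Functions on `G` are pulled back to `G × ℝ`, where `ZInv.liftX` shows that each left-invariant
derivative preserves annihilation by `𝔷`. -/
theorem leftDeriv_lapl_eq_zero (hb : IsGradedBasis b) (hf : ContMDiff 𝓘(ℝ, E) 𝓘(ℝ, ℝ) ∞ f)
    (h0 : ∀ d x, leftDeriv (b (iz d)) f x = 0) (d : Fin p) (x : G) :
    leftDeriv (b (iz d)) (lapl b gm f) x = 0 := by
  have hz : ∀ f : G → ℝ, ContMDiff 𝓘(ℝ, E) 𝓘(ℝ, ℝ) ∞ f → ZInv b (fun y : G × ℝ => f y.1) Set.univ →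
      ∀ i, ZInv b (fun y : G × ℝ => leftDeriv (b i) f y.1) Set.univ := fun f hf h i => by
    rw [← dirDeriv_liftX_comp_fst b hf]
    exact h.liftX hb isOpen_univ ((contMDiff_comp_fst hf).contMDiffOn.of_le two_le_infty) i
  have h1 : ZInv b (fun y : G × ℝ => f y.1) Set.univ := fun y _ =>
    ⟨mdifferentiableAt_comp_fst (hf.mdifferentiable (by simp)) y, fun d => by
      rw [dirDeriv_liftX_comp_fst b hf]; exact h0 d y.1⟩
  have h2 : ZInv b (fun y : G × ℝ => lapl b gm f y.1) Set.univ :=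
    ZInv.sum fun A _ => ZInv.sum fun B _ => (ZInv.const _).mul
      (hz _ (contMDiff_leftDeriv b hf _) (hz f hf h1 _) _)
  have h3 := (h2 (x, 0) trivial).2 d
  rwa [dirDeriv_liftX_comp_fst b (contMDiff_lapl hf)] at h3

theorem leftDeriv_serCoeff_eq_zero (hb : IsGradedBasis b) (hF : ContMDiff 𝓘(ℝ, E) 𝓘(ℝ, ℝ) ∞ F)
    (h0 : ∀ d x, leftDeriv (b (iz d)) F x = 0) (k : ℕ) (d : Fin p) (x : G) :
    leftDeriv (b (iz d)) (serCoeff b gm F k) x = 0 := by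
  have h : ∀ k d x, leftDeriv (b (iz d)) ((lapl b gm)^[k] F) x = 0 := by
    intro k
    induction k with
    | zero => exact h0
    | succ k ih =>
      rw [Function.iterate_succ_apply']
      exact leftDeriv_lapl_eq_zero hb (contMDiff_iterate_lapl hF k) ih
  have e : serCoeff b gm F k = fun x => (k.factorial
      * ∏ i ∈ Finset.Icc 1 k, (2 * (i : ℝ) + (2 * p + r : ℕ)))⁻¹ * ((lapl b gm)^[k] F) x := by
    funext x; rw [serCoeff, div_eq_inv_mul]
  rw [e, leftDeriv_const_mul (contMDiff_iterate_lapl hF k)]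
  simp only [h, mul_zero]

end Coefficients

section Partial

set_option linter.unusedSectionVars false

variable {E : Type*} [NormedAddCommGroup E] [NormedSpace ℝ E] [CompleteSpace E]
  {G : Type*} [TopologicalSpace G] [ChartedSpace E G] [Group G] [LieGroup 𝓘(ℝ, E) ∞ G] {p r : ℕ}
  {b : Module.Basis (AdaptedIndex p r) ℝ (GroupLieAlgebra 𝓘(ℝ, E) G)}
  {gm : Matrix (Fin r) (Fin r) ℝ} {F : G → ℝ}

theorem contMDiff_serTerm (hF : ContMDiff 𝓘(ℝ, E) 𝓘(ℝ, ℝ) ∞ F) (k : ℕ) :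
    ContMDiff (sliceModel E) 𝓘(ℝ, ℝ) ∞ (fun y : G × ℝ => serCoeff b gm F k y.1 * y.2 ^ k) := by
  have h1 : ContMDiff (sliceModel E) 𝓘(ℝ, ℝ) ∞ (fun y : G × ℝ => y.2 ^ k) :=
    (show ContDiff ℝ ∞ (fun x : ℝ => x ^ k) by fun_prop).contMDiff.comp contMDiff_snd
  rw [← contMDiffOn_univ]
  exact contMDiffOn_fun_mul (contMDiff_comp_fst (contMDiff_serCoeff hF k)).contMDiffOn
    h1.contMDiffOn

theorem contMDiff_serPartial (hF : ContMDiff 𝓘(ℝ, E) 𝓘(ℝ, ℝ) ∞ F) (N : ℕ) :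
    ContMDiff (sliceModel E) 𝓘(ℝ, ℝ) ∞ (fun y : G × ℝ => serPartial b gm N F y.1 y.2) := by
  rw [← contMDiffOn_univ]
  exact contMDiffOn_fun_sum fun k _ => (contMDiff_serTerm hF k).contMDiffOn

theorem dirDeriv_liftX_serTerm {f : G → ℝ} (hf : ContMDiff 𝓘(ℝ, E) 𝓘(ℝ, ℝ) ∞ f) (k : ℕ)
    (i : AdaptedIndex p r) : dirDeriv (liftX b i) (fun y : G × ℝ => f y.1 * y.2 ^ k)
      = fun y => leftDeriv (b i) f y.1 * y.2 ^ k := by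
  funext y
  have h := dirDeriv_liftX_comp_snd_mul (b := b) (y := y) (φ := fun x : ℝ => x ^ k)
    (s := fun y : G × ℝ => f y.1) (by fun_prop)
    (mdifferentiableAt_comp_fst (hf.mdifferentiable (by simp)) y) i
  rw [dirDeriv_liftX_comp_fst b hf] at h
  simp only [mul_comm _ (y.2 ^ k)] at h ⊢
  simpa only [mul_comm] using h

theorem dirDeriv_liftR_serTerm {f : G → ℝ} (hf : ContMDiff 𝓘(ℝ, E) 𝓘(ℝ, ℝ) ∞ f) (k : ℕ) :
    dirDeriv (liftR E G) (fun y : G × ℝ => f y.1 * y.2 ^ k)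
      = fun y => k * (f y.1 * y.2 ^ (k - 1)) := by
  funext y
  have hm := mdifferentiableAt_comp_fst (hf.mdifferentiable (by simp)) y
  have h := dirDeriv_liftR_comp_snd_mul (E := E) (y := y) (hasDerivAt_pow k y.2) hm
  have h0 : dirDeriv (liftR E G) (fun y : G × ℝ => f y.1) y = 0 := by
    rw [dirDeriv_liftR hm]; exact deriv_const y.2 (f y.1)
  rw [h0, mul_zero, add_zero] at h
  rw [show (fun y : G × ℝ => f y.1 * y.2 ^ k) = fun y => y.2 ^ k * f y.1 from
    funext fun y => mul_comm _ _, h]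
  ring

theorem fuchs_add {s t : G × ℝ → ℝ} (hs : ContMDiff (sliceModel E) 𝓘(ℝ, ℝ) ∞ s)
    (ht : ContMDiff (sliceModel E) 𝓘(ℝ, ℝ) ∞ t) (y : G × ℝ) :
    fuchs b gm (fun y => s y + t y) y = fuchs b gm s y + fuchs b gm t y := by
  have h1 : (1 : ℕ∞ω) ≤ ∞ := ENat.LEInfty.out
  have h12 : (1 : ℕ∞ω) + 1 ≤ ∞ := by rw [one_add_one_eq_two]; exact two_le_infty
  have md : ∀ {u : G × ℝ → ℝ}, ContMDiffOn (sliceModel E) 𝓘(ℝ, ℝ) 1 u Set.univ →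
      ∀ y, MDifferentiableAt (sliceModel E) 𝓘(ℝ, ℝ) u y := fun hu y =>
    (hu.contMDiffAt Filter.univ_mem).mdifferentiableAt one_ne_zero
  have e : ∀ X : ∀ y : G × ℝ, TangentSpace (sliceModel E) y,
      dirDeriv X (fun y => s y + t y) = fun y => dirDeriv X s y + dirDeriv X t y := fun X =>
    funext fun y => dirDeriv_add (hs.mdifferentiable (by simp) y) (ht.mdifferentiable (by simp) y)
  have eX : ∀ A B, dirDeriv (liftX b A) (dirDeriv (liftX b B) (fun y => s y + t y)) y
      = dirDeriv (liftX b A) (dirDeriv (liftX b B) s) y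
        + dirDeriv (liftX b A) (dirDeriv (liftX b B) t) y := fun A B => by
    rw [e]
    exact dirDeriv_add (md (contMDiffOn_slX h12 le_rfl h1 isOpen_univ B hs.contMDiffOn) y)
      (md (contMDiffOn_slX h12 le_rfl h1 isOpen_univ B ht.contMDiffOn) y)
  have eR : dirDeriv (liftR E G) (dirDeriv (liftR E G) (fun y => s y + t y)) y
      = dirDeriv (liftR E G) (dirDeriv (liftR E G) s) y
        + dirDeriv (liftR E G) (dirDeriv (liftR E G) t) y := by
    rw [e]
    exact dirDeriv_add (md (contMDiffOn_slR h12 le_rfl h1 isOpen_univ hs.contMDiffOn) y)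
      (md (contMDiffOn_slR h12 le_rfl h1 isOpen_univ ht.contMDiffOn) y)
  simp only [fuchs, eX, eR]
  simp only [e, mul_add, Finset.sum_add_distrib]
  ring

/-- The indicial polynomial of the equation is `k(k-1) + (n/2+1)k = ½ k(2k+n)`. -/
theorem fuchs_serTerm (hF : ContMDiff 𝓘(ℝ, E) 𝓘(ℝ, ℝ) ∞ F) (k : ℕ) (y : G × ℝ) :
    fuchs b gm (fun y : G × ℝ => serCoeff b gm F k y.1 * y.2 ^ k) y
      = 1 / 2 * (k * (2 * k + ((2 * p + r : ℕ) : ℝ)) * serCoeff b gm F k y.1 * y.2 ^ (k - 1)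
        - lapl b gm (serCoeff b gm F k) y.1 * y.2 ^ k) := by
  have hc := contMDiff_serCoeff (b := b) (gm := gm) hF k
  have e1 : ∀ A B, dirDeriv (liftX b (im A)) (dirDeriv (liftX b (im B))
      (fun y : G × ℝ => serCoeff b gm F k y.1 * y.2 ^ k)) y
      = leftDeriv (b (im A)) (leftDeriv (b (im B)) (serCoeff b gm F k)) y.1 * y.2 ^ k := by
    intro A B
    rw [dirDeriv_liftX_serTerm hc, dirDeriv_liftX_serTerm (contMDiff_leftDeriv b hc _)]
  have e2 : y.2 * dirDeriv (liftR E G) (dirDeriv (liftR E G)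
      (fun y : G × ℝ => serCoeff b gm F k y.1 * y.2 ^ k)) y
      = k * (k - 1) * serCoeff b gm F k y.1 * y.2 ^ (k - 1) := by
    have : (fun y : G × ℝ => (k : ℝ) * (serCoeff b gm F k y.1 * y.2 ^ (k - 1)))
        = fun y => ((k : ℝ) * serCoeff b gm F k y.1) * y.2 ^ (k - 1) := funext fun y => by ring
    have hk : ContMDiff 𝓘(ℝ, E) 𝓘(ℝ, ℝ) ∞ (fun x => (k : ℝ) * serCoeff b gm F k x) := by
      rw [← contMDiffOn_univ]; exact contMDiffOn_fun_mul contMDiffOn_const hc.contMDiffOn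
    rw [dirDeriv_liftR_serTerm hc, this, dirDeriv_liftR_serTerm hk]
    rcases k with _ | _ | k
    · simp
    · simp
    · simp only [Nat.add_sub_cancel, pow_succ]; push_cast; ring
  rw [fuchs, e2, dirDeriv_liftR_serTerm hc, lapl]
  simp only [e1, Finset.sum_mul, mul_assoc, mul_sub]
  simp only [Finset.mul_sum]
  ring

/-- The sum telescopes: by the recursion, the `ρ`-derivatives of each term cancel the Laplacian of
the term before it, and only the Laplacian of the last term remains. -/
theorem fuchs_serPartial (hF : ContMDiff 𝓘(ℝ, E) 𝓘(ℝ, ℝ) ∞ F) (N : ℕ) (y : G × ℝ) :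
    fuchs b gm (fun y : G × ℝ => serPartial b gm N F y.1 y.2) y
      = -(1 / 2) * (lapl b gm (serCoeff b gm F N) y.1 * y.2 ^ N) := by
  induction N with
  | zero =>
    have := fuchs_serTerm (b := b) (gm := gm) hF 0 y
    simp only [serPartial, zero_add, Finset.sum_range_one]
    rw [this]; push_cast; ring
  | succ N ih =>
    have e : (fun y : G × ℝ => serPartial b gm (N + 1) F y.1 y.2) = fun y =>
        serPartial b gm N F y.1 y.2 + serCoeff b gm F (N + 1) y.1 * y.2 ^ (N + 1) := by
      funext y; rw [serPartial, Finset.sum_range_succ]; rfl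
    rw [e, fuchs_add (contMDiff_serPartial hF N) (contMDiff_serTerm hF _), ih, fuchs_serTerm hF,
      ← serCoeff_succ hF]
    rw [Nat.add_sub_cancel]
    push_cast
    ring

theorem dirDeriv_iz_serPartial (hb : IsGradedBasis b) (hF : ContMDiff 𝓘(ℝ, E) 𝓘(ℝ, ℝ) ∞ F)
    (h0 : ∀ d x, leftDeriv (b (iz d)) F x = 0) (N : ℕ) (d : Fin p) (y : G × ℝ) :
    dirDeriv (liftX b (iz d)) (fun y : G × ℝ => serPartial b gm N F y.1 y.2) y = 0 := by
  refine (dirDeriv_sum fun k _ => (contMDiff_serTerm hF k).mdifferentiable (by simp) y).trans ?_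
  refine Finset.sum_eq_zero fun k _ => ?_
  rw [dirDeriv_liftX_serTerm (contMDiff_serCoeff hF k)]
  simp only [leftDeriv_serCoeff_eq_zero hb hF h0, zero_mul]

end Partial

/-! ### Termwise differentiation and convergent solutions -/

section PowerSeries

/-- Convergence at `R` bounds `c_k R^k`, so the differentiated series is dominated by a multiple of
`∑ (k+1) q^k` with `q = |ρ|/|R| < 1`. -/
theorem summable_deriv_powerSeries {c : ℕ → ℝ} {R ρ : ℝ} (hs : Summable fun k => c k * R ^ k)
    (hρ : |ρ| < |R|) : Summable fun k : ℕ => ‖k * (c k * ρ ^ (k - 1))‖ := by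
  have hR : 0 < |R| := (abs_nonneg _).trans_lt hρ
  obtain ⟨M, hM⟩ := hs.tendsto_atTop_zero.norm.bddAbove_range
  have hM' : ∀ k, |c k| * |R| ^ k ≤ M := fun k => by
    have := hM ⟨k, rfl⟩
    simpa [abs_mul] using this
  have hq : |ρ| / |R| < 1 := (div_lt_one hR).2 hρ
  have hg : Summable fun k : ℕ => (k : ℝ) ^ 1 * (|ρ| / |R|) ^ k :=
    summable_pow_mul_geometric_of_norm_lt_one 1 (by
      rw [Real.norm_of_nonneg (by positivity)]; exact hq)
  have hg2 : Summable fun k : ℕ => ((k : ℝ) + 1) * (|ρ| / |R|) ^ k := by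
    simpa only [add_mul, pow_one, one_mul] using hg.add
      (summable_geometric_of_lt_one (by positivity) hq)
  rw [← summable_nat_add_iff 1]
  refine Summable.of_nonneg_of_le (fun _ => norm_nonneg _) (fun k => ?_) (hg2.mul_left (M / |R|))
  rw [Nat.add_sub_cancel, Real.norm_eq_abs, abs_mul, abs_mul, abs_pow, Nat.abs_cast]
  have h1 := hM' (k + 1)
  have h2 : |c (k + 1)| ≤ M / |R| ^ (k + 1) := by rwa [le_div_iff₀ (by positivity)]
  calc ((k + 1 : ℕ) : ℝ) * (|c (k + 1)| * |ρ| ^ k)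
      ≤ ((k + 1 : ℕ) : ℝ) * (M / |R| ^ (k + 1) * |ρ| ^ k) := by gcongr
    _ = _ := by push_cast; rw [div_pow, pow_succ]; field_simp

theorem hasDerivAt_powerSeries {c : ℕ → ℝ} {R ρ : ℝ} (hs : Summable fun k => c k * R ^ k)
    (hρ : |ρ| < |R|) :
    HasDerivAt (fun x => ∑' k, c k * x ^ k) (∑' k : ℕ, k * (c k * ρ ^ (k - 1))) ρ := by
  -- On the ball of radius `q` the derivatives are dominated uniformly by those at `q`, which are
  -- summable because `q < |R|`.
  obtain ⟨q, h1, h2⟩ := exists_between hρ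
  have hq0 : 0 < q := (abs_nonneg _).trans_lt h1
  refine hasDerivAt_tsum_of_isPreconnected (g := fun k x => c k * x ^ k)
    (g' := fun (k : ℕ) x => k * (c k * x ^ (k - 1))) (t := Metric.ball (0 : ℝ) q) (y₀ := (0 : ℝ))
    (summable_deriv_powerSeries (ρ := q) hs (by rwa [abs_of_pos hq0])) Metric.isOpen_ball
    (convex_ball _ _).isPreconnected (fun k y _ => ?_) (fun k y hy => ?_)
    (Metric.mem_ball_self hq0) ?_ (by simpa using h1)
  · exact ((hasDerivAt_pow k y).const_mul (c k)).congr_deriv (by ring)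
  · have : |y| ≤ q := by simpa using (Metric.mem_ball.1 hy).le
    simp only [norm_mul, norm_pow, Real.norm_eq_abs, abs_of_pos hq0]
    gcongr
  · refine summable_of_ne_finset_zero (s := {0}) fun k hk => ?_
    rw [zero_pow (by simpa using hk), mul_zero]

end PowerSeries

section Termwise

variable {EM : Type*} [NormedAddCommGroup EM] [NormedSpace ℝ EM] [CompleteSpace EM]
  {HM : Type*} [TopologicalSpace HM] {J : ModelWithCorners ℝ EM HM}
  {M : Type*} [TopologicalSpace M] [ChartedSpace HM M] [IsManifold J ∞ M] [BoundarylessManifold J M]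

/-- Termwise differentiation in the direction of a vector field. -/
theorem dirDeriv_eq_tsum {X : ∀ x : M, TangentSpace J x} {Ω : Set M} (hΩ : IsOpen Ω)
    (hX : ContMDiff J J.tangent ∞ fun x => (⟨x, X x⟩ : TangentBundle J M))
    {u : ℕ → M → ℝ} {S : M → ℝ} (hu : ∀ k, MDifferentiable J 𝓘(ℝ, ℝ) (u k))
    (hS : ∀ y ∈ Ω, HasSum (fun k => u k y) (S y))
    (hsum : SummableLocallyUniformlyOn (fun k => dirDeriv X (u k)) Ω) {y : M} (hy : y ∈ Ω)
    (hd : MDifferentiableAt J 𝓘(ℝ, ℝ) S y) : dirDeriv X S y = ∑' k, dirDeriv X (u k) y := by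
  have : IsManifold J 1 M := IsManifold.of_le (n := ∞) ENat.LEInfty.out
  -- Along an integral curve of `X` through `y` the claim is the one-variable theorem on locally
  -- uniformly convergent derivatives. Since `S` is differentiable at `y`, the derivative along the
  -- curve is the derivative along `X`.
  obtain ⟨σ, hσ0, hσ⟩ := exists_isMIntegralCurveAt_of_contMDiffAt_boundaryless (v := X) 0
    (hX.contMDiffAt (x := y) |>.of_le ENat.LEInfty.out)
  have hσc : ContinuousAt σ 0 := hσ.self_of_nhds.continuousAt
  have hev : ∀ᶠ t in 𝓝 (0 : ℝ), HasMFDerivAt 𝓘(ℝ, ℝ) J σ t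
      ((1 : ℝ →L[ℝ] ℝ).smulRight (X (σ t))) ∧ σ t ∈ Ω :=
    hσ.and (hσc.eventually (by rw [hσ0]; exact hΩ.mem_nhds hy))
  obtain ⟨T, hT, hTo, hT0⟩ := eventually_nhds_iff.1 hev
  have hder : ∀ (f : M → ℝ), ∀ t ∈ T, MDifferentiableAt J 𝓘(ℝ, ℝ) f (σ t) →
      HasDerivAt (fun t => f (σ t)) (dirDeriv X f (σ t)) t := by
    intro f t ht hf
    have := hf.hasMFDerivAt.comp t (hT t ht).1
    obtain ⟨L, hL, h2⟩ : ∃ L : ℝ →L[ℝ] ℝ, L 1 = dirDeriv X f (σ t) ∧ HasFDerivAt (f ∘ σ) L t :=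
      ⟨_, congrArg (mfderiv J 𝓘(ℝ, ℝ) f (σ t)) (one_smul ℝ (X (σ t))),
        hasMFDerivAt_iff_hasFDerivAt.1 this⟩
    exact h2.hasDerivAt.congr_deriv hL
  have h1 : HasDerivAt (fun t => S (σ t)) (∑' k, dirDeriv X (u k) (σ 0)) 0 := by
    refine hasDerivAt_of_tendstoLocallyUniformlyOn (l := Filter.atTop) (s := T)
      (f := fun (n : Finset ℕ) t => ∑ k ∈ n, u k (σ t))
      (f' := fun (n : Finset ℕ) t => ∑ k ∈ n, dirDeriv X (u k) (σ t))
      (g' := fun t => ∑' k, dirDeriv X (u k) (σ t)) hTo ?_ ?_ ?_ hT0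
    · exact hsum.hasSumLocallyUniformlyOn.comp σ (fun t ht => (hT t ht).2)
        fun t ht => (hT t ht).1.continuousAt.continuousWithinAt
    · exact Filter.Eventually.of_forall fun n t ht => by
        exact HasDerivAt.fun_sum fun k _ => hder (u k) t ht (hu k _)
    · exact fun t ht => hS _ (hT t ht).2
  have h2 := hder S 0 hT0 (by rwa [hσ0])
  have h3 := h2.unique h1
  rwa [hσ0] at h3

end Termwise

section SeriesSolution

set_option linter.unusedSectionVars false

variable {E : Type*} [NormedAddCommGroup E] [NormedSpace ℝ E] [CompleteSpace E]
  {G : Type*} [TopologicalSpace G] [ChartedSpace E G] [Group G] [LieGroup 𝓘(ℝ, E) ∞ G] {p r : ℕ}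
  {b : Module.Basis (AdaptedIndex p r) ℝ (GroupLieAlgebra 𝓘(ℝ, E) G)}
  {gm : Matrix (Fin r) (Fin r) ℝ} {F : G → ℝ} {Ω : Set (G × ℝ)}

/-- Moving `ρ` slightly away from 0 stays in the open set and gives convergence at a larger radius.
The hypotheses on the series say nothing about `ρ`-derivatives; these are obtained from power series
in this way. -/
theorem exists_abs_lt_of_isOpen {X : Type*} [TopologicalSpace X] {Ω : Set (X × ℝ)}
    (hΩ : IsOpen Ω) {x : X} {ρ : ℝ} (h : (x, ρ) ∈ Ω) : ∃ R, |ρ| < |R| ∧ (x, R) ∈ Ω := by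
  have hc : ∀ s : ℝ, ∀ᶠ t in 𝓝[>] (0 : ℝ), (x, ρ + t * s) ∈ Ω := fun s => by
    have : Continuous fun t : ℝ => (x, ρ + t * s) := by fun_prop
    exact (this.continuousAt.eventually (hΩ.mem_nhds (by simpa using h))).filter_mono
      nhdsWithin_le_nhds
  rcases le_total 0 ρ with h0 | h0
  · obtain ⟨t, h1, ht⟩ := ((hc 1).and self_mem_nhdsWithin).exists
    have ht : 0 < t := ht
    exact ⟨_, by rw [abs_of_nonneg h0, abs_of_nonneg (by linarith)]; linarith, h1⟩
  · obtain ⟨t, h1, ht⟩ := ((hc (-1)).and self_mem_nhdsWithin).exists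
    have ht : 0 < t := ht
    exact ⟨_, by rw [abs_of_nonpos h0, abs_of_nonpos (by linarith)]; linarith, h1⟩

variable (hΩ : IsOpen Ω) (hF : ContMDiff 𝓘(ℝ, E) 𝓘(ℝ, ℝ) ∞ F) (hs : SeriesConverges b gm F Ω)
include hΩ hF hs

theorem hasSum_dirDeriv_liftX_serSum (i : AdaptedIndex p r) {y : G × ℝ} (hy : y ∈ Ω) :
    HasSum (fun k => leftDeriv (b i) (serCoeff b gm F k) y.1 * y.2 ^ k)
      (dirDeriv (liftX b i) (fun y : G × ℝ => serSum b gm F y.1 y.2) y) := by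
  have e := fun k => dirDeriv_liftX_serTerm (b := b) (contMDiff_serCoeff (b := b) (gm := gm) hF k) k i
  have h := dirDeriv_eq_tsum (u := fun k (y : G × ℝ) => serCoeff b gm F k y.1 * y.2 ^ k) hΩ
    (contMDiff_liftX b i) (fun k => (contMDiff_serTerm hF k).mdifferentiable (by simp))
    (fun z hz => (hs.summable.summable hz).hasSum)
    (by simp only [e]; exact hs.summable_deriv (b i)) hy
    ((hs.smooth.contMDiffAt (hΩ.mem_nhds hy)).mdifferentiableAt (by simp))
  simp only [e] at h
  have h2 := ((hs.summable_deriv (b i)).summable hy).hasSum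
  rw [← h] at h2
  exact h2

theorem hasSum_dirDeriv_liftX_liftX_serSum (i j : AdaptedIndex p r) {y : G × ℝ} (hy : y ∈ Ω) :
    HasSum (fun k => leftDeriv (b i) (leftDeriv (b j) (serCoeff b gm F k)) y.1 * y.2 ^ k)
      (dirDeriv (liftX b i) (dirDeriv (liftX b j)
        (fun y : G × ℝ => serSum b gm F y.1 y.2)) y) := by
  have hsm := fun k => contMDiff_leftDeriv b (contMDiff_serCoeff (b := b) (gm := gm) hF k) j
  have e := fun k => dirDeriv_liftX_serTerm (b := b) (hsm k) k i
  have hmd : ∀ k, MDifferentiable (sliceModel E) 𝓘(ℝ, ℝ)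
      (fun y : G × ℝ => leftDeriv (b j) (serCoeff b gm F k) y.1 * y.2 ^ k) := fun k y =>
    (mdifferentiableAt_comp_fst ((hsm k).mdifferentiable (by simp)) y).mul
      (mdifferentiableAt_comp_snd (φ := fun x : ℝ => x ^ k) (by fun_prop))
  have h := dirDeriv_eq_tsum hΩ (contMDiff_liftX b i) hmd
    (fun z hz => hasSum_dirDeriv_liftX_serSum hΩ hF hs j hz)
    (by simp only [e]; exact hs.summable_deriv_deriv (b i) (b j)) hy
    (((contMDiffOn_slX (m := ∞) (by simp) le_rfl le_rfl hΩ j hs.smooth).contMDiffAt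
      (hΩ.mem_nhds hy)).mdifferentiableAt (by simp))
  simp only [e] at h
  have h2 := ((hs.summable_deriv_deriv (b i) (b j)).summable hy).hasSum
  rw [← h] at h2
  exact h2

theorem hasSum_dirDeriv_liftR_serSum {y : G × ℝ} (hy : y ∈ Ω) :
    HasSum (fun k : ℕ => (k + 1) * serCoeff b gm F (k + 1) y.1 * y.2 ^ k)
        (dirDeriv (liftR E G) (fun y : G × ℝ => serSum b gm F y.1 y.2) y)
      ∧ HasSum (fun k : ℕ => k * ((k + 1) * serCoeff b gm F (k + 1) y.1 * y.2 ^ (k - 1)))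
        (dirDeriv (liftR E G) (dirDeriv (liftR E G) (fun y : G × ℝ => serSum b gm F y.1 y.2)) y) := by
  have h1 : ∀ z ∈ Ω, HasSum (fun k : ℕ => (k + 1) * serCoeff b gm F (k + 1) z.1 * z.2 ^ k)
      (dirDeriv (liftR E G) (fun y : G × ℝ => serSum b gm F y.1 y.2) z) := by
    intro z hz
    obtain ⟨R, hR, hRΩ⟩ := exists_abs_lt_of_isOpen hΩ (x := z.1) (ρ := z.2) hz
    have hsum := hs.summable.summable hRΩ
    rw [dirDeriv_liftR ((hs.smooth.contMDiffAt (hΩ.mem_nhds hz)).mdifferentiableAt (by simp))]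
    have hd := (hasDerivAt_powerSeries hsum hR).deriv
    simp only [serSum]
    rw [hd]
    have h2 := ((summable_deriv_powerSeries hsum hR).of_norm).hasSum
    rw [← hasSum_nat_add_iff' 1] at h2
    simpa [mul_assoc] using h2
  refine ⟨h1 y hy, ?_⟩
  obtain ⟨R, hR, hRΩ⟩ := exists_abs_lt_of_isOpen hΩ (x := y.1) (ρ := y.2) hy
  -- The second derivative needs the differentiated series to converge strictly beyond `|ρ|`, hence
  -- an intermediate radius.
  obtain ⟨q, hq1, hq2⟩ := exists_between hR
  have hq0 : 0 < q := (abs_nonneg _).trans_lt hq1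
  have hsum : Summable fun k : ℕ => ((k + 1) * serCoeff b gm F (k + 1) y.1) * q ^ k := by
    have h2 := (summable_deriv_powerSeries (hs.summable.summable hRΩ)
      (ρ := q) (by rwa [abs_of_pos hq0])).of_norm
    rw [← summable_nat_add_iff 1] at h2
    simpa [mul_assoc] using h2
  have hy' : |y.2| < |q| := by rwa [abs_of_pos hq0]
  rw [dirDeriv_liftR (((contMDiffOn_slR (m := ∞) (by simp) le_rfl le_rfl hΩ hs.smooth).contMDiffAt
    (hΩ.mem_nhds hy)).mdifferentiableAt (by simp))]
  have hcont : ContinuousAt (fun s : ℝ => (y.1, s)) y.2 := by fun_prop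
  have hev : (fun s => dirDeriv (liftR E G) (fun y : G × ℝ => serSum b gm F y.1 y.2) (y.1, s))
      =ᶠ[𝓝 y.2] fun s => ∑' k : ℕ, ((k + 1) * serCoeff b gm F (k + 1) y.1) * s ^ k :=
    (hcont.eventually (hΩ.mem_nhds hy)).mono fun s hs' => (h1 _ hs').tsum_eq.symm
  rw [hev.deriv_eq, (hasDerivAt_powerSeries hsum hy').deriv]
  exact ((summable_deriv_powerSeries hsum hy').of_norm).hasSum

theorem fuchs_serSum {y : G × ℝ} (hy : y ∈ Ω) :
    fuchs b gm (fun y : G × ℝ => serSum b gm F y.1 y.2) y = 0 := by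
  obtain ⟨h1, h2⟩ := hasSum_dirDeriv_liftR_serSum hΩ hF hs hy
  have h3 := hasSum_sum (s := Finset.univ) fun A _ => hasSum_sum (s := Finset.univ) fun B _ =>
    (hasSum_dirDeriv_liftX_liftX_serSum hΩ hF hs (im A) (im B) hy).mul_left (gm⁻¹ A B)
  have h := ((h2.mul_left y.2).add (h1.mul_left (((2 * p + r : ℕ) : ℝ) / 2 + 1))).sub
    (h3.mul_left (1 / 2))
  refine h.unique ?_
  -- Already the coefficient of each `ρ^k` is zero, by the recursion. The factor `ρ` in front of the
  -- second derivative restores the exponent `k - 1` to `k`; for `k = 0` that term vanishes.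
  refine (congrArg (fun f : ℕ → ℝ => HasSum f 0) (funext fun k => ?_)).mpr hasSum_zero
  have hrec := serCoeff_succ (b := b) (gm := gm) hF k y.1
  have e : ∑ A, ∑ B, gm⁻¹ A B * (leftDeriv (b (im A)) (leftDeriv (b (im B)) (serCoeff b gm F k)) y.1
      * y.2 ^ k) = lapl b gm (serCoeff b gm F k) y.1 * y.2 ^ k := by
    simp only [lapl, Finset.sum_mul, mul_assoc]
  rw [e, ← hrec]
  rcases k with _ | k
  · push_cast; ring
  · rw [Nat.add_sub_cancel, pow_succ]; push_cast; ring

theorem dirDeriv_iz_serSum (hb : IsGradedBasis b) (h0 : ∀ d x, leftDeriv (b (iz d)) F x = 0)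
    (d : Fin p) {y : G × ℝ} (hy : y ∈ Ω) :
    dirDeriv (liftX b (iz d)) (fun y : G × ℝ => serSum b gm F y.1 y.2) y = 0 := by
  refine (hasSum_dirDeriv_liftX_serSum hΩ hF hs (iz d) hy).unique ?_
  simp only [leftDeriv_serCoeff_eq_zero hb hF h0, zero_mul]
  exact hasSum_zero

end SeriesSolution

/-! ### Convergent solutions, formal solutions and the case `F = 0` -/

section Solutions

set_option linter.unusedSectionVars false

variable {E : Type*} [NormedAddCommGroup E] [NormedSpace ℝ E] [CompleteSpace E]
  {G : Type*} [TopologicalSpace G] [ChartedSpace E G] [Group G] [LieGroup 𝓘(ℝ, E) ∞ G] {p r : ℕ}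
  {b : Module.Basis (AdaptedIndex p r) ℝ (GroupLieAlgebra 𝓘(ℝ, E) G)}
  {gz : Matrix (Fin p) (Fin p) ℝ} {gm : Matrix (Fin r) (Fin r) ℝ} {F : Fin p → Fin p → G → ℝ}
  {Ω : Set (G × ℝ)}

theorem isCoeff_serSum (hb : IsGradedBasis b) (hF : IsAdmissible b F) (hΩ : IsOpen Ω)
    (hs : ∀ a c, SeriesConverges b gm (F a c) Ω) :
    IsCoeff b (fun a c => serSum b gm (F a c)) Ω where
  isOpen := hΩ
  symm a c := by simp only [hF.symm a c]
  contMDiffOn a c := (hs a c).smooth.of_le two_le_infty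
  annihilated a c d _ hy :=
    dirDeriv_iz_serSum hΩ (hF.smooth a c) (hs a c) hb (hF.annihilated a c) d hy

theorem isCoeff_serPartial (hb : IsGradedBasis b) (hF : IsAdmissible b F) (N : ℕ) :
    IsCoeff b (fun a c => serPartial b gm N (F a c)) Set.univ where
  isOpen := isOpen_univ
  symm a c := by simp only [hF.symm a c]
  contMDiffOn a c := (contMDiff_serPartial (hF.smooth a c) N).contMDiffOn.of_le two_le_infty
  annihilated a c d y _ :=
    dirDeriv_iz_serPartial hb (hF.smooth a c) (hF.annihilated a c) N d y

theorem isCoeff_zero : IsCoeff (G := G) b 0 Set.univ where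
  isOpen := isOpen_univ
  symm _ _ := rfl
  contMDiffOn _ _ := contMDiffOn_const
  annihilated _ _ _ _ _ := dirDeriv_const _ _ _

theorem fuchs_zero (y : G × ℝ) : fuchs b gm (fun _ => 0) y = 0 := by
  have e : ∀ X : ∀ y : G × ℝ, TangentSpace (sliceModel E) y,
      dirDeriv X (fun _ : G × ℝ => (0 : ℝ)) = fun _ => 0 := fun X =>
    funext fun y => dirDeriv_const _ _ _
  simp only [fuchs, e, mul_zero, Finset.sum_const_zero, add_zero, sub_zero]

variable (hb : IsGradedBasis b) (hn : 4 ≤ 2 * p + r) (hgz : IsUnit gz.det) (hgm : IsUnit gm.det)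
  (hs : gm.IsSymm)
include hb hn hgz hgm hs

theorem isAmbientRicciFlat_of_fuchs {f : Fin p → Fin p → G → ℝ → ℝ} (hf : IsCoeff b f Ω)
    (h0 : ∀ a c, ∀ y ∈ Ω, fuchs b gm (fun y : G × ℝ => f a c y.1 y.2) y = 0) :
    IsAmbientRicciFlat b (ambientFamily b gz gm f) Ω := by
  intro J K P ht hP
  rw [ricci_ambientFamily hb hn hgz hgm hs hf ht hP]
  split
  · rw [h0 _ _ _ hP, mul_zero]
  · rfl

theorem convergent_solution (hF : IsAdmissible b F) (hΩ : IsOpen Ω)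
    (hc : ∀ a c, SeriesConverges b gm (F a c) Ω) :
    IsNormalForm (if Even (2 * p + r) then ∞ else 2) (leftMetric b gz gm)
        (ambientFamily b gz gm fun a c => serSum b gm (F a c)) Ω
      ∧ IsNormalForm ∞ (leftMetric b gz gm)
        (ambientFamily b gz gm fun a c => serSum b gm (F a c)) (Ω ∩ {y | y.2 ≠ 0})
      ∧ IsAmbientRicciFlat b (ambientFamily b gz gm fun a c => serSum b gm (F a c)) Ω := by
  have hcoeff := isCoeff_serSum hb hF hΩ hc
  refine ⟨?_, ?_, isAmbientRicciFlat_of_fuchs hb hn hgz hgm hs hcoeff fun a c y hy =>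
    fuchs_serSum hΩ (hF.smooth a c) (hc a c) hy⟩
  · refine isNormalForm_ambientFamily hn hgz hgm hs hcoeff.symm fun a c => ?_
    refine contMDiffOn_fun_mul ((contDiff_halfPow hn).contMDiff.comp
      contMDiff_snd).contMDiffOn ((hc a c).smooth.of_le ?_)
    split_ifs
    exacts [le_rfl, two_le_infty]
  · refine isNormalForm_ambientFamily hn hgz hgm hs hcoeff.symm fun a c => ?_
    refine contMDiffOn_fun_mul (fun y hy => ?_) ((hc a c).smooth.mono Set.inter_subset_left)
    exact ((contDiffAt_halfPow (2 * p + r) hy.2).contMDiffAt.comp y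
      contMDiffAt_snd).contMDiffWithinAt

theorem formal_solution (hF : IsAdmissible b F) (N : ℕ) :
    IsNormalForm (if Even (2 * p + r) then ∞ else 2) (leftMetric b gz gm)
        (ambientFamily b gz gm fun a c => serPartial b gm N (F a c)) Set.univ
      ∧ ∀ i j, ∀ P : ℝ × G × ℝ, 0 < P.1 → P.2.2 = 0 →
        (fun Q : ℝ × G × ℝ => ricci (ambientMetric (ambientFamily b gz gm
            fun a c => serPartial b gm N (F a c))) (ambientFrame b) i j Q)
          =O[𝓝 P] fun Q => halfPow (2 * p + r) Q.2.2 * Q.2.2 ^ N := by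
  have hcoeff := isCoeff_serPartial (gm := gm) hb hF N
  constructor
  · refine isNormalForm_ambientFamily hn hgz hgm hs hcoeff.symm fun a c => ?_
    refine contMDiffOn_fun_mul ((contDiff_halfPow hn).contMDiff.comp
      contMDiff_snd).contMDiffOn ((contMDiff_serPartial (hF.smooth a c) N).contMDiffOn.of_le ?_)
    split_ifs
    exacts [le_rfl, two_le_infty]
  · intro i j P hP _
    have hev : ∀ᶠ Q : ℝ × G × ℝ in 𝓝 P, 0 < Q.1 := (continuous_fst.tendsto P).eventually
      (lt_mem_nhds hP)
    have hR : ∀ᶠ Q : ℝ × G × ℝ in 𝓝 P, _ = _ := hev.mono fun Q hQ =>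
      ricci_ambientFamily (gz := gz) hb hn hgz hgm hs hcoeff hQ trivial i j
    refine IsBigO.congr' ?_ (Filter.EventuallyEq.symm hR) Filter.EventuallyEq.rfl
    split
    · rename_i a c
      have hc : Continuous fun Q : ℝ × G × ℝ => lapl b gm (serCoeff b gm (F a c) N) Q.2.1 :=
        (contMDiff_lapl (contMDiff_serCoeff (hF.smooth a c) N)).continuous.comp
          (continuous_fst.comp continuous_snd)
      -- The Ricci component is exactly `ρ^{n/2} ρ^N` times this function, which is continuous and
      -- so bounded near `P`.
      have h1 : (fun Q : ℝ × G × ℝ => -(1 / 2) * lapl b gm (serCoeff b gm (F a c) N) Q.2.1)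
          =O[𝓝 P] fun _ => (1 : ℝ) := (continuous_const.mul hc).continuousAt.isBigO_one ℝ
      have h2 := h1.mul (isBigO_refl (fun Q : ℝ × G × ℝ =>
        halfPow (2 * p + r) Q.2.2 * Q.2.2 ^ N) (𝓝 P))
      refine h2.congr (fun Q => ?_) fun Q => one_mul _
      rw [fuchs_serPartial (hF.smooth a c)]; ring
    · exact isBigO_zero _ _

theorem isAmbientRicciFlat_zero : IsAmbientRicciFlat b (ambientFamily b gz gm 0) Set.univ :=
  isAmbientRicciFlat_of_fuchs hb hn hgz hgm hs isCoeff_zero fun _ _ y _ => fuchs_zero y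

omit hb in
theorem isNormalForm_zero :
    IsNormalForm ∞ (leftMetric b gz gm) (ambientFamily b gz gm 0) Set.univ := by
  refine isNormalForm_ambientFamily hn hgz hgm hs (fun _ _ => rfl) fun a c => ?_
  simp only [Pi.zero_apply, mul_zero]
  exact contMDiffOn_const

end Solutions

section Analytic

variable {E : Type*} [NormedAddCommGroup E] [NormedSpace ℝ E]
  {G : Type*} [TopologicalSpace G] [ChartedSpace E G] [Group G] {p r : ℕ}

theorem isAnalyticInRho_zero (b : Module.Basis (AdaptedIndex p r) ℝ (GroupLieAlgebra 𝓘(ℝ, E) G))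
    (gz : Matrix (Fin p) (Fin p) ℝ) (gm : Matrix (Fin r) (Fin r) ℝ) :
    IsAnalyticInRho (ambientFamily b gz gm 0) Set.univ := by
  intro y _ v w
  simp only [ambientFamily, Pi.zero_apply, mul_zero, add_zero, LinearMap.add_apply,
    LinearMap.sum_apply, LinearMap.smul_apply, smul_eq_mul, div_eq_mul_inv]
  fun_prop

end Analytic

/-! ### Orders of vanishing in `ρ` and how they change -/

section Jets

set_option linter.unusedSectionVars false

variable {E : Type*} [NormedAddCommGroup E] [NormedSpace ℝ E] [CompleteSpace E]
  {G : Type*} [TopologicalSpace G] [ChartedSpace E G] [Group G] [LieGroup 𝓘(ℝ, E) ∞ G]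
  {κ : Type*} [Fintype κ] [DecidableEq κ] {Ω : Set (G × ℝ)}

variable (E) in
/-- The function is smooth on `Ω` and vanishes to order `k` in `ρ` at the points with `ρ = 0`. -/
def VanishesToOrder (Ω : Set (G × ℝ)) : ℕ → (G × ℝ → ℝ) → Prop
  | 0, f => ContMDiffOn (sliceModel E) 𝓘(ℝ, ℝ) ∞ f Ω
  | k + 1, f => ContMDiffOn (sliceModel E) 𝓘(ℝ, ℝ) ∞ f Ω ∧ (∀ x, (x, (0 : ℝ)) ∈ Ω → f (x, 0) = 0)
      ∧ VanishesToOrder Ω k (dirDeriv (liftR E G) f)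

theorem infty_add_one_le : (∞ : ℕ∞ω) + 1 ≤ ∞ := le_rfl

theorem mdifferentiableAt_of_smooth (hΩ : IsOpen Ω) {f : G × ℝ → ℝ}
    (hf : ContMDiffOn (sliceModel E) 𝓘(ℝ, ℝ) ∞ f Ω) {y : G × ℝ} (hy : y ∈ Ω) :
    MDifferentiableAt (sliceModel E) 𝓘(ℝ, ℝ) f y :=
  (hf.contMDiffAt (hΩ.mem_nhds hy)).mdifferentiableAt (by simp)

theorem smooth_dirDeriv_liftR (hΩ : IsOpen Ω) {f : G × ℝ → ℝ}
    (hf : ContMDiffOn (sliceModel E) 𝓘(ℝ, ℝ) ∞ f Ω) :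
    ContMDiffOn (sliceModel E) 𝓘(ℝ, ℝ) ∞ (dirDeriv (liftR E G) f) Ω :=
  contMDiffOn_slR infty_add_one_le le_rfl le_rfl hΩ hf

theorem smooth_dirDeriv_liftX (b : Module.Basis κ ℝ (GroupLieAlgebra 𝓘(ℝ, E) G)) (hΩ : IsOpen Ω)
    (i : κ) {f : G × ℝ → ℝ} (hf : ContMDiffOn (sliceModel E) 𝓘(ℝ, ℝ) ∞ f Ω) :
    ContMDiffOn (sliceModel E) 𝓘(ℝ, ℝ) ∞ (dirDeriv (liftX b i) f) Ω :=
  contMDiffOn_slX infty_add_one_le le_rfl le_rfl hΩ i hf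

theorem dirDeriv_congr_on (hΩ : IsOpen Ω) {X : ∀ y : G × ℝ, TangentSpace (sliceModel E) y}
    {f g : G × ℝ → ℝ} (h : ∀ y ∈ Ω, f y = g y) : ∀ y ∈ Ω, dirDeriv X f y = dirDeriv X g y :=
  fun _ hy => dirDeriv_congr (Filter.eventually_of_mem (hΩ.mem_nhds hy) h)

namespace VanishesToOrder

theorem smooth {k : ℕ} {f : G × ℝ → ℝ} (h : VanishesToOrder E Ω k f) :
    ContMDiffOn (sliceModel E) 𝓘(ℝ, ℝ) ∞ f Ω := by
  cases k with
  | zero => exact h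
  | succ k => exact h.1

variable (hΩ : IsOpen Ω)
include hΩ

theorem congr {k : ℕ} {f g : G × ℝ → ℝ} (hf : VanishesToOrder E Ω k f)
    (h : ∀ y ∈ Ω, f y = g y) : VanishesToOrder E Ω k g := by
  induction k generalizing f g with
  | zero => exact ContMDiffOn.congr hf fun y hy => (h y hy).symm
  | succ k ih =>
    exact ⟨hf.1.congr fun y hy => (h y hy).symm, fun x hx => (h _ hx).symm.trans (hf.2.1 x hx),
      ih hf.2.2 (dirDeriv_congr_on hΩ h)⟩

theorem of_succ {k : ℕ} {f : G × ℝ → ℝ} (hf : VanishesToOrder E Ω (k + 1) f) :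
    VanishesToOrder E Ω k f := by
  induction k generalizing f with
  | zero => exact hf.1
  | succ k ih => exact ⟨hf.1, hf.2.1, ih hf.2.2⟩

theorem add {k : ℕ} {f g : G × ℝ → ℝ} (hf : VanishesToOrder E Ω k f)
    (hg : VanishesToOrder E Ω k g) : VanishesToOrder E Ω k (fun y => f y + g y) := by
  induction k generalizing f g with
  | zero => exact ContMDiffOn.add hf hg
  | succ k ih =>
    refine ⟨hf.1.add hg.1, fun x hx => by
      beta_reduce; rw [hf.2.1 x hx, hg.2.1 x hx, add_zero],
      (ih hf.2.2 hg.2.2).congr hΩ fun y hy => ?_⟩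
    rw [dirDeriv_add (mdifferentiableAt_of_smooth hΩ hf.1 hy)
      (mdifferentiableAt_of_smooth hΩ hg.1 hy)]

theorem mul {k : ℕ} {f g : G × ℝ → ℝ} (hf : ContMDiffOn (sliceModel E) 𝓘(ℝ, ℝ) ∞ f Ω)
    (hg : VanishesToOrder E Ω k g) : VanishesToOrder E Ω k (fun y => f y * g y) := by
  induction k generalizing f g with
  | zero => exact contMDiffOn_fun_mul hf hg
  | succ k ih =>
    refine ⟨contMDiffOn_fun_mul hf hg.1, fun x hx => by
      beta_reduce; rw [hg.2.1 x hx, mul_zero],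
      ((ih (smooth_dirDeriv_liftR hΩ hf) (hg.of_succ hΩ)).add hΩ (ih hf hg.2.2)).congr hΩ
        fun y hy => ?_⟩
    rw [dirDeriv_mul (mdifferentiableAt_of_smooth hΩ hf hy)
      (mdifferentiableAt_of_smooth hΩ hg.1 hy)]

theorem const_mul {k : ℕ} (c : ℝ) {f : G × ℝ → ℝ} (hf : VanishesToOrder E Ω k f) :
    VanishesToOrder E Ω k (fun y => c * f y) :=
  mul hΩ contMDiffOn_const hf

theorem sub {k : ℕ} {f g : G × ℝ → ℝ} (hf : VanishesToOrder E Ω k f)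
    (hg : VanishesToOrder E Ω k g) : VanishesToOrder E Ω k (fun y => f y - g y) :=
  (hf.add hΩ (hg.const_mul hΩ (-1))).congr hΩ fun y _ => by ring

theorem zero (k : ℕ) : VanishesToOrder E Ω k (fun _ => 0) := by
  induction k with
  | zero => exact contMDiffOn_const
  | succ k ih =>
    exact ⟨contMDiffOn_const, fun _ _ => rfl, ih.congr hΩ fun y _ => (dirDeriv_const _ _ _).symm⟩

theorem sum {k : ℕ} {α : Type*} (s : Finset α) {f : α → G × ℝ → ℝ}
    (hf : ∀ i ∈ s, VanishesToOrder E Ω k (f i)) :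
    VanishesToOrder E Ω k (fun y => ∑ i ∈ s, f i y) := by
  classical
  induction s using Finset.induction_on with
  | empty => simpa using zero hΩ k
  | insert i s hi ih =>
    simp only [Finset.sum_insert hi]
    exact (hf i (by simp)).add hΩ (ih fun j hj => hf j (by simp [hj]))

/-- Derivatives along `G` vanish on the slice `ρ = 0` if the function does, and they commute with
`∂_ρ`; so no order is lost. -/
theorem dirDeriv_liftX {k : ℕ} (b : Module.Basis κ ℝ (GroupLieAlgebra 𝓘(ℝ, E) G)) (i : κ)
    {f : G × ℝ → ℝ} (hf : VanishesToOrder E Ω k f) :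
    VanishesToOrder E Ω k (dirDeriv (liftX b i) f) := by
  induction k generalizing f with
  | zero => exact smooth_dirDeriv_liftX b hΩ i hf
  | succ k ih =>
    refine ⟨smooth_dirDeriv_liftX b hΩ i hf.1, fun x hx => ?_,
      (ih hf.2.2).congr hΩ fun y hy =>
        dirDeriv_liftX_liftR b i hΩ (hf.1.of_le two_le_infty) hy⟩
    rw [_root_.dirDeriv_liftX b (mdifferentiableAt_of_smooth hΩ hf.1 hx)]
    have hev : (fun x' => f (x', 0)) =ᶠ[𝓝 x] fun _ => 0 := by
      have hc : Continuous fun x' : G => (x', (0 : ℝ)) := by fun_prop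
      exact (hc.continuousAt.eventually (hΩ.mem_nhds hx)).mono fun x' hx' => hf.2.1 x' hx'
    exact (dirDeriv_congr hev).trans (dirDeriv_const _ _ _)

/-- The induction rests on `∂_ρ(ρ f) = f + ρ ∂_ρ f`. -/
theorem rho_mul {k : ℕ} {f : G × ℝ → ℝ} (hf : VanishesToOrder E Ω k f) :
    VanishesToOrder E Ω (k + 1) (fun y => y.2 * f y) := by
  have hs : ContMDiffOn (sliceModel E) 𝓘(ℝ, ℝ) ∞ (fun y : G × ℝ => y.2) Ω :=
    contMDiff_snd.contMDiffOn
  have key : ∀ {f : G × ℝ → ℝ}, ContMDiffOn (sliceModel E) 𝓘(ℝ, ℝ) ∞ f Ω → ∀ y ∈ Ω,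
      f y + y.2 * dirDeriv (liftR E G) f y = dirDeriv (liftR E G) (fun y => y.2 * f y) y :=
    fun {f} h y hy => by
      rw [dirDeriv_mul (f := fun y : G × ℝ => y.2) mdifferentiableAt_snd
        (mdifferentiableAt_of_smooth hΩ h hy), dirDeriv_liftR_snd, one_mul]
  induction k generalizing f with
  | zero =>
    exact ⟨contMDiffOn_fun_mul hs hf, fun x _ => zero_mul _,
      smooth_dirDeriv_liftR hΩ (contMDiffOn_fun_mul hs hf)⟩
  | succ k ih =>
    exact ⟨contMDiffOn_fun_mul hs hf.1, fun x _ => zero_mul _,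
      (hf.add hΩ (ih hf.2.2)).congr hΩ (key hf.1)⟩

/-- The leading term `c(x) ρ^k` of `f` is an eigenfunction of `ρ ∂_ρ` with eigenvalue `k`. The
induction uses that `∂_ρ` carries `ρ ∂_ρ - (k+1)` to `ρ ∂_ρ - k` acting on `∂_ρ f`. -/
theorem euler {k : ℕ} {f : G × ℝ → ℝ} (hf : VanishesToOrder E Ω k f) :
    VanishesToOrder E Ω (k + 1) (fun y => y.2 * dirDeriv (liftR E G) f y - k * f y) := by
  induction k generalizing f with
  | zero =>
    exact (rho_mul (k := 0) hΩ (smooth_dirDeriv_liftR hΩ hf)).congr hΩ fun y _ => by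
      rw [Nat.cast_zero, zero_mul, sub_zero]
  | succ k ih =>
    have hR := smooth_dirDeriv_liftR hΩ hf.1
    have h1 : VanishesToOrder E Ω (k + 1) (fun y => y.2 * dirDeriv (liftR E G) f y) :=
      rho_mul hΩ hf.2.2
    have h2 := h1.sub hΩ (hf.const_mul hΩ ((k + 1 : ℕ) : ℝ))
    refine ⟨h2.smooth, h2.2.1, (ih hf.2.2).congr hΩ fun y hy => ?_⟩
    have e : dirDeriv (liftR E G) (fun y => y.2 * dirDeriv (liftR E G) f y
          + (-((k + 1 : ℕ) : ℝ)) * f y) y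
        = dirDeriv (liftR E G) f y + y.2 * dirDeriv (liftR E G) (dirDeriv (liftR E G) f) y
          + (-((k + 1 : ℕ) : ℝ)) * dirDeriv (liftR E G) f y := by
      rw [dirDeriv_add (f := fun y => y.2 * dirDeriv (liftR E G) f y)
          (g := fun y => (-((k + 1 : ℕ) : ℝ)) * f y)
          (mdifferentiableAt_of_smooth hΩ h1.smooth hy)
          (mdifferentiableAt_const.mul (mdifferentiableAt_of_smooth hΩ hf.1 hy)),
        dirDeriv_const_mul _ (mdifferentiableAt_of_smooth hΩ hf.1 hy),
        dirDeriv_mul (f := fun y : G × ℝ => y.2) mdifferentiableAt_snd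
          (mdifferentiableAt_of_smooth hΩ hR hy), dirDeriv_liftR_snd, one_mul]
    simp only [sub_eq_add_neg, ← neg_mul] at e ⊢
    rw [e]; push_cast; ring

theorem iteratedDeriv_eq_zero {k : ℕ} {f : G × ℝ → ℝ} (hf : VanishesToOrder E Ω k f) {x : G}
    (hx : (x, (0 : ℝ)) ∈ Ω) {j : ℕ} (hj : j < k) :
    iteratedDeriv j (fun s => f (x, s)) 0 = 0 := by
  induction j generalizing f k with
  | zero =>
    obtain ⟨k, rfl⟩ := Nat.exists_eq_add_of_lt hj
    rw [iteratedDeriv_zero]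
    exact (show VanishesToOrder E Ω (0 + k + 1) f from hf).2.1 x hx
  | succ j ih =>
    obtain ⟨k, rfl⟩ : ∃ m, k = m + 1 := ⟨k - 1, by omega⟩
    have hc : Continuous fun s : ℝ => (x, s) := by fun_prop
    have hev : deriv (fun s => f (x, s)) =ᶠ[𝓝 0] fun s => dirDeriv (liftR E G) f (x, s) :=
      (hc.continuousAt.eventually (hΩ.mem_nhds hx)).mono fun s hs => by
        beta_reduce; rw [dirDeriv_liftR (mdifferentiableAt_of_smooth hΩ hf.1 hs)]
    rw [iteratedDeriv_succ', hev.iteratedDeriv_eq j, ih hf.2.2 (Nat.lt_of_succ_lt_succ hj)]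

end VanishesToOrder

end Jets

section Congruence

set_option linter.unusedSectionVars false

variable {E : Type*} [NormedAddCommGroup E] [NormedSpace ℝ E] [CompleteSpace E]
  {G : Type*} [TopologicalSpace G] [ChartedSpace E G] [Group G] [LieGroup 𝓘(ℝ, E) ∞ G]
  {κ : Type*} [Fintype κ] [DecidableEq κ] {Ω : Set (G × ℝ)}

variable (E) in
/-- Two functions are smooth on `Ω` and agree to order `k` in `ρ` at the points with `ρ = 0`. -/
structure AgreeToOrder (Ω : Set (G × ℝ)) (k : ℕ) (f g : G × ℝ → ℝ) : Prop where
  left : ContMDiffOn (sliceModel E) 𝓘(ℝ, ℝ) ∞ f Ω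
  right : ContMDiffOn (sliceModel E) 𝓘(ℝ, ℝ) ∞ g Ω
  diff : VanishesToOrder E Ω k fun y => f y - g y

namespace AgreeToOrder

variable (hΩ : IsOpen Ω) {k : ℕ} {f g f' g' : G × ℝ → ℝ}
include hΩ

theorem refl (hf : ContMDiffOn (sliceModel E) 𝓘(ℝ, ℝ) ∞ f Ω) : AgreeToOrder E Ω k f f :=
  ⟨hf, hf, (VanishesToOrder.zero hΩ k).congr hΩ fun _ _ => (sub_self _).symm⟩

theorem const (c : ℝ) : AgreeToOrder E Ω k (fun _ => c) (fun _ => c) :=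
  refl hΩ contMDiffOn_const

theorem of_succ (h : AgreeToOrder E Ω (k + 1) f g) : AgreeToOrder E Ω k f g :=
  ⟨h.left, h.right, h.diff.of_succ hΩ⟩

theorem add (h : AgreeToOrder E Ω k f g) (h' : AgreeToOrder E Ω k f' g') :
    AgreeToOrder E Ω k (fun y => f y + f' y) (fun y => g y + g' y) :=
  ⟨h.left.add h'.left, h.right.add h'.right, (h.diff.add hΩ h'.diff).congr hΩ fun y _ => by ring⟩

theorem sub (h : AgreeToOrder E Ω k f g) (h' : AgreeToOrder E Ω k f' g') :
    AgreeToOrder E Ω k (fun y => f y - f' y) (fun y => g y - g' y) :=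
  ⟨h.left.sub h'.left, h.right.sub h'.right, (h.diff.sub hΩ h'.diff).congr hΩ fun y _ => by ring⟩

theorem mul (h : AgreeToOrder E Ω k f g) (h' : AgreeToOrder E Ω k f' g') :
    AgreeToOrder E Ω k (fun y => f y * f' y) (fun y => g y * g' y) :=
  ⟨contMDiffOn_fun_mul h.left h'.left, contMDiffOn_fun_mul h.right h'.right,
    ((VanishesToOrder.mul hΩ h.left h'.diff).add hΩ (VanishesToOrder.mul hΩ h'.right h.diff)).congr
      hΩ fun y _ => by ring⟩

theorem sum {α : Type*} (s : Finset α) {f g : α → G × ℝ → ℝ}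
    (h : ∀ i ∈ s, AgreeToOrder E Ω k (f i) (g i)) :
    AgreeToOrder E Ω k (fun y => ∑ i ∈ s, f i y) (fun y => ∑ i ∈ s, g i y) :=
  ⟨contMDiffOn_fun_sum fun i hi => (h i hi).left, contMDiffOn_fun_sum fun i hi => (h i hi).right,
    (VanishesToOrder.sum hΩ s fun i hi => (h i hi).diff).congr hΩ fun _ _ =>
      Finset.sum_sub_distrib _ _⟩

theorem rho_mul (h : AgreeToOrder E Ω k f g) :
    AgreeToOrder E Ω (k + 1) (fun y => y.2 * f y) (fun y => y.2 * g y) :=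
  ⟨contMDiffOn_fun_mul contMDiff_snd.contMDiffOn h.left,
    contMDiffOn_fun_mul contMDiff_snd.contMDiffOn h.right,
    (h.diff.rho_mul hΩ).congr hΩ fun y _ => by ring⟩

theorem dirDeriv_sub {X : ∀ y : G × ℝ, TangentSpace (sliceModel E) y}
    (hf : ContMDiffOn (sliceModel E) 𝓘(ℝ, ℝ) ∞ f Ω) (hg : ContMDiffOn (sliceModel E) 𝓘(ℝ, ℝ) ∞ g Ω)
    {y : G × ℝ} (hy : y ∈ Ω) :
    dirDeriv X (fun y => f y - g y) y = dirDeriv X f y - dirDeriv X g y := by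
  have e : (fun y => f y - g y) = fun y => f y + (-1) * g y := by funext y; ring
  have hg' := mdifferentiableAt_of_smooth hΩ hg hy
  rw [e, dirDeriv_add (g := fun y => -1 * g y) (mdifferentiableAt_of_smooth hΩ hf hy) (mdifferentiableAt_const.mul hg'),
    dirDeriv_const_mul _ hg']
  ring

theorem dirDeriv_liftR (h : AgreeToOrder E Ω (k + 1) f g) :
    AgreeToOrder E Ω k (dirDeriv (liftR E G) f) (dirDeriv (liftR E G) g) :=
  ⟨smooth_dirDeriv_liftR hΩ h.left, smooth_dirDeriv_liftR hΩ h.right,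
    h.diff.2.2.congr hΩ fun _ hy => dirDeriv_sub hΩ h.left h.right hy⟩

theorem dirDeriv_liftX (b : Module.Basis κ ℝ (GroupLieAlgebra 𝓘(ℝ, E) G)) (i : κ)
    (h : AgreeToOrder E Ω k f g) :
    AgreeToOrder E Ω k (dirDeriv (liftX b i) f) (dirDeriv (liftX b i) g) :=
  ⟨smooth_dirDeriv_liftX b hΩ i h.left, smooth_dirDeriv_liftX b hΩ i h.right,
    (h.diff.dirDeriv_liftX hΩ b i).congr hΩ fun _ hy => dirDeriv_sub hΩ h.left h.right hy⟩

variable {a a' : κ → κ → G × ℝ → ℝ} (h : ∀ i j, AgreeToOrder E Ω k (a i j) (a' i j))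

theorem slKoszul (h : ∀ i j, AgreeToOrder E Ω k (a i j) (a' i j))
    (b : Module.Basis κ ℝ (GroupLieAlgebra 𝓘(ℝ, E) G)) (i j l : κ) :
    AgreeToOrder E Ω k (slKoszul b a i j l) (slKoszul b a' i j l) := by
  have hX : ∀ i j k', AgreeToOrder E Ω k (dirDeriv (liftX b i) (a j k'))
    (dirDeriv (liftX b i) (a' j k')) := fun i j k' => (h j k').dirDeriv_liftX hΩ b i
  have hs : ∀ i j k', AgreeToOrder E Ω k (fun y => ∑ l, structConst b l i j * a l k' y)
      (fun y => ∑ l, structConst b l i j * a' l k' y) := fun i j k' =>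
    sum hΩ _ fun l _ => (const hΩ _).mul hΩ (h l k')
  exact (const hΩ (1 / 2)).mul hΩ ((((((hX i j l).add hΩ (hX j i l)).sub hΩ (hX l i j)).add hΩ
    (hs i j l)).sub hΩ (hs i l j)).sub hΩ (hs j l i))

variable (hdet : ∀ y ∈ Ω, (slMat a y).det ≠ 0) (hdet' : ∀ y ∈ Ω, (slMat a' y).det ≠ 0)
include h hdet hdet'

/-- With `A`, `B` the two matrices, `A⁻¹ - B⁻¹ = -A⁻¹ (A - B) B⁻¹`. -/
theorem slMat_inv (i j : κ) :
    AgreeToOrder E Ω k (fun y => (slMat a y)⁻¹ i j) (fun y => (slMat a' y)⁻¹ i j) := by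
  have h1 : ∀ i j, ContMDiffOn (sliceModel E) 𝓘(ℝ, ℝ) ∞ (fun y => (slMat a y)⁻¹ i j) Ω :=
    contMDiffOn_matrix_inv (fun i j => (h i j).left) hdet
  have h2 : ∀ i j, ContMDiffOn (sliceModel E) 𝓘(ℝ, ℝ) ∞ (fun y => (slMat a' y)⁻¹ i j) Ω :=
    contMDiffOn_matrix_inv (fun i j => (h i j).right) hdet'
  refine ⟨h1 i j, h2 i j, ((VanishesToOrder.sum hΩ Finset.univ fun l _ =>
    VanishesToOrder.sum hΩ Finset.univ fun m _ => VanishesToOrder.mul hΩ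
      (contMDiffOn_fun_mul (h1 i l) (h2 m j)) (h l m).diff).const_mul hΩ (-1)).congr hΩ
        fun y hy => ?_⟩
  have e : (slMat a y)⁻¹ - (slMat a' y)⁻¹
      = -((slMat a y)⁻¹ * (slMat a y - slMat a' y) * (slMat a' y)⁻¹) := by
    rw [Matrix.mul_sub, Matrix.sub_mul, Matrix.nonsing_inv_mul _ (hdet y hy).isUnit, one_mul,
      Matrix.mul_assoc, Matrix.mul_nonsing_inv _ (hdet' y hy).isUnit, mul_one, neg_sub]
  have := congrFun (congrFun e i) j
  rw [Matrix.sub_apply] at this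
  rw [this, Matrix.neg_apply, Matrix.mul_assoc, Matrix.mul_apply, neg_one_mul]
  congr 1
  refine Finset.sum_congr rfl fun l _ => ?_
  rw [Matrix.mul_apply, Finset.mul_sum]
  refine Finset.sum_congr rfl fun m _ => ?_
  simp only [Matrix.sub_apply, slMat, Matrix.of_apply]
  ring

theorem slConn (b : Module.Basis κ ℝ (GroupLieAlgebra 𝓘(ℝ, E) G)) (l i j : κ) :
    AgreeToOrder E Ω k (slConn b a l i j) (slConn b a' l i j) :=
  sum hΩ _ fun m _ => (slMat_inv hΩ h hdet hdet' l m).mul hΩ (slKoszul hΩ h b i j m)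

/-- The Ricci tensor of the slices involves only derivatives along `G`, so the order of agreement is
kept. -/
theorem slRicci (b : Module.Basis κ ℝ (GroupLieAlgebra 𝓘(ℝ, E) G)) (i j : κ) :
    AgreeToOrder E Ω k (slRicci b a i j) (slRicci b a' i j) := by
  have hC := slConn hΩ h hdet hdet' b
  exact sum hΩ _ fun l _ => (((hC l i j).dirDeriv_liftX hΩ b l).sub hΩ
    ((hC l l j).dirDeriv_liftX hΩ b i)).add hΩ (sum hΩ _ fun m _ =>
      (((hC m i j).mul hΩ (hC l l m)).sub hΩ ((hC m l j).mul hΩ (hC l i m))).sub hΩ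
        (((hC m l i).sub hΩ (hC m i l)).mul hΩ (hC l m j)))

end AgreeToOrder

/-- The shape operator contains one `ρ`-derivative, which costs one order. -/
theorem AgreeToOrder.slShape (hΩ : IsOpen Ω) {k : ℕ} {a a' : κ → κ → G × ℝ → ℝ}
    (h : ∀ i j, AgreeToOrder E Ω (k + 1) (a i j) (a' i j))
    (hdet : ∀ y ∈ Ω, (slMat a y).det ≠ 0) (hdet' : ∀ y ∈ Ω, (slMat a' y).det ≠ 0) (l i : κ) :
    AgreeToOrder E Ω k (slShape E a l i) (slShape E a' l i) :=
  sum hΩ _ fun m _ => (slMat_inv hΩ (fun i j => (h i j).of_succ hΩ) hdet hdet' l m).mul hΩ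
    ((const hΩ _).mul hΩ ((h i m).dirDeriv_liftR hΩ))

end Congruence

/-! ### Uniqueness in odd dimensions -/

section Uniqueness

set_option linter.unusedSectionVars false

variable {E : Type*} [NormedAddCommGroup E] [NormedSpace ℝ E] [CompleteSpace E]
  {G : Type*} [TopologicalSpace G] [ChartedSpace E G] [Group G] [LieGroup 𝓘(ℝ, E) ∞ G]
  {κ : Type*} [Fintype κ] [DecidableEq κ] {b : Module.Basis κ ℝ (GroupLieAlgebra 𝓘(ℝ, E) G)}
  {Ω : Set (G × ℝ)} {a a' : κ → κ → G × ℝ → ℝ}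

theorem sum_inv_mul_eq_card {y : G × ℝ} (hdet : (slMat a y).det ≠ 0)
    (hsymm : ∀ i j, a i j y = a j i y) :
    ∑ i, ∑ l, (slMat a y)⁻¹ i l * a i l y = Fintype.card κ := by
  have e : ∀ i, ∑ l, (slMat a y)⁻¹ i l * a i l y = 1 := fun i => by
    have := sum_inv_mul_slMat a hdet i i
    simp only [if_true] at this
    rw [← this]
    exact Finset.sum_congr rfl fun l _ => by rw [hsymm i l]
  simp [e]

/-- The step of the induction over the orders of vanishing, for odd dimensions. -/
theorem agreeToOrder_succ (hΩ : IsOpen Ω) (hodd : Odd (Fintype.card κ)) (hn : 2 ≤ Fintype.card κ)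
    (hdet : ∀ y ∈ Ω, (slMat a y).det ≠ 0) (hdet' : ∀ y ∈ Ω, (slMat a' y).det ≠ 0)
    (hsymm : ∀ y ∈ Ω, ∀ i j, a i j y = a j i y)
    (hR : ∀ y ∈ Ω, ∀ J K, ambRicci b a J K y = 0) (hR' : ∀ y ∈ Ω, ∀ J K, ambRicci b a' J K y = 0)
    {k : ℕ} (h : ∀ i j, AgreeToOrder E Ω (k + 1) (a i j) (a' i j)) (i j : κ) :
    AgreeToOrder E Ω (k + 2) (a i j) (a' i j) := by
  have hS := AgreeToOrder.slShape hΩ h hdet hdet'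
  have hT : AgreeToOrder E Ω k (fun y => ∑ i, slShape E a i i y) (fun y => ∑ i, slShape E a' i i y) :=
    .sum hΩ _ fun i _ => hS i i
  have hD : ∀ i j, AgreeToOrder E Ω k (dirDeriv (liftR E G) (a i j))
    (dirDeriv (liftR E G) (a' i j)) := fun i j => (h i j).dirDeriv_liftR hΩ
  set n : ℝ := (Fintype.card κ : ℝ) with hn_def
  set σ : G × ℝ → ℝ := fun y => ∑ i, slShape E a i i y - ∑ i, slShape E a' i i y with hσ
  set D : κ → κ → G × ℝ → ℝ :=
    fun i j y => dirDeriv (liftR E G) (a i j) y - dirDeriv (liftR E G) (a' i j) y with hDdef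
  -- The difference of the `e_i e_j` components of the two Ricci equations, modulo order `k + 1`. By
  -- `euler`, `ρ ∂_ρ D` may be replaced by `k D`; terms with a factor `ρ` gain an order, and the
  -- slice Ricci tensors agree to order `k + 1`. There remain `(1 - n/2) D` and the trace term `-a
  -- σ`.
  have key : ∀ i j, VanishesToOrder E Ω (k + 1)
      fun y => ((k : ℝ) + 1 - n / 2) * D i j y - a i j y * σ y := by
    intro i j
    have hB := ((((hD i j).mul hΩ hT).rho_mul hΩ).sub hΩ ((AgreeToOrder.sum hΩ Finset.univ
      fun m _ => ((hS m j).mul hΩ (hD i m)).add hΩ ((hD m j).mul hΩ (hS m i))).rho_mul hΩ)).add hΩ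
      (AgreeToOrder.slRicci hΩ h hdet hdet' b i j)
    have h1 := (VanishesToOrder.mul hΩ hT.right (h i j).diff).sub hΩ (hB.diff.add hΩ
      ((hD i j).diff.euler hΩ))
    refine h1.congr hΩ fun y hy => ?_
    have e1 := hR y hy (.inr (.inl i)) (.inr (.inl j))
    have e2 := hR' y hy (.inr (.inl i)) (.inr (.inl j))
    have e3 := AgreeToOrder.dirDeriv_sub hΩ (X := liftR E G) (hD i j).left (hD i j).right hy
    simp only [ambRicci] at e1 e2
    rw [e3]
    simp only [hσ, hDdef, hn_def]
    linear_combination e2 - e1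
  have hinv := AgreeToOrder.slMat_inv hΩ h hdet hdet'
  -- Contraction of `key` with `½ a⁻¹`. Up to order `k + 1` half the trace of `D` is `σ`, and the
  -- trace of `a` is `n`, so the factor is `(k + 1 - n/2) - n/2`.
  have htr : VanishesToOrder E Ω (k + 1) fun y => ((k : ℝ) + 1 - n) * σ y := by
    have h1 := (VanishesToOrder.sum hΩ Finset.univ fun i _ => VanishesToOrder.sum hΩ Finset.univ
      fun l _ => VanishesToOrder.mul hΩ (hinv i l).left (key i l)).const_mul hΩ (1 / 2)
    have h2 := (VanishesToOrder.sum hΩ Finset.univ fun i _ => VanishesToOrder.sum hΩ Finset.univ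
      fun l _ => VanishesToOrder.mul hΩ (hD i l).right (hinv i l).diff).const_mul hΩ
        (((k : ℝ) + 1 - n / 2) * (1 / 2))
    refine (h1.add hΩ h2).congr hΩ fun y hy => ?_
    have e1 := sum_inv_mul_eq_card (hdet y hy) (hsymm y hy)
    have e2 : σ y = 1 / 2 * ∑ i, ∑ l, ((slMat a y)⁻¹ i l * D i l y
        + dirDeriv (liftR E G) (a' i l) y * ((slMat a y)⁻¹ i l - (slMat a' y)⁻¹ i l)) := by
      simp only [hσ, hDdef, slShape, ← Finset.sum_sub_distrib, Finset.mul_sum]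
      exact Finset.sum_congr rfl fun i _ => Finset.sum_congr rfl fun l _ => by ring
    have e3 : ∑ i, ∑ l, (slMat a y)⁻¹ i l * (((k : ℝ) + 1 - n / 2) * D i l y - a i l y * σ y)
        = ((k : ℝ) + 1 - n / 2) * ∑ i, ∑ l, (slMat a y)⁻¹ i l * D i l y - n * σ y := by
      rw [hn_def, ← e1]
      simp only [Finset.sum_mul, Finset.mul_sum, ← Finset.sum_sub_distrib]
      exact Finset.sum_congr rfl fun i _ => Finset.sum_congr rfl fun l _ => by ring
    simp only [Finset.sum_add_distrib] at e2
    rw [e3]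
    linear_combination (-((k : ℝ) + 1 - n / 2)) * e2
  have hσ1 : VanishesToOrder E Ω (k + 1) σ := by
    -- For `k + 1 = n` the traced equation is empty. The `∂_ρ ∂_ρ` component then helps: it
    -- expresses `∂_ρ σ` by squares of the shape operators, which agree to order `k`. Here `n ≥ 2`
    -- ensures `k ≥ 1`, so that `σ` is already known to vanish at `ρ = 0`.
    by_cases hk : k + 1 = Fintype.card κ
    · obtain ⟨m, rfl⟩ : ∃ m, k = m + 1 := ⟨k - 1, by omega⟩
      refine ⟨hT.diff.smooth, hT.diff.2.1, ?_⟩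
      have hSS := AgreeToOrder.sum hΩ Finset.univ fun i _ => AgreeToOrder.sum hΩ Finset.univ
        fun l _ => (hS l i).mul hΩ (hS i l)
      refine (hSS.diff.const_mul hΩ (-1)).congr hΩ fun y hy => ?_
      have e1 := hR y hy (.inr (.inr ())) (.inr (.inr ()))
      have e2 := hR' y hy (.inr (.inr ())) (.inr (.inr ()))
      simp only [ambRicci] at e1 e2
      rw [hσ, AgreeToOrder.dirDeriv_sub hΩ hT.left hT.right hy,
        dirDeriv_sum fun i _ => mdifferentiableAt_of_smooth hΩ (hS i i).left hy,
        dirDeriv_sum fun i _ => mdifferentiableAt_of_smooth hΩ (hS i i).right hy]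
      linear_combination e1 - e2
    · have h0 : ((k : ℝ) + 1 - n) ≠ 0 := by
        rw [sub_ne_zero, hn_def]; exact_mod_cast hk
      exact (htr.const_mul hΩ ((k : ℝ) + 1 - n)⁻¹).congr hΩ fun y _ => inv_mul_cancel_left₀ h0 _
  refine ⟨(h i j).left, (h i j).right, (h i j).diff.smooth, (h i j).diff.2.1, ?_⟩
  -- This is where `n` must be odd: for even `n` the step `k + 1 = n/2` is obstructed.
  have h0 : ((k : ℝ) + 1 - n / 2) ≠ 0 := by
    intro h0
    have : (2 * (k + 1) : ℝ) = n := by linear_combination 2 * h0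
    rw [hn_def] at this
    have : 2 * (k + 1) = Fintype.card κ := by exact_mod_cast this
    rw [← this] at hodd
    exact (Nat.not_odd_iff_even.2 (even_two_mul _)) hodd
  refine (((key i j).add hΩ (VanishesToOrder.mul hΩ (h i j).left hσ1)).const_mul hΩ
    ((k : ℝ) + 1 - n / 2)⁻¹).congr hΩ fun y hy => ?_
  rw [AgreeToOrder.dirDeriv_sub hΩ (h i j).left (h i j).right hy, sub_add_cancel,
    inv_mul_cancel_left₀ h0]

end Uniqueness

/-! ### From equal jets to equal metrics -/

section AnalyticUniqueness

set_option linter.unusedSectionVars false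

variable {E : Type*} [NormedAddCommGroup E] [NormedSpace ℝ E] [CompleteSpace E]
  {G : Type*} [TopologicalSpace G] [ChartedSpace E G] [Group G] [LieGroup 𝓘(ℝ, E) ∞ G]
  {κ : Type*} [Fintype κ] [DecidableEq κ]

/-- Vanishing of all derivatives kills the germ at 0, and the identity theorem carries this along
the segment from 0 to `c`. -/
theorem eq_zero_of_iteratedDeriv_eq_zero {f : ℝ → ℝ} {c : ℝ}
    (hf : ∀ s ∈ Set.Icc (0 : ℝ) 1, AnalyticAt ℝ f (s * c))
    (h0 : ∀ j, iteratedDeriv j f 0 = 0) : f c = 0 := by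
  have hf0 : AnalyticAt ℝ f 0 := by simpa using hf 0 (by simp)
  have hev : f =ᶠ[𝓝 0] 0 := by
    refine analyticOrderAt_eq_top.1 (ENat.eq_top_iff_forall_ge.2 fun n => ?_)
    exact (natCast_le_analyticOrderAt_iff_iteratedDeriv_eq_zero hf0).2 fun i _ => h0 i
  have hU : IsPreconnected ((fun s : ℝ => s * c) '' Set.Icc 0 1) :=
    isPreconnected_Icc.image _ (by fun_prop)
  have ha : AnalyticOnNhd ℝ f ((fun s : ℝ => s * c) '' Set.Icc 0 1) := by
    rintro _ ⟨s, hs, rfl⟩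
    exact hf s hs
  exact ha.eqOn_zero_of_preconnected_of_eventuallyEq_zero hU ⟨0, by simp⟩ hev ⟨1, by simp⟩

theorem IsNormalForm.mono {m : ℕ∞ω} {g : BilinField 𝓘(ℝ, E) G} {γ : BilinFamily E G}
    {Ω Ω' : Set (G × ℝ)} (h : IsNormalForm m g γ Ω) (hs : Ω' ⊆ Ω) : IsNormalForm m g γ Ω' where
  symm y hy := h.symm y (hs hy)
  nondeg y hy := h.nondeg y (hs hy)
  contMDiffOn v w := (h.contMDiffOn v w).mono hs
  initial x hx := h.initial x (hs hx)

variable (b : Module.Basis κ ℝ (GroupLieAlgebra 𝓘(ℝ, E) G)) {Ω : Set (G × ℝ)}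

theorem IsNormalForm.det_ne_zero {m : ℕ∞ω} {g : BilinField 𝓘(ℝ, E) G} {γ : BilinFamily E G}
    (h : IsNormalForm m g γ Ω) {y : G × ℝ} (hy : y ∈ Ω) : (slMat (famGram b γ) y).det ≠ 0 := by
  intro hdet
  obtain ⟨c, hc, hc0⟩ := Matrix.exists_vecMul_eq_zero_iff.2 hdet
  have hv := h.nondeg y hy (∑ i, c i • leftFrame b i y.1) fun w => by
    rw [tangent_eq_sum b y.1 w, family_eq_sum, Finset.sum_comm]
    refine Finset.sum_eq_zero fun j _ => ?_
    have := congrFun hc0 j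
    simp only [Matrix.vecMul, dotProduct, slMat, Matrix.of_apply, Pi.zero_apply] at this
    calc _ = b.repr (toLieAlgebra y.1 w) j * ∑ i, c i * famGram b γ i j y := by
          rw [Finset.mul_sum]; exact Finset.sum_congr rfl fun i _ => by ring
      _ = 0 := by rw [this, mul_zero]
  refine hc (funext fun j => ?_)
  have := congrArg (coframe b j y.1) hv
  simpa [coframe_leftFrame] using this

/-- In odd dimensions, a Ricci-flat ambient metric that is analytic in `ρ` is determined by the
metric for `ρ = 0`. -/
theorem ambient_unique (hodd : Odd (Fintype.card κ)) (hn : 2 ≤ Fintype.card κ) (hΩ : IsOpen Ω)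
    (hstar : ∀ x ρ, (x, ρ) ∈ Ω → ∀ s ∈ Set.Icc (0 : ℝ) 1, (x, s * ρ) ∈ Ω)
    {g : BilinField 𝓘(ℝ, E) G} {γ γ' : BilinFamily E G}
    (hγ : IsNormalForm ∞ g γ Ω) (hγ' : IsNormalForm ∞ g γ' Ω)
    (ha : IsAnalyticInRho γ Ω) (ha' : IsAnalyticInRho γ' Ω)
    (hR : IsAmbientRicciFlat b γ Ω) (hR' : IsAmbientRicciFlat b γ' Ω) {y : G × ℝ} (hy : y ∈ Ω) :
    γ y.1 y.2 = γ' y.1 y.2 := by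
  have hsm : ∀ {γ : BilinFamily E G}, IsNormalForm ∞ g γ Ω → ∀ i j,
      ContMDiffOn (sliceModel E) 𝓘(ℝ, ℝ) ∞ (famGram b γ i j) Ω :=
    fun h i j => h.contMDiffOn (b i) (b j)
  have hsy : ∀ {γ : BilinFamily E G}, IsNormalForm ∞ g γ Ω → ∀ y ∈ Ω, ∀ i j,
      famGram b γ i j y = famGram b γ j i y := fun h y hy i j => h.symm y hy _ _
  have hflat : ∀ {γ : BilinFamily E G}, IsNormalForm ∞ g γ Ω → IsAmbientRicciFlat b γ Ω →
      ∀ y ∈ Ω, ∀ J K, ambRicci b (famGram b γ) J K y = 0 := fun {γ} h hR y hy J K => by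
    rw [← hR J K (1, y) one_pos hy, ricci_ambientFrame b hΩ
      (fun i j => (hsm h i j).of_le two_le_infty) (hsy h) (fun y hy => h.det_ne_zero b hy)
      (P := (1, y)) one_pos hy]
  -- Order 1 is the common initial value `g`; every further order is one application of the
  -- induction step.
  have hagree : ∀ k i j, AgreeToOrder E Ω (k + 1) (famGram b γ i j) (famGram b γ' i j) := by
    intro k
    induction k with
    | zero =>
      refine fun i j => ⟨hsm hγ i j, hsm hγ' i j, (hsm hγ i j).sub (hsm hγ' i j), fun x hx => ?_,
        smooth_dirDeriv_liftR hΩ ((hsm hγ i j).sub (hsm hγ' i j))⟩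
      simp only [famGram, hγ.initial x hx, hγ'.initial x hx, sub_self]
    | succ k ih =>
      exact agreeToOrder_succ hΩ hodd hn (fun y hy => hγ.det_ne_zero b hy)
        (fun y hy => hγ'.det_ne_zero b hy) (hsy hγ) (hflat hγ hR) (hflat hγ' hR') ih
  have hgram : ∀ i j, famGram b γ i j y = famGram b γ' i j y := by
    intro i j
    have hz : (y.1, (0 : ℝ)) ∈ Ω := by simpa using hstar y.1 y.2 hy 0 (by simp)
    refine sub_eq_zero.1 (eq_zero_of_iteratedDeriv_eq_zero
      (f := fun s => famGram b γ i j (y.1, s) - famGram b γ' i j (y.1, s)) (c := y.2)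
      (fun s hs => ?_) fun j' =>
        (hagree j' i j).diff.iteratedDeriv_eq_zero hΩ hz (Nat.lt_succ_self j'))
    exact (ha _ (hstar y.1 y.2 hy s hs) (leftFrame b i y.1) (leftFrame b j y.1)).fun_sub
      (ha' _ (hstar y.1 y.2 hy s hs) (leftFrame b i y.1) (leftFrame b j y.1))
  refine LinearMap.ext₂ fun v w => ?_
  rw [tangent_eq_sum b y.1 v, tangent_eq_sum b y.1 w, family_eq_sum, family_eq_sum]
  simp only [hgram]

end AnalyticUniqueness

end

/-! ### Assembly -/

theorem mainTheorem6
    {𝔥 𝔨 : Type*} [LieRing 𝔥] [LieAlgebra ℝ 𝔥] [LieRing 𝔨] [LieAlgebra ℝ 𝔨]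
    (h_nilp : ∀ x y z : 𝔨, ⁅x, ⁅y, z⁆⁆ = 0)
    (φ : 𝔥 →ₗ⁅ℝ⁆ LieDerivation ℝ 𝔨 𝔨)
    {E : Type*} [NormedAddCommGroup E] [NormedSpace ℝ E] [FiniteDimensional ℝ E]
    {G : Type*} [TopologicalSpace G] [ChartedSpace E G] [Group G] [LieGroup 𝓘(ℝ, E) ∞ G]
    (ψ : LieAlgebra.SemiDirectSum 𝔨 𝔥 φ ≃ₗ⁅ℝ⁆ GroupLieAlgebra 𝓘(ℝ, E) G)
    (p r : ℕ) (hn : 3 ≤ 2 * p + r)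
    (bh : Module.Basis (Fin p) ℝ 𝔥) (bk : Module.Basis (Fin p ⊕ Fin r) ℝ 𝔨)
    (h_centre : Submodule.span ℝ (Set.range fun a : Fin p => bk (Sum.inl a))
      = (LieAlgebra.center ℝ 𝔨).toSubmodule)
    (gz : Matrix (Fin p) (Fin p) ℝ) (gm : Matrix (Fin r) (Fin r) ℝ)
    (hgz : IsUnit gz.det) (hgm : IsUnit gm.det) (hgm_symm : gm.IsSymm)
    (b : Module.Basis (AdaptedIndex p r) ℝ (GroupLieAlgebra 𝓘(ℝ, E) G))
    (hb : b = (adaptedBasis φ bk bh).map ψ.toLinearEquiv) :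
    -- where the series converge, the metric is a Ricci-flat ambient metric
    (∀ F : Fin p → Fin p → G → ℝ, IsAdmissible b F →
      ∀ Ω : Set (G × ℝ), IsOpen Ω → (∀ a c, SeriesConverges b gm (F a c) Ω) →
        IsNormalForm (if Even (2 * p + r) then ∞ else 2) (leftMetric b gz gm)
            (ambientFamily b gz gm fun a c => serSum b gm (F a c)) Ω
          ∧ IsNormalForm ∞ (leftMetric b gz gm)
            (ambientFamily b gz gm fun a c => serSum b gm (F a c)) (Ω ∩ {y | y.2 ≠ 0})
          ∧ IsAmbientRicciFlat b
            (ambientFamily b gz gm fun a c => serSum b gm (F a c)) Ω)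
    -- for arbitrary functions, the equation holds to all orders of the series
    ∧ (∀ F : Fin p → Fin p → G → ℝ, IsAdmissible b F → ∀ N : ℕ,
        IsNormalForm (if Even (2 * p + r) then ∞ else 2) (leftMetric b gz gm)
            (ambientFamily b gz gm fun a c => serPartial b gm N (F a c)) Set.univ
          ∧ ∀ i j, ∀ P : ℝ × G × ℝ, 0 < P.1 → P.2.2 = 0 →
            (fun Q : ℝ × G × ℝ => ricci (ambientMetric (ambientFamily b gz gm
                fun a c => serPartial b gm N (F a c))) (ambientFrame b) i j Q)
              =O[𝓝 P] fun Q => halfPow (2 * p + r) Q.2.2 * Q.2.2 ^ N)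
    -- the case `F = 0`
    ∧ (IsNormalForm ∞ (leftMetric b gz gm) (ambientFamily b gz gm 0) Set.univ
        ∧ IsAnalyticInRho (ambientFamily b gz gm 0) Set.univ
        ∧ IsAmbientRicciFlat b (ambientFamily b gz gm 0) Set.univ)
    -- uniqueness of the analytic Ricci-flat ambient metric in odd dimensions
    ∧ (Odd (2 * p + r) → ∀ Ω : Set (G × ℝ), IsOpen Ω →
        (∀ x ρ, (x, ρ) ∈ Ω → ∀ s ∈ Set.Icc (0 : ℝ) 1, (x, s * ρ) ∈ Ω) →
        ∀ γ : BilinFamily E G, IsNormalForm ∞ (leftMetric b gz gm) γ Ω →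
          IsAnalyticInRho γ Ω → IsAmbientRicciFlat b γ Ω →
          ∀ y ∈ Ω, γ y.1 y.2 = ambientFamily b gz gm 0 y.1 y.2) := by
  have : CompleteSpace E := FiniteDimensional.complete ℝ E
  -- From `r ≠ 1`, `p ≥ 1` and `n = 2p + r ≥ 3` it follows that `n ≥ 4`.
  obtain ⟨hr, hp⟩ := one_le_of_centre h_nilp hn h_centre
  have hn4 : 4 ≤ 2 * p + r := by omega
  have hgr : IsGradedBasis b := by
    intro k i j hk
    rw [hb, structConst_map] at hk
    exact isGradedBasis_adaptedBasis φ bh h_nilp h_centre k i j hk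
  have h0 := isNormalForm_zero (b := b) hn4 hgz hgm hgm_symm
  have hflat := isAmbientRicciFlat_zero hgr hn4 hgz hgm hgm_symm
  have hana := isAnalyticInRho_zero b gz gm
  have hcard : Fintype.card (AdaptedIndex p r) = 2 * p + r := by
    simp only [Fintype.card_sum, Fintype.card_fin]; ring
  refine ⟨fun F hF Ω hΩ hc => convergent_solution hgr hn4 hgz hgm hgm_symm hF hΩ hc,
    fun F hF N => formal_solution hgr hn4 hgz hgm hgm_symm hF N, ⟨h0, hana, hflat⟩,
    fun hodd Ω hΩ hstar γ hγ ha hR y hy => ?_⟩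
  exact ambient_unique b (hcard ▸ hodd) (by omega) hΩ hstar hγ (h0.mono (Set.subset_univ Ω)) ha
    (fun y _ => hana y trivial) hR (fun i j P hP _ => hflat i j P hP trivial) hy
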